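/- **Setting.** Let $G$ be a countable set with weights $\omega_{xy}=\omega_{yx}\ge 0$ ($x,y\in G$); write $x\sim y$ if $\omega_{xy}>0$. Assume that this graph is connected and that every vertex has at most $M$ neighbours. Let $d(\cdot,\cdot)$ be the graph distance, $B(x,R)=\{y: d(x,y)<R\}$ for real $R>0$, and for $A\subset G$ let $\overline A$ be $A$ together with all neighbours of points of $A$. Put $\pi(x)=\sum_{y}\omega_{xy}$, and let $\tilde d(x,y)$ be the infimum over paths $x=x_0\sim x_1\sim\dots\sim x_m=y$ of $\sum_{i<m} \bigl(1\wedge\omega_{x_ix_{i+1}}^{-1/2}\bigr)$, with $\tilde B(x,R)=\{y:\tilde d(x,y)<R\}$. Fix $\theta=\pi$ (constant speed walk, CSRW) or $\theta\equiv1$ (variable speed walk, VSRW), and let $\theta(A)=\sum_{x\in A}\theta(x)$. Let $X$ be the continuous time Markov chain on $G$ that jumps from $x$ to $y$ with probability $\omega_{xy}/\pi(x)$ after an exponential holding time at $x$, of mean $1$ (CSRW) or $\pi(x)^{-1}$ (VSRW); after a possible explosion $X$ is in no vertex. Let $$p_t(x,y)=P^x(X_t=y)/\theta(y),\qquad \tau_A=\inf\{t\ge0:X_t\notin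 A\},\qquad \mathcal L_\theta f(x)=\frac1{\theta(x)}\sum_y (f(y)-f(x))\,\omega_{xy}.$$ **Assumption at $x_0\in G$**, with a real number $\mathsf d>0$ and positive constants $\delta,c_1,\dots,c_5,C_E,\kappa$. There are $T_0,R_0,R_1,R_2,R_3,R_4\in[1,\infty)$, which may depend on $G,\omega,x_0$, such that: 1. $p_t(x,y)\le c_1t^{-\mathsf d/2}$ for all $t\ge T_0$ and $x,y\in B(x_0,t^{(1+\delta)/2})$. 2. For all $r\ge R_0$: in the CSRW case $c_2r^2\le E^x[\tau_{B(x,r)}]$ for all $x\in B(x_0,r^{1+\delta})$; in the VSRW case $c_2r^2\le E^x[\tau_{\tilde B(x,r)}]$ for all $x\in\tilde B(x_0,r^{1+\delta})$. 3. If $R\ge R_1$ and $h$ is a positive function on $\overline{B(x_0,R)}$ with $\mathcal L_\theta h=0$ on $B(x_0,R)$, then $\sup_{B(x_0,R/2)}h\le C_E\inf_{B(x_0,R/2)}h$. 4. $c_3R^{\mathsf d}\le\theta(B(x_0,R))$ and $\sup_{x\in B(x_0,R^{1+\delta})}\theta(B(x,R))\le c_4R^{\mathsf d}$ for all $R\ge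 R_2$. 5. CSRW case: $\min_{x\in B(x_0,R)}\pi(x)\ge R^{-\kappa}$ for all $R\ge R_3$. VSRW case: $\tilde d(x,y)\ge c_5\,d(x,y)$ whenever $R\ge R_4$, $x\in B(x_0,R)$ and $d(x,y)\ge R$. **Theorem 1.5 (parabolic Harnack inequality).** There are constants $c>0$ and $C_*\ge2$, depending only on the choice of CSRW or VSRW and on $\mathsf d,M,\delta,c_1,\dots,c_5,C_E,\kappa$, such that for every weighted graph as above and every $x_0\in G$ that satisfies the assumption there is $R_5=R_5(x_0)\in[1,\infty)$ with the following property. Let $R\ge R_5$, $T=R^2$, and let $u(t,y)$ be a non-negative function on $[0,4T]\times\overline{B(x_0,C_*R)}$ that is caloric on $Q(x_0,R,T)=(0,4T]\times B(x_0,C_*R)$; that is, for each $y\in B(x_0,C_*R)$, $\partial_tu(t,y)=\mathcal L_\theta u(t,y)$ for all $t\in(0,4T)$, and $t\mapsto u(t,y)$ is continuous on $(0,4T]$. Then $u$ is bounded on $[T,2T]\times B(x_0,R)$, and $$\sup_{[T,2T]\times B(x_0,R)}u\;\le\; c\inf_{[3T,4T]\times B(x_0,R)}u .$$ -/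

import Mathlib

open MeasureTheory ProbabilityTheory
open scoped ENNReal

namespace RCM

noncomputable section

/-- Symmetric non-negative weights (conductances) on a vertex set `G`.
Vertices `x`, `y` are neighbours iff `0 < ω x y`. -/
structure WeightedGraph (G : Type*) where
  ω : G → G → ℝ
  symm : ∀ x y, ω x y = ω y x
  nonneg : ∀ x y, 0 ≤ ω x y

/-- The two time parametrizations: constant speed and variable speed random walk. -/
inductive WalkSpeed
  | csrw
  | vsrw

namespace WeightedGraph

variable {G : Type*} (W : WeightedGraph G)

/-- The underlying simple graph (loops play no role for paths and distances). -/
def graph : SimpleGraph G where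
  Adj x y := x ≠ y ∧ 0 < W.ω x y
  symm := ⟨fun x y h => ⟨h.1.symm, by rw [W.symm y x]; exact h.2⟩⟩
  loopless := ⟨fun _ h => h.1 rfl⟩

/-- Every vertex has at most `M` neighbours. -/
def DegreeLE (M : ℕ) : Prop := ∀ x, {y | 0 < W.ω x y}.encard ≤ M

/-- The total weight `π(x) = ∑_{y ∼ x} ω_{xy}` of a vertex. -/
def weight (x : G) : ℝ := ∑' y, W.ω x y

/-- The reference measure at a vertex: `π` for the CSRW, `ν ≡ 1` for the VSRW. -/
def theta (s : WalkSpeed) (x : G) : ℝ :=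
  match s with
  | .csrw => W.weight x
  | .vsrw => 1

/-- `θ(A) = ∑_{x ∈ A} θ(x)`. -/
def thetaSet (s : WalkSpeed) (A : Set G) : ℝ := ∑' x : A, W.theta s x

/-- The open ball `{y | d(x,y) < R}` of the graph distance. -/
def ball (x : G) (R : ℝ) : Set G := {y | (W.graph.dist x y : ℝ) < R}

/-- A set of vertices together with all neighbours of its points. -/
def closure (A : Set G) : Set G := A ∪ {y | ∃ x ∈ A, 0 < W.ω x y}

/-- The distance `d̃`: infimum over paths of the sum of `1 ∧ ω^{-1/2}` along the edges. -/
def dTilde (x y : G) : ℝ :=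
  ⨅ p : W.graph.Walk x y,
    (p.darts.map fun e => min 1 (1 / Real.sqrt (W.ω e.fst e.snd))).sum

/-- The open ball of `d̃`. -/
def ballTilde (x : G) (R : ℝ) : Set G := {y | W.dTilde x y < R}

/-- The discrete Laplacian `L_θ f(x) = θ(x)⁻¹ ∑_y (f(y) - f(x)) ω_{xy}`. -/
def laplacian (s : WalkSpeed) (f : G → ℝ) (x : G) : ℝ :=
  1 / W.theta s x * ∑' y, (f y - f x) * W.ω x y

/-- `h` is harmonic on `A`. -/
def HarmonicOn (s : WalkSpeed) (h : G → ℝ) (A : Set G) : Prop :=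
  ∀ x ∈ A, W.laplacian s h x = 0

/-! ### The random walks -/

open scoped Classical in
/-- One jump from `x`: the law `y ↦ ω_{xy} / π(x)` (staying at `x` if `x` has no neighbour). -/
def jumpPMF (x : G) : PMF G :=
  if h : (∑' y, ENNReal.ofReal (W.ω x y)) ≠ 0 ∧ (∑' y, ENNReal.ofReal (W.ω x y)) ≠ ∞ then
    PMF.normalize (fun y => ENNReal.ofReal (W.ω x y)) h.1 h.2
  else PMF.pure x

variable [Countable G] [MeasurableSpace G] [DiscreteMeasurableSpace G]

/-- The jump law as a Markov kernel. -/
def jumpKernel : Kernel G G := Kernel.ofFunOfCountable fun x => (W.jumpPMF x).toMeasure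

instance : IsMarkovKernel W.jumpKernel :=
  ⟨fun x => by unfold jumpKernel; exact PMF.toMeasure.isProbabilityMeasure (W.jumpPMF x)⟩

/-- The jump law given the past, which depends on the last position only. -/
def stepKernel (n : ℕ) : Kernel ((i : Finset.Iic n) → G) G :=
  W.jumpKernel.comap (fun h => h ⟨n, Finset.mem_Iic.2 le_rfl⟩) (measurable_pi_apply _)

instance (n : ℕ) : IsMarkovKernel (W.stepKernel n) := by
  unfold stepKernel; infer_instance

/-- The law of the embedded jump chain `Y₀, Y₁, …` started at `x`. -/
def jumpChainLaw (x : G) : Measure (ℕ → G) :=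
  Kernel.trajMeasure (X := fun _ => G) (Measure.dirac x) W.stepKernel

/-- The law `P^x`: the jump chain `Y` started at `x` and, independently of it, a sequence `e` of
independent exponential variables of mean one. -/
def pathLaw (x : G) : Measure ((ℕ → G) × (ℕ → ℝ)) :=
  (W.jumpChainLaw x).prod (Measure.infinitePi fun _ : ℕ => expMeasure 1)

instance (x : G) : IsProbabilityMeasure (W.jumpChainLaw x) := by
  unfold jumpChainLaw; infer_instance

instance (x : G) : IsProbabilityMeasure (W.pathLaw x) := by
  have : ∀ _ : ℕ, IsProbabilityMeasure (expMeasure 1) :=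
    fun _ => isProbabilityMeasure_expMeasure one_pos
  unfold pathLaw; infer_instance

/-- The walk started at `x` has initial position `x`. -/
theorem jumpChainLaw_map_zero (x : G) :
    (W.jumpChainLaw x).map (fun Y => Y 0) = Measure.dirac x := by
  unfold jumpChainLaw
  have h := Kernel.traj_map_frestrictLe (X := fun _ => G) (κ := W.stepKernel) 0 0
  rw [Kernel.partialTraj_self] at h
  have e : (fun Y : ℕ → G => Y 0) =
      (fun z : (i : Finset.Iic 0) → G => z ⟨0, Finset.mem_Iic.2 le_rfl⟩) ∘
        Preorder.frestrictLe (π := fun _ => G) 0 := rfl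
  rw [e, ← Measure.map_map (measurable_pi_apply _) (by fun_prop), Kernel.trajMeasure,
    Measure.map_comp _ _ (by fun_prop), h, Measure.id_comp,
    Measure.map_map (measurable_pi_apply _) (by fun_prop)]
  exact Measure.map_id

/-- The rate at which the walk leaves a position: `1` for the CSRW, `π(x)` for the VSRW. -/
def rate (s : WalkSpeed) (x : G) : ℝ :=
  match s with
  | .csrw => 1
  | .vsrw => W.weight x

end WeightedGraph

namespace WeightedGraph

variable {G : Type*} (W : WeightedGraph G)

/-- The `n`-th holding time `e n / rate (Y n)`, exponential with mean `1 / rate (Y n)` given `Y`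
(infinite if the rate is zero). -/
def holdTime (s : WalkSpeed) (p : (ℕ → G) × (ℕ → ℝ)) (n : ℕ) : ℝ≥0∞ :=
  ENNReal.ofReal (p.2 n) / ENNReal.ofReal (W.rate s (p.1 n))

/-- The time of the `n`-th jump. -/
def jumpTime (s : WalkSpeed) (p : (ℕ → G) × (ℕ → ℝ)) (n : ℕ) : ℝ≥0∞ :=
  ∑ k ∈ Finset.range n, W.holdTime s p k

/-- `X_t = y`: at time `t` the walk sits at `y`. For each `t` there is at most one such `y`, and
there is none exactly if infinitely many jumps have occurred by time `t`. -/
def IsAt (s : WalkSpeed) (p : (ℕ → G) × (ℕ → ℝ)) (t : ℝ≥0∞) (y : G) : Prop :=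
  ∃ n, W.jumpTime s p n ≤ t ∧ t < W.jumpTime s p (n + 1) ∧ p.1 n = y

/-- The exit time `τ_A = inf {t ≥ 0 : X_t ∉ A}`. -/
def exitTime (s : WalkSpeed) (A : Set G) (p : (ℕ → G) × (ℕ → ℝ)) : ℝ≥0∞ :=
  sInf {t | ¬ ∃ y ∈ A, W.IsAt s p t y}

variable [Countable G] [MeasurableSpace G] [DiscreteMeasurableSpace G]

/-- The heat kernel `p_t(x,y) = P^x(X_t = y) / θ(y)`. -/
def heatKernel (s : WalkSpeed) (t : ℝ) (x y : G) : ℝ :=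
  (W.pathLaw x {p | W.IsAt s p (ENNReal.ofReal t) y}).toReal / W.theta s y

/-- The mean exit time `E^x[τ_A]`. -/
def meanExitTime (s : WalkSpeed) (A : Set G) (x : G) : ℝ≥0∞ :=
  ∫⁻ p, W.exitTime s A p ∂(W.pathLaw x)

end WeightedGraph

/-- The constants in the standing assumption. `κ` is used for the CSRW only and `c₅` for the VSRW
only. -/
structure Constants where
  δ : ℝ
  c₁ : ℝ
  c₂ : ℝ
  c₃ : ℝ
  c₄ : ℝ
  c₅ : ℝ
  CE : ℝ
  κ : ℝ
  δ_pos : 0 < δ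
  c₁_pos : 0 < c₁
  c₂_pos : 0 < c₂
  c₃_pos : 0 < c₃
  c₄_pos : 0 < c₄
  c₅_pos : 0 < c₅
  CE_pos : 0 < CE
  κ_pos : 0 < κ

namespace WeightedGraph

variable {G : Type*} (W : WeightedGraph G)

/-- On-diagonal upper bound of order `t^{-d/2}` for the heat kernel near `x₀` at large times. -/
def HeatKernelUpper [Countable G] [MeasurableSpace G] [DiscreteMeasurableSpace G]
    (s : WalkSpeed) (d : ℝ) (k : Constants) (x₀ : G) : Prop :=
  ∃ T₀ : ℝ, 1 ≤ T₀ ∧ ∀ t ≥ T₀,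
    ∀ x ∈ W.ball x₀ (t ^ ((1 + k.δ) / 2)), ∀ y ∈ W.ball x₀ (t ^ ((1 + k.δ) / 2)),
      W.heatKernel s t x y ≤ k.c₁ * t ^ (-d / 2)

/-- The balls in which exit times are measured: `d`-balls for the CSRW, `d̃`-balls for the VSRW. -/
def exitBall (s : WalkSpeed) (x : G) (r : ℝ) : Set G :=
  match s with
  | .csrw => W.ball x r
  | .vsrw => W.ballTilde x r

/-- Quadratic lower bound for mean exit times from balls. -/
def ExitTimeLower [Countable G] [MeasurableSpace G] [DiscreteMeasurableSpace G]
    (s : WalkSpeed) (k : Constants) (x₀ : G) : Prop :=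
  ∃ R₀ : ℝ, 1 ≤ R₀ ∧ ∀ r ≥ R₀, ∀ x ∈ W.exitBall s x₀ (r ^ (1 + k.δ)),
    ENNReal.ofReal (k.c₂ * r ^ 2) ≤ W.meanExitTime s (W.exitBall s x r) x

/-- The elliptic Harnack inequality on balls centred at `x₀`. -/
def EllipticHarnack (s : WalkSpeed) (k : Constants) (x₀ : G) : Prop :=
  ∃ R₁ : ℝ, 1 ≤ R₁ ∧ ∀ R ≥ R₁, ∀ h : G → ℝ,
    (∀ x ∈ W.closure (W.ball x₀ R), 0 < h x) → W.HarmonicOn s h (W.ball x₀ R) →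
      sSup (h '' W.ball x₀ (R / 2)) ≤ k.CE * sInf (h '' W.ball x₀ (R / 2))

/-- Volume growth of order `R^d`. -/
def VolumeGrowth (s : WalkSpeed) (d : ℝ) (k : Constants) (x₀ : G) : Prop :=
  ∃ R₂ : ℝ, 1 ≤ R₂ ∧ ∀ R ≥ R₂,
    k.c₃ * R ^ d ≤ W.thetaSet s (W.ball x₀ R) ∧
    ∀ x ∈ W.ball x₀ (R ^ (1 + k.δ)), W.thetaSet s (W.ball x R) ≤ k.c₄ * R ^ d

/-- CSRW: polynomial lower bound on the vertex weights. VSRW: `d̃` dominates a multiple of `d`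
at large distances. -/
def LocalRegularity (s : WalkSpeed) (k : Constants) (x₀ : G) : Prop :=
  match s with
  | .csrw => ∃ R₃ : ℝ, 1 ≤ R₃ ∧ ∀ R ≥ R₃, ∀ x ∈ W.ball x₀ R, R ^ (-k.κ) ≤ W.weight x
  | .vsrw => ∃ R₄ : ℝ, 1 ≤ R₄ ∧ ∀ R ≥ R₄, ∀ x ∈ W.ball x₀ R, ∀ y,
      R ≤ (W.graph.dist x y : ℝ) → k.c₅ * (W.graph.dist x y : ℝ) ≤ W.dTilde x y

/-- The standing assumption at the distinguished point `x₀`, with constants `k`. -/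
structure StandingAssumption [Countable G] [MeasurableSpace G] [DiscreteMeasurableSpace G]
    (s : WalkSpeed) (d : ℝ) (k : Constants) (x₀ : G) : Prop where
  heatKernelUpper : W.HeatKernelUpper s d k x₀
  exitTimeLower : W.ExitTimeLower s k x₀
  ellipticHarnack : W.EllipticHarnack s k x₀
  volumeGrowth : W.VolumeGrowth s d k x₀
  localRegularity : W.LocalRegularity s k x₀

/-- `u` is caloric on `Q = (0,4T] × B(x, C R)`: it solves `∂_t u = L_θ u` at all times
`t ∈ (0,4T)` at all points of the ball, and is continuous in time up to the final time `4T`. -/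
def Caloric (s : WalkSpeed) (C : ℝ) (x : G) (R T : ℝ) (u : ℝ × G → ℝ) : Prop :=
  ∀ y ∈ W.ball x (C * R),
    (∀ t ∈ Set.Ioo 0 (4 * T),
      HasDerivAt (fun r => u (r, y)) (W.laplacian s (fun z => u (t, z)) y) t) ∧
    ContinuousOn (fun r => u (r, y)) (Set.Ioc 0 (4 * T))

/-- `Q_- = [T, 2T] × B(x,R)`. -/
def Qminus (x : G) (R T : ℝ) : Set (ℝ × G) := Set.Icc T (2 * T) ×ˢ W.ball x R

/-- `Q_+ = [3T, 4T] × B(x,R)`. -/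
def Qplus (x : G) (R T : ℝ) : Set (ℝ × G) := Set.Icc (3 * T) (4 * T) ×ˢ W.ball x R

end WeightedGraph

end

end RCM

/-!
# The parabolic Harnack inequality at a point

The proof works on finite domains around `x₀`: at scale `r` the domain `D` is the ball in which the
exit time is measured. On `D` the heat kernel of the killed walk, `Regular.killed`, is a finite sum
over Dirichlet eigenfunctions, so that all semigroup identities are algebra. Two facts connect it with
the random walk: it is dominated by the heat kernel of the walk (`Regular.killed_le_heatKernel`), and
mean exit times are dominated by solutions of `L v = -1` (`Regular.meanExitTime_le`). Both are proved by
decomposing at the first jump. Everything else is analysis on `D`, with the assumptions at `x₀`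
collected in `Scales`.

*On-diagonal lower bound* (`exists_diag_lower`). The upper bound and the volume bound give a
probability at least `1/2` of leaving `D` by time `K r²`, hence a torsion function of size `r²`. The exit
time assumption then bounds the survival probability at a time of order `r²` from below, and
Cauchy-Schwarz turns this into `p_t(x₀, x₀) ≥ c r^{-d}` for `t ≤ c₂ r²`.

*Continuity* (`exists_killed_osc_le`). On a small ball `p_t(·, y)` is a harmonic function plus the
solution of a Poisson equation with right-hand side of order `t⁻¹ r^{-d}`. The elliptic Harnack
inequality makes the oscillation of the harmonic part small on a much smaller ball. This gives the
near-diagonal lower bound `exists_near_diag_lower`.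

*Lower bound* (`exists_killed_lower`). With `R = l r`, the near-diagonal bound gives
`p_t(x, x₀) ≥ c r^{-d}` on the ball of radius `3R`, but only at a time `t` that is long compared with
`R²`. A sum of decaying exponentials with bounded coefficients that is of order one at some time was of
order one at some much earlier time as well (`exists_earlier`). Continuity in space and chaining
through a small ball around `x₀` then give the lower bound at all times of order `R²`.

*Off-diagonal upper bound* (`exists_killed_far_le`). Davies' weighted `ℓ²` estimates, iterated over
dyadic times, give `p_t(x, y) ≤ C r^{-d}` at distances of order `r`, at all times down to zero. The
on-diagonal bound holds for times beyond `r^γ` with some `γ < 2`. Before that time the walk has almost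
no chance to travel so far, and the polynomial lower bound for the weights, or the comparison of `d̃`
with `d`, absorbs the remaining factors.

*Balayage* (`Regular.le_of_killed_le`). A non-negative caloric function `u` is replaced by its balayage
from `B(x₀, 3R)`: a function on `D` that agrees with `u` on `B(x₀, 3R)` and whose defect in the heat
equation is a non-negative measure on the inner boundary of that ball. Then `u(t₁, x₁)` and
`u(t₂, x₂)` are integrals of the heat kernels from `(t₁, x₁)` and `(t₂, x₂)` against the same initial
value and the same measure. The first kernel is bounded by a constant multiple of the second: on the
inner boundary by the off-diagonal and the lower bound, at the initial time by the on-diagonal and the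
lower bound.
-/

namespace RCM

noncomputable section

namespace WeightedGraph

/-! ### Locally finite weighted graphs -/

section

variable {G : Type*} {W : WeightedGraph G} {s : WalkSpeed}

/-- The graph is locally finite and no vertex has weight zero, so that `θ > 0` and all sums over
neighbours are finite. -/
structure Regular (W : WeightedGraph G) : Prop where
  locFin : ∀ x, {y | 0 < W.ω x y}.Finite
  weight_pos : ∀ x, 0 < W.weight x

theorem DegreeLE.locFin {M : ℕ} (h : W.DegreeLE M) (x : G) : {y | 0 < W.ω x y}.Finite :=
  Set.finite_of_encard_le_coe (h x)

/-- The finite set of neighbours of a vertex. -/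
def Regular.nbr (hW : W.Regular) (x : G) : Finset G := (hW.locFin x).toFinset

theorem Regular.mem_nbr (hW : W.Regular) {x y : G} : y ∈ hW.nbr x ↔ 0 < W.ω x y := by
  simp [Regular.nbr]

theorem Regular.omega_eq_zero (hW : W.Regular) {x y : G} (h : y ∉ hW.nbr x) : W.ω x y = 0 :=
  le_antisymm (not_lt.1 fun h' => h (hW.mem_nbr.2 h')) (W.nonneg x y)

theorem omega_eq_zero_of_not_pos {x y : G} (h : ¬ 0 < W.ω x y) : W.ω x y = 0 :=
  le_antisymm (not_lt.1 h) (W.nonneg x y)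

theorem Regular.weight_eq (hW : W.Regular) (x : G) : W.weight x = ∑ y ∈ hW.nbr x, W.ω x y :=
  tsum_eq_sum fun _ h => hW.omega_eq_zero h

theorem Regular.sum_omega_mul (hW : W.Regular) {x : G} {D : Finset G} {f : G → ℝ}
    (hD : ∀ y ∉ D, 0 < W.ω x y → f y = 0) :
    ∑ y ∈ hW.nbr x, W.ω x y * f y = ∑ y ∈ D, W.ω x y * f y := by
  classical
  rw [Finset.sum_subset (s₁ := hW.nbr x) (s₂ := hW.nbr x ∪ D) Finset.subset_union_left,
    Finset.sum_subset (s₁ := D) (s₂ := hW.nbr x ∪ D) Finset.subset_union_right]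
  · intro y _ hy
    by_cases h : 0 < W.ω x y
    · rw [hD y hy h, mul_zero]
    · rw [omega_eq_zero_of_not_pos h, zero_mul]
  · intro y _ hy
    rw [hW.omega_eq_zero hy, zero_mul]

theorem Regular.sum_le_weight (hW : W.Regular) (x : G) (D : Finset G) :
    ∑ y ∈ D, W.ω x y ≤ W.weight x := by
  classical
  rw [hW.weight_eq, Finset.sum_subset (s₁ := hW.nbr x) (s₂ := hW.nbr x ∪ D)
    Finset.subset_union_left fun y _ hy => hW.omega_eq_zero hy]
  exact Finset.sum_le_sum_of_subset_of_nonneg Finset.subset_union_right fun y _ _ => W.nonneg x y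

theorem Regular.theta_pos (hW : W.Regular) (s : WalkSpeed) (x : G) : 0 < W.theta s x := by
  cases s
  · exact hW.weight_pos x
  · exact one_pos

theorem Regular.laplacian_eq (hW : W.Regular) (s : WalkSpeed) (f : G → ℝ) (x : G) :
    W.laplacian s f x = 1 / W.theta s x * (∑ y ∈ hW.nbr x, W.ω x y * f y - W.weight x * f x) := by
  unfold laplacian
  rw [tsum_eq_sum (s := hW.nbr x) fun y h => by rw [hW.omega_eq_zero h, mul_zero], hW.weight_eq,
    Finset.sum_mul, ← Finset.sum_sub_distrib]
  congr 1
  exact Finset.sum_congr rfl fun y _ => by ring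

theorem Regular.theta_mul_laplacian (hW : W.Regular) (s : WalkSpeed) (f : G → ℝ) (x : G) :
    W.theta s x * W.laplacian s f x = ∑ y ∈ hW.nbr x, W.ω x y * f y - W.weight x * f x := by
  rw [hW.laplacian_eq]
  field_simp [(hW.theta_pos s x).ne']

/-- The Laplacian of a function that vanishes outside a finite set `D`. -/
theorem Regular.theta_mul_laplacian_of_zero (hW : W.Regular) (s : WalkSpeed) {D : Finset G}
    {f : G → ℝ} (hf : ∀ y ∉ D, f y = 0) (x : G) :
    W.theta s x * W.laplacian s f x = ∑ y ∈ D, W.ω x y * f y - W.weight x * f x := by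
  rw [hW.theta_mul_laplacian, hW.sum_omega_mul fun y hy _ => hf y hy]

theorem Regular.laplacian_congr (hW : W.Regular) {f g : G → ℝ} {x : G} (hx : f x = g x)
    (h : ∀ y, 0 < W.ω x y → f y = g y) : W.laplacian s f x = W.laplacian s g x := by
  rw [hW.laplacian_eq, hW.laplacian_eq, hx]
  congr 2
  exact Finset.sum_congr rfl fun y hy => by rw [h y (hW.mem_nbr.1 hy)]

theorem Regular.laplacian_add (hW : W.Regular) (f g : G → ℝ) (x : G) :
    W.laplacian s (fun y => f y + g y) x = W.laplacian s f x + W.laplacian s g x := by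
  simp only [hW.laplacian_eq, mul_add, Finset.sum_add_distrib]
  ring

theorem Regular.laplacian_sub (hW : W.Regular) (f g : G → ℝ) (x : G) :
    W.laplacian s (fun y => f y - g y) x = W.laplacian s f x - W.laplacian s g x := by
  simp only [hW.laplacian_eq, mul_sub, Finset.sum_sub_distrib]
  ring

theorem Regular.laplacian_const_mul (hW : W.Regular) (c : ℝ) (f : G → ℝ) (x : G) :
    W.laplacian s (fun y => c * f y) x = c * W.laplacian s f x := by
  simp only [hW.laplacian_eq]
  have : ∑ y ∈ hW.nbr x, W.ω x y * (c * f y) = c * ∑ y ∈ hW.nbr x, W.ω x y * f y := by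
    rw [Finset.mul_sum]
    exact Finset.sum_congr rfl fun y _ => by ring
  rw [this]; ring

theorem laplacian_const (c : ℝ) (x : G) :
    W.laplacian s (fun _ => c) x = 0 := by
  simp [laplacian]

theorem Regular.laplacian_sum (hW : W.Regular) {ι : Type*} (S : Finset ι) (f : ι → G → ℝ) (x : G) :
    W.laplacian s (fun y => ∑ i ∈ S, f i y) x = ∑ i ∈ S, W.laplacian s (f i) x := by
  classical
  induction S using Finset.induction_on with
  | empty => simpa using laplacian_const (W := W) (s := s) 0 x
  | insert a S ha ih =>
    simp only [Finset.sum_insert ha]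
    rw [hW.laplacian_add, ih]

/-- At a point where `f` is minimal among the neighbours the Laplacian is non-negative. -/
theorem Regular.laplacian_nonneg_of_le (hW : W.Regular) {f : G → ℝ} {x : G}
    (h : ∀ y, 0 < W.ω x y → f x ≤ f y) : 0 ≤ W.laplacian s f x := by
  unfold laplacian
  refine mul_nonneg (one_div_nonneg.2 (hW.theta_pos s x).le) (tsum_nonneg fun y => ?_)
  by_cases hy : 0 < W.ω x y
  · exact mul_nonneg (sub_nonneg.2 (h y hy)) hy.le
  · rw [omega_eq_zero_of_not_pos hy, mul_zero]

/-- Self-adjointness of the Laplacian on functions supported in a finite set. -/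
theorem Regular.sum_mul_laplacian_comm (hW : W.Regular) (s : WalkSpeed) {D : Finset G}
    {f g : G → ℝ} (hf : ∀ y ∉ D, f y = 0) (hg : ∀ y ∉ D, g y = 0) :
    ∑ x ∈ D, W.laplacian s f x * g x * W.theta s x =
      ∑ x ∈ D, f x * W.laplacian s g x * W.theta s x := by
  have h1 : ∀ x ∈ D, W.laplacian s f x * g x * W.theta s x =
      ∑ y ∈ D, W.ω x y * f y * g x - W.weight x * f x * g x := fun x _ => by
    rw [mul_right_comm, mul_comm (W.laplacian s f x), hW.theta_mul_laplacian_of_zero s hf,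
      sub_mul, Finset.sum_mul]
  have h2 : ∀ x ∈ D, f x * W.laplacian s g x * W.theta s x =
      ∑ y ∈ D, W.ω x y * g y * f x - W.weight x * f x * g x := fun x _ => by
    rw [mul_assoc, mul_comm (W.laplacian s g x), hW.theta_mul_laplacian_of_zero s hg,
      mul_comm, sub_mul, Finset.sum_mul]
    ring
  rw [Finset.sum_congr rfl h1, Finset.sum_congr rfl h2, Finset.sum_sub_distrib,
    Finset.sum_sub_distrib, Finset.sum_comm]
  congr 1
  refine Finset.sum_congr rfl fun x _ => Finset.sum_congr rfl fun y _ => ?_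
  rw [W.symm y x]; ring

/-! ### Graph distance, balls and the metric `d̃` -/

theorem mem_ball {x y : G} {R : ℝ} : y ∈ W.ball x R ↔ (W.graph.dist x y : ℝ) < R := Iff.rfl

theorem mem_ball_self {x : G} {R : ℝ} (h : 0 < R) : x ∈ W.ball x R := by simpa [mem_ball] using h

theorem ball_mono {x : G} {R R' : ℝ} (h : R ≤ R') : W.ball x R ⊆ W.ball x R' :=
  fun _ hy => lt_of_lt_of_le hy h

theorem dist_le_add_one (hc : W.graph.Connected) (x : G) {y z : G} (h : 0 < W.ω y z) :
    (W.graph.dist x z : ℝ) ≤ W.graph.dist x y + 1 := by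
  by_cases hyz : y = z
  · subst hyz; linarith
  · have h1 : W.graph.dist y z = 1 := SimpleGraph.dist_eq_one_iff_adj.2 ⟨hyz, h⟩
    have := hc.dist_triangle (u := x) (v := y) (w := z)
    rw [h1] at this
    exact_mod_cast this

theorem mem_ball_add_one (hc : W.graph.Connected) {x y z : G} {R : ℝ} (hy : y ∈ W.ball x R)
    (h : 0 < W.ω y z) : z ∈ W.ball x (R + 1) := by
  have := dist_le_add_one hc x h
  rw [mem_ball] at *
  linarith

theorem closure_ball_subset (hc : W.graph.Connected) (x : G) (R : ℝ) :
    W.closure (W.ball x R) ⊆ W.ball x (R + 1) := by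
  rintro z (hz | ⟨y, hy, h⟩)
  · exact ball_mono (by linarith) hz
  · exact mem_ball_add_one hc hy h

theorem ball_finite (hc : W.graph.Connected) (hf : ∀ x, {y | 0 < W.ω x y}.Finite) (x : G) (R : ℝ) :
    (W.ball x R).Finite := by
  have key : ∀ n : ℕ, {y | W.graph.dist x y ≤ n}.Finite := by
    intro n
    induction n with
    | zero =>
      refine (Set.finite_singleton x).subset fun y hy => ?_
      have : W.graph.dist x y = 0 := Nat.le_zero.1 hy
      exact ((hc x y).dist_eq_zero_iff.1 this).symm
    | succ n ih =>
      refine (ih.union (ih.biUnion fun y _ => hf y)).subset fun z hz => ?_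
      rcases Nat.lt_or_ge n (W.graph.dist x z) with h | h
      · have hz' : W.graph.dist x z = n + 1 := le_antisymm hz h
        obtain ⟨p, hp⟩ := (hc x z).exists_walk_length_eq_dist
        right
        have hlen : p.reverse.length = n + 1 := by rw [SimpleGraph.Walk.length_reverse, hp, hz']
        cases hq : p.reverse with
        | nil => rw [hq] at hlen; simp at hlen
        | @cons _ y _ h1 q =>
          rw [hq] at hlen
          simp only [SimpleGraph.Walk.length_cons, Nat.add_right_cancel_iff] at hlen
          simp only [Set.mem_iUnion]
          refine ⟨y, ?_, ?_⟩
          · have := SimpleGraph.dist_le q.reverse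
            rw [SimpleGraph.Walk.length_reverse, hlen] at this
            exact this
          · have := h1.2
            rw [W.symm] at this
            exact this
      · exact Or.inl h
  obtain ⟨n, hn⟩ := exists_nat_ge R
  refine (key n).subset fun y hy => ?_
  have : (W.graph.dist x y : ℝ) < n := lt_of_lt_of_le hy hn
  exact_mod_cast this.le

/-- The length of an edge in the metric `d̃`. -/
def edgeLength (W : WeightedGraph G) (x y : G) : ℝ := min 1 (1 / Real.sqrt (W.ω x y))

theorem edgeLength_nonneg (x y : G) : 0 ≤ W.edgeLength x y :=
  le_min zero_le_one (by positivity)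

theorem edgeLength_le_one (x y : G) : W.edgeLength x y ≤ 1 := min_le_left _ _

theorem edgeLength_comm (x y : G) : W.edgeLength x y = W.edgeLength y x := by
  unfold edgeLength; rw [W.symm]

theorem omega_mul_edgeLength_sq_le (x y : G) : W.ω x y * W.edgeLength x y ^ 2 ≤ 1 := by
  by_cases h : 0 < W.ω x y
  · have h1 : W.edgeLength x y ^ 2 ≤ (1 / Real.sqrt (W.ω x y)) ^ 2 :=
      pow_le_pow_left₀ (edgeLength_nonneg x y) (min_le_right _ _) 2
    rw [div_pow, Real.sq_sqrt h.le, one_pow] at h1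
    calc _ ≤ W.ω x y * (1 / W.ω x y) := mul_le_mul_of_nonneg_left h1 h.le
      _ = 1 := by field_simp
  · rw [omega_eq_zero_of_not_pos h]; simp

/-- The `d̃`-length of a walk. -/
def walkLength (W : WeightedGraph G) {x y : G} (p : W.graph.Walk x y) : ℝ :=
  (p.darts.map fun e => W.edgeLength e.fst e.snd).sum

theorem walkLength_nonneg {x y : G} (p : W.graph.Walk x y) : 0 ≤ W.walkLength p := by
  refine List.sum_nonneg fun a ha => ?_
  obtain ⟨e, _, rfl⟩ := List.mem_map.1 ha
  exact edgeLength_nonneg _ _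

theorem dTilde_eq (x y : G) : W.dTilde x y = ⨅ p : W.graph.Walk x y, W.walkLength p := rfl

theorem walkLength_bddBelow (x y : G) :
    BddBelow (Set.range fun p : W.graph.Walk x y => W.walkLength p) :=
  ⟨0, by rintro _ ⟨p, rfl⟩; exact walkLength_nonneg p⟩

theorem dTilde_le_walkLength {x y : G} (p : W.graph.Walk x y) : W.dTilde x y ≤ W.walkLength p :=
  ciInf_le (walkLength_bddBelow x y) p

theorem dTilde_nonneg (x y : G) : 0 ≤ W.dTilde x y := Real.iInf_nonneg fun p => walkLength_nonneg p

theorem dTilde_self (x : G) : W.dTilde x x = 0 :=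
  le_antisymm (by simpa [walkLength] using dTilde_le_walkLength (SimpleGraph.Walk.nil (u := x)))
    (dTilde_nonneg x x)

theorem walkLength_append {x y z : G} (p : W.graph.Walk x y) (q : W.graph.Walk y z) :
    W.walkLength (p.append q) = W.walkLength p + W.walkLength q := by
  simp [walkLength, SimpleGraph.Walk.darts_append]

theorem dTilde_triangle (hc : W.graph.Connected) (x y z : G) :
    W.dTilde x z ≤ W.dTilde x y + W.dTilde y z := by
  have : ∀ x y, Nonempty (W.graph.Walk x y) := fun x y => hc x y
  refine le_of_forall_pos_lt_add fun ε hε => ?_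
  obtain ⟨p, hp⟩ := exists_lt_of_ciInf_lt
    (show (⨅ p : W.graph.Walk x y, W.walkLength p) < W.dTilde x y + ε / 2 by
      rw [← dTilde_eq]; linarith)
  obtain ⟨q, hq⟩ := exists_lt_of_ciInf_lt
    (show (⨅ p : W.graph.Walk y z, W.walkLength p) < W.dTilde y z + ε / 2 by
      rw [← dTilde_eq]; linarith)
  have := dTilde_le_walkLength (p.append q)
  rw [walkLength_append] at this
  linarith

theorem dTilde_le_edgeLength {x y : G} (h : 0 < W.ω x y) : W.dTilde x y ≤ W.edgeLength x y := by
  by_cases hxy : x = y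
  · subst hxy; rw [dTilde_self]; exact edgeLength_nonneg x x
  · have := dTilde_le_walkLength (SimpleGraph.Walk.cons (show W.graph.Adj x y from ⟨hxy, h⟩) .nil)
    simpa [walkLength] using this

theorem dTilde_le_dist (hc : W.graph.Connected) (x y : G) : W.dTilde x y ≤ W.graph.dist x y := by
  obtain ⟨p, hp⟩ := (hc x y).exists_walk_length_eq_dist
  rw [← hp]
  refine (dTilde_le_walkLength p).trans ?_
  have := List.sum_le_card_nsmul (p.darts.map fun e => W.edgeLength e.fst e.snd) 1
    (fun a ha => by
      obtain ⟨e, _, rfl⟩ := List.mem_map.1 ha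
      exact edgeLength_le_one _ _)
  simpa [walkLength] using this

theorem abs_dTilde_sub_le (hc : W.graph.Connected) (x : G) {y z : G} (h : 0 < W.ω y z) :
    |W.dTilde x y - W.dTilde x z| ≤ W.edgeLength y z := by
  have h1 := dTilde_triangle hc x y z
  have h2 := dTilde_triangle hc x z y
  have h3 := dTilde_le_edgeLength h
  have h4 := dTilde_le_edgeLength (W := W) (x := z) (y := y) (by rwa [W.symm])
  rw [edgeLength_comm] at h4
  exact abs_sub_le_iff.2 ⟨by linarith, by linarith⟩

end

/-! ### Spectral decomposition of the Laplacian with Dirichlet boundary condition -/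

section

variable {G : Type*} {W : WeightedGraph G} {s : WalkSpeed}

open scoped Classical in
/-- The matrix of `-L_θ` on functions vanishing outside `D`, conjugated by `θ^{1/2}` so that it
becomes symmetric. -/
def dirichletMatrix (W : WeightedGraph G) (s : WalkSpeed) (D : Finset G) : Matrix D D ℝ :=
  fun x y => ((if x = y then W.weight x else 0) - W.ω x y) /
    (Real.sqrt (W.theta s x) * Real.sqrt (W.theta s y))

theorem dirichletMatrix_isHermitian (W : WeightedGraph G) (s : WalkSpeed) (D : Finset G) :
    (W.dirichletMatrix s D).IsHermitian := by
  ext x y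
  simp only [Matrix.conjTranspose_apply, dirichletMatrix, star_trivial]
  rw [W.symm y x, mul_comm]
  by_cases h : x = y
  · subst h; rfl
  · rw [if_neg h, if_neg (Ne.symm h)]

open scoped Classical in
/-- The spectral theorem for `-L_θ` on `ℓ²(D, θ)` with zero boundary values. The last conjunct is
completeness of the eigenbasis. -/
theorem Regular.exists_eigenfunctions (hW : W.Regular) (s : WalkSpeed) (D : Finset G) :
    ∃ (lam : D → ℝ) (φ : D → G → ℝ),
      (∀ i, ∀ y ∉ D, φ i y = 0) ∧ (∀ i, ∀ x ∈ D, W.laplacian s (φ i) x = -lam i * φ i x) ∧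
      (∀ i j, ∑ x ∈ D, φ i x * φ j x * W.theta s x = if i = j then 1 else 0) ∧
      (∀ x ∈ D, ∀ y ∈ D, ∑ i, φ i x * φ i y = if x = y then 1 / W.theta s x else 0) := by
  set hA := W.dirichletMatrix_isHermitian s D
  set b := hA.eigenvectorBasis with hb
  have hθ : ∀ x, 0 < Real.sqrt (W.theta s x) := fun x => Real.sqrt_pos.2 (hW.theta_pos s x)
  have hθ2 : ∀ x, Real.sqrt (W.theta s x) * Real.sqrt (W.theta s x) = W.theta s x :=
    fun x => Real.mul_self_sqrt (hW.theta_pos s x).le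
  have horth : ∀ i j, ∑ x, b i x * b j x = if i = j then 1 else 0 := by
    intro i j
    have := orthonormal_iff_ite.1 b.orthonormal i j
    rw [← this, PiLp.inner_apply]
    exact Finset.sum_congr rfl fun x _ => by simp [mul_comm]
  have hcompl : ∀ x y, ∑ i, b i x * b i y = if x = y then 1 else 0 := by
    let U : Matrix D D ℝ := fun i x => b i x
    have h1 : U * U.transpose = 1 := by
      ext i j
      rw [Matrix.mul_apply, Matrix.one_apply, ← horth]
      rfl
    have h2 := mul_eq_one_comm.1 h1
    intro x y
    have := congrFun (congrFun h2 x) y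
    rw [Matrix.mul_apply, Matrix.one_apply] at this
    exact this
  let φ : D → G → ℝ := fun i x => if h : x ∈ D then b i ⟨x, h⟩ / Real.sqrt (W.theta s x) else 0
  have hφ : ∀ i (x : D), φ i x = b i x / Real.sqrt (W.theta s x) := fun i x => dif_pos x.2
  refine ⟨hA.eigenvalues, φ, fun i y hy => dif_neg hy, fun i x hx => ?_, fun i j => ?_,
    fun x hx y hy => ?_⟩
  · have h1 := congrFun (hA.mulVec_eigenvectorBasis i) ⟨x, hx⟩
    have h0 : ∀ y ∉ D, φ i y = 0 := fun y hy => dif_neg hy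
    have h2 : W.theta s x * W.laplacian s (φ i) x = W.theta s x * (-hA.eigenvalues i * φ i x) := by
      rw [hW.theta_mul_laplacian_of_zero s h0, ← Finset.sum_coe_sort D]
      simp only [Matrix.mulVec, dotProduct, Pi.smul_apply, smul_eq_mul] at h1
      have h3 : ∀ y : D, W.dirichletMatrix s D ⟨x, hx⟩ y * b i y =
          ((if (⟨x, hx⟩ : D) = y then W.weight x else 0) * φ i y - W.ω x y * φ i y) /
            Real.sqrt (W.theta s x) := fun y => by
        rw [hφ, dirichletMatrix]
        have := (hθ x).ne'
        have := (hθ y).ne'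
        field_simp
      rw [Finset.sum_congr rfl fun y _ => h3 y, ← Finset.sum_div, Finset.sum_sub_distrib] at h1
      simp only [ite_mul, zero_mul, Finset.sum_ite_eq, Finset.mem_univ, if_true] at h1
      rw [div_eq_iff (hθ x).ne'] at h1
      have h4 : φ i x = b i ⟨x, hx⟩ / Real.sqrt (W.theta s x) := dif_pos hx
      have h5 : W.theta s x * φ i x = b i ⟨x, hx⟩ * Real.sqrt (W.theta s x) := by
        have := (hθ x).ne'
        calc _ = (Real.sqrt (W.theta s x) * Real.sqrt (W.theta s x)) *
              (b i ⟨x, hx⟩ / Real.sqrt (W.theta s x)) := by rw [hθ2, h4]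
          _ = _ := by field_simp
      have h6 : W.theta s x * (-hA.eigenvalues i * φ i x) =
        -(hA.eigenvalues i * b i ⟨x, hx⟩ * Real.sqrt (W.theta s x)) := by
        rw [mul_assoc, ← h5]; ring
      rw [h6, ← h1]; ring
    exact mul_left_cancel₀ (hW.theta_pos s x).ne' h2
  · rw [← horth, ← Finset.sum_coe_sort D]
    refine Finset.sum_congr rfl fun x _ => ?_
    have := (hθ x).ne'
    calc _ = b i x / Real.sqrt (W.theta s x) * (b j x / Real.sqrt (W.theta s x)) *
          (Real.sqrt (W.theta s x) * Real.sqrt (W.theta s x)) := by rw [hφ, hφ, hθ2]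
      _ = _ := by field_simp
  · have h1 : ∀ i, φ i x * φ i y = b i ⟨x, hx⟩ * b i ⟨y, hy⟩ /
        (Real.sqrt (W.theta s x) * Real.sqrt (W.theta s y)) := fun i => by
      rw [show φ i x = _ from dif_pos hx, show φ i y = _ from dif_pos hy, div_mul_div_comm]
    rw [Finset.sum_congr rfl fun i _ => h1 i, ← Finset.sum_div, hcompl]
    by_cases h : x = y
    · subst h; simp [hθ2]
    · simp [h]

/-- The Dirichlet eigenvalues of `-L_θ` on `D`. -/
def Regular.eigenvalue (hW : W.Regular) (s : WalkSpeed) (D : Finset G) : D → ℝ :=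
  (hW.exists_eigenfunctions s D).choose

/-- The Dirichlet eigenfunctions of `-L_θ` on `D`, orthonormal in `ℓ²(θ)` and zero off `D`. -/
def Regular.eigenfunction (hW : W.Regular) (s : WalkSpeed) (D : Finset G) : D → G → ℝ :=
  (hW.exists_eigenfunctions s D).choose_spec.choose

section kernel

variable (hW : W.Regular) (s) (D : Finset G)

theorem Regular.eigenfunction_off (i : D) {y : G} (hy : y ∉ D) : hW.eigenfunction s D i y = 0 :=
  (hW.exists_eigenfunctions s D).choose_spec.choose_spec.1 i y hy

theorem Regular.laplacian_eigenfunction (i : D) {x : G} (hx : x ∈ D) :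
    W.laplacian s (hW.eigenfunction s D i) x =
      -hW.eigenvalue s D i * hW.eigenfunction s D i x :=
  (hW.exists_eigenfunctions s D).choose_spec.choose_spec.2.1 i x hx

open scoped Classical in
theorem Regular.eigenfunction_orthonormal (i j : D) :
    ∑ x ∈ D, hW.eigenfunction s D i x * hW.eigenfunction s D j x * W.theta s x =
      if i = j then 1 else 0 :=
  (hW.exists_eigenfunctions s D).choose_spec.choose_spec.2.2.1 i j

open scoped Classical in
theorem Regular.eigenfunction_complete {x y : G} (hx : x ∈ D) (hy : y ∈ D) :
    ∑ i, hW.eigenfunction s D i x * hW.eigenfunction s D i y =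
      if x = y then 1 / W.theta s x else 0 :=
  (hW.exists_eigenfunctions s D).choose_spec.choose_spec.2.2.2 x hx y hy

theorem Regular.eigenvalue_nonneg (i : D) : 0 ≤ hW.eigenvalue s D i := by
  set φ := hW.eigenfunction s D i with hφ
  have h0 : ∀ y ∉ D, φ y = 0 := fun y hy => hW.eigenfunction_off s D i hy
  have h1 : hW.eigenvalue s D i = -∑ x ∈ D, φ x * (W.theta s x * W.laplacian s φ x) := by
    have := hW.eigenfunction_orthonormal s D i i
    rw [if_pos rfl] at this
    rw [← mul_one (hW.eigenvalue s D i), ← this, Finset.mul_sum, ← Finset.sum_neg_distrib]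
    refine Finset.sum_congr rfl fun x hx => ?_
    rw [hφ, hW.laplacian_eigenfunction s D i hx]; ring
  have h2 : ∑ x ∈ D, φ x * (W.theta s x * W.laplacian s φ x) =
      ∑ x ∈ D, ∑ y ∈ D, W.ω x y * (φ x * φ y) - ∑ x ∈ D, W.weight x * φ x ^ 2 := by
    rw [← Finset.sum_sub_distrib]
    refine Finset.sum_congr rfl fun x _ => ?_
    rw [hW.theta_mul_laplacian_of_zero s h0, mul_sub, Finset.mul_sum]
    congr 1
    · exact Finset.sum_congr rfl fun y _ => by ring
    · ring
  have h3 : ∑ x ∈ D, ∑ y ∈ D, W.ω x y * (φ x * φ y) ≤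
      ∑ x ∈ D, ∑ y ∈ D, (W.ω x y * φ x ^ 2 / 2 + W.ω y x * φ y ^ 2 / 2) := by
    refine Finset.sum_le_sum fun x _ => Finset.sum_le_sum fun y _ => ?_
    rw [W.symm y x]
    nlinarith [W.nonneg x y, mul_nonneg (W.nonneg x y) (sq_nonneg (φ x - φ y))]
  have h4 : ∑ x ∈ D, ∑ y ∈ D, (W.ω x y * φ x ^ 2 / 2 + W.ω y x * φ y ^ 2 / 2) =
      ∑ x ∈ D, (∑ y ∈ D, W.ω x y) * φ x ^ 2 := by
    simp only [Finset.sum_add_distrib]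
    rw [Finset.sum_comm (f := fun x y => W.ω y x * φ y ^ 2 / 2), ← Finset.sum_add_distrib]
    refine Finset.sum_congr rfl fun x _ => ?_
    rw [← Finset.sum_add_distrib, Finset.sum_mul]
    exact Finset.sum_congr rfl fun y _ => by ring
  have h5 : ∑ x ∈ D, (∑ y ∈ D, W.ω x y) * φ x ^ 2 ≤ ∑ x ∈ D, W.weight x * φ x ^ 2 :=
    Finset.sum_le_sum fun x _ => mul_le_mul_of_nonneg_right (hW.sum_le_weight x D) (sq_nonneg _)
  rw [h1, h2]
  linarith

/-- The heat kernel `p^D_t(x,y)` (with respect to `θ`) of the walk killed on leaving `D`, defined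
for all real `t` by its eigenfunction expansion. -/
def Regular.killed (t : ℝ) (x y : G) : ℝ :=
  ∑ i, Real.exp (-hW.eigenvalue s D i * t) * hW.eigenfunction s D i x * hW.eigenfunction s D i y

theorem Regular.killed_comm (t : ℝ) (x y : G) : hW.killed s D t x y = hW.killed s D t y x :=
  Finset.sum_congr rfl fun i _ => by ring

theorem Regular.killed_off_left (t : ℝ) {x : G} (y : G) (hx : x ∉ D) : hW.killed s D t x y = 0 :=
  Finset.sum_eq_zero fun i _ => by rw [hW.eigenfunction_off s D i hx]; ring

theorem Regular.killed_off_right (t : ℝ) (x : G) {y : G} (hy : y ∉ D) : hW.killed s D t x y = 0 := by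
  rw [hW.killed_comm, hW.killed_off_left s D t x hy]

open scoped Classical in
theorem Regular.killed_zero {x y : G} (hx : x ∈ D) (hy : y ∈ D) :
    hW.killed s D 0 x y = if x = y then 1 / W.theta s x else 0 := by
  rw [← hW.eigenfunction_complete s D hx hy]
  exact Finset.sum_congr rfl fun i _ => by simp

theorem Regular.laplacian_killed (t : ℝ) {x : G} (y : G) (hx : x ∈ D) :
    W.laplacian s (fun z => hW.killed s D t z y) x =
      ∑ i, -hW.eigenvalue s D i * Real.exp (-hW.eigenvalue s D i * t) *
        hW.eigenfunction s D i x * hW.eigenfunction s D i y := by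
  have : (fun z => hW.killed s D t z y) = fun z => ∑ i, (Real.exp (-hW.eigenvalue s D i * t) *
      hW.eigenfunction s D i y) * hW.eigenfunction s D i z := by
    funext z
    exact Finset.sum_congr rfl fun i _ => by ring
  rw [this, hW.laplacian_sum]
  refine Finset.sum_congr rfl fun i _ => ?_
  rw [hW.laplacian_const_mul, hW.laplacian_eigenfunction s D i hx]; ring

/-- The killed heat kernel solves the heat equation. -/
theorem Regular.hasDerivAt_killed (t : ℝ) {x : G} (y : G) (hx : x ∈ D) :
    HasDerivAt (fun r => hW.killed s D r x y) (W.laplacian s (fun z => hW.killed s D t z y) x) t := by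
  rw [hW.laplacian_killed s D t y hx]
  refine HasDerivAt.fun_sum fun i _ => ?_
  have h1 : HasDerivAt (fun r : ℝ => -hW.eigenvalue s D i * r) (-hW.eigenvalue s D i) t := by
    simpa using (hasDerivAt_id t).const_mul (-hW.eigenvalue s D i)
  have := ((h1.exp.mul_const (hW.eigenfunction s D i x)).mul_const (hW.eigenfunction s D i y))
  exact this.congr_deriv (by ring)

theorem Regular.continuous_killed (x y : G) : Continuous fun r => hW.killed s D r x y := by
  unfold Regular.killed; fun_prop

/-- The Chapman-Kolmogorov equation. -/
theorem Regular.killed_add (t r : ℝ) (x y : G) :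
    ∑ z ∈ D, hW.killed s D t x z * hW.killed s D r z y * W.theta s z =
      hW.killed s D (t + r) x y := by
  classical
  set lam := hW.eigenvalue s D
  set φ := hW.eigenfunction s D
  calc ∑ z ∈ D, hW.killed s D t x z * hW.killed s D r z y * W.theta s z
      = ∑ z ∈ D, ∑ i, ∑ j, (Real.exp (-lam i * t) * Real.exp (-lam j * r) * φ i x * φ j y) *
          (φ i z * φ j z * W.theta s z) := by
        refine Finset.sum_congr rfl fun z _ => ?_
        unfold Regular.killed
        rw [Finset.sum_mul_sum, Finset.sum_mul]
        refine Finset.sum_congr rfl fun i _ => ?_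
        rw [Finset.sum_mul]
        exact Finset.sum_congr rfl fun j _ => by ring
    _ = ∑ i, ∑ j, (Real.exp (-lam i * t) * Real.exp (-lam j * r) * φ i x * φ j y) *
          ∑ z ∈ D, (φ i z * φ j z * W.theta s z) := by
        rw [Finset.sum_comm]
        refine Finset.sum_congr rfl fun i _ => ?_
        rw [Finset.sum_comm]
        exact Finset.sum_congr rfl fun j _ => by rw [Finset.mul_sum]
    _ = ∑ i, ∑ j, (Real.exp (-lam i * t) * Real.exp (-lam j * r) * φ i x * φ j y) *
          (if i = j then 1 else 0) := by
        refine Finset.sum_congr rfl fun i _ => Finset.sum_congr rfl fun j _ => ?_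
        rw [hW.eigenfunction_orthonormal s D i j]
    _ = hW.killed s D (t + r) x y := by
        simp only [mul_ite, mul_one, mul_zero, Finset.sum_ite_eq, Finset.mem_univ, if_true]
        unfold Regular.killed
        refine Finset.sum_congr rfl fun i _ => ?_
        rw [mul_add, Real.exp_add]

theorem Regular.sum_killed_sq (t : ℝ) (x : G) :
    ∑ z ∈ D, hW.killed s D t x z ^ 2 * W.theta s z = hW.killed s D (2 * t) x x := by
  rw [two_mul, ← hW.killed_add]
  exact Finset.sum_congr rfl fun z _ => by rw [hW.killed_comm s D t z x, sq]

theorem Regular.killed_self_antitone (x : G) : Antitone fun t => hW.killed s D t x x := by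
  intro t r htr
  refine Finset.sum_le_sum fun i _ => ?_
  rw [mul_assoc, mul_assoc]
  refine mul_le_mul_of_nonneg_right (Real.exp_le_exp.2 ?_) (mul_self_nonneg _)
  nlinarith [hW.eigenvalue_nonneg s D i]

/-- The absolute convergence form of the Cauchy-Schwarz inequality
`p_t(x,y) ≤ (p_t(x,x) p_t(y,y))^{1/2}`. -/
theorem Regular.sum_abs_killed_le (t : ℝ) (x y : G) :
    ∑ i, Real.exp (-hW.eigenvalue s D i * t) *
      |hW.eigenfunction s D i x * hW.eigenfunction s D i y| ≤
      (hW.killed s D t x x + hW.killed s D t y y) / 2 := by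
  unfold Regular.killed
  rw [← Finset.sum_add_distrib, Finset.sum_div]
  refine Finset.sum_le_sum fun i _ => ?_
  have h := Real.exp_pos (-hW.eigenvalue s D i * t)
  set a := hW.eigenfunction s D i x
  set b := hW.eigenfunction s D i y
  have : |a * b| ≤ (a * a + b * b) / 2 := by
    rw [abs_mul]
    nlinarith [sq_nonneg (|a| - |b|), abs_mul_abs_self a, abs_mul_abs_self b]
  calc _ ≤ Real.exp (-hW.eigenvalue s D i * t) * ((a * a + b * b) / 2) :=
        mul_le_mul_of_nonneg_left this h.le
    _ = _ := by ring

/-- The time derivative of the killed heat kernel is controlled by its diagonal values. -/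
theorem Regular.abs_laplacian_killed_le {t : ℝ} (ht : 0 < t) {x : G} (y : G) (hx : x ∈ D) {B : ℝ}
    (hxB : hW.killed s D (t / 2) x x ≤ B) (hyB : hW.killed s D (t / 2) y y ≤ B) :
    |W.laplacian s (fun z => hW.killed s D t z y) x| ≤ 2 / t * B := by
  rw [hW.laplacian_killed s D t y hx]
  calc _ ≤ ∑ i, |(-hW.eigenvalue s D i * Real.exp (-hW.eigenvalue s D i * t) *
        hW.eigenfunction s D i x * hW.eigenfunction s D i y)| := Finset.abs_sum_le_sum_abs _ _
    _ ≤ ∑ i, 2 / t * (Real.exp (-hW.eigenvalue s D i * (t / 2)) *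
        |hW.eigenfunction s D i x * hW.eigenfunction s D i y|) := by
        refine Finset.sum_le_sum fun i _ => ?_
        have hl := hW.eigenvalue_nonneg s D i
        set l := hW.eigenvalue s D i
        rw [mul_assoc, abs_mul, abs_mul, abs_neg, abs_of_nonneg hl,
          abs_of_pos (Real.exp_pos _), ← mul_assoc]
        refine mul_le_mul_of_nonneg_right ?_ (abs_nonneg _)
        have h1 : Real.exp (-l * t) = Real.exp (-l * (t / 2)) * Real.exp (-(l * (t / 2))) := by
          rw [← Real.exp_add]; congr 1; ring
        have h2 : l * Real.exp (-(l * (t / 2))) ≤ 2 / t := by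
          rw [Real.exp_neg, ← div_eq_mul_inv, div_le_div_iff₀ (Real.exp_pos _) ht]
          nlinarith [Real.add_one_le_exp (l * (t / 2))]
        rw [h1, ← mul_assoc, mul_right_comm]
        exact mul_le_mul_of_nonneg_right h2 (Real.exp_pos _).le
    _ = 2 / t * ∑ i, (Real.exp (-hW.eigenvalue s D i * (t / 2)) *
        |hW.eigenfunction s D i x * hW.eigenfunction s D i y|) := by rw [Finset.mul_sum]
    _ ≤ _ := by
        refine mul_le_mul_of_nonneg_left ?_ (by positivity)
        have := hW.sum_abs_killed_le s D (t / 2) x y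
        linarith

end kernel

/-! ### The parabolic minimum principle -/

theorem deriv_nonpos_of_left_min {f : ℝ → ℝ} {f' a t : ℝ} (hat : a < t) (hf : HasDerivAt f f' t)
    (hmin : ∀ r ∈ Set.Icc a t, f t ≤ f r) : f' ≤ 0 := by
  have h := (hasDerivAt_iff_tendsto_slope.1 hf).mono_left
    (show nhdsWithin t (Set.Iio t) ≤ nhdsWithin t {t}ᶜ from
      nhdsWithin_mono _ fun r hr => ne_of_lt hr)
  refine le_of_tendsto h ?_
  filter_upwards [Ioo_mem_nhdsLT hat] with r hr
  rw [slope_def_field]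
  exact div_nonpos_of_nonneg_of_nonpos (sub_nonneg.2 (hmin r ⟨hr.1.le, hr.2.le⟩))
    (sub_nonpos.2 hr.2.le)

/-- The minimum principle for supersolutions of the heat equation on a finite set. The equation is
only required in the open time interval. -/
theorem Regular.parabolic_nonneg (hW : W.Regular) {D : Finset G} {a b : ℝ} {z : ℝ → G → ℝ}
    (hcont : ∀ x ∈ D, ContinuousOn (fun t => z t x) (Set.Icc a b))
    (hder : ∀ x ∈ D, ∀ t ∈ Set.Ioo a b, ∃ z', HasDerivAt (fun r => z r x) z' t ∧
      W.laplacian s (z t) x ≤ z')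
    (hout : ∀ t ∈ Set.Ioo a b, ∀ x ∈ D, ∀ y ∉ D, 0 < W.ω x y → 0 ≤ z t y)
    (h0 : ∀ x ∈ D, 0 ≤ z a x) : ∀ t ∈ Set.Icc a b, ∀ x ∈ D, 0 ≤ z t x := by
  have key : ∀ t ∈ Set.Ioo a b, ∀ x ∈ D, 0 ≤ z t x := by
    intro t₁ ht₁ x₁ hx₁
    refine le_of_forall_pos_le_add fun ε hε => ?_
    set η := ε / (b - a) with hη
    have hab : 0 < b - a := by linarith [ht₁.1, ht₁.2]
    have hηpos : 0 < η := div_pos hε hab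
    -- The added linear term makes the supersolution strict.
    let f : G → ℝ → ℝ := fun x t => z t x + η * (t - a)
    have hsub : Set.Icc a t₁ ⊆ Set.Icc a b := Set.Icc_subset_Icc_right ht₁.2.le
    have hmin : ∀ x, ∃ t, x ∈ D → t ∈ Set.Icc a t₁ ∧ ∀ r ∈ Set.Icc a t₁, f x t ≤ f x r := by
      intro x
      by_cases hx : x ∈ D
      · obtain ⟨t, ht, h⟩ := isCompact_Icc.exists_isMinOn (Set.nonempty_Icc.2 ht₁.1.le)
          (f := f x) (((hcont x hx).mono hsub).add (by fun_prop))
        exact ⟨t, fun _ => ⟨ht, fun r hr => h hr⟩⟩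
      · exact ⟨0, fun h => absurd h hx⟩
    choose τ hτ using hmin
    obtain ⟨x, hx, hxmin⟩ := D.exists_min_image (fun x => f x (τ x)) ⟨x₁, hx₁⟩
    have hall : ∀ y ∈ D, ∀ r ∈ Set.Icc a t₁, f x (τ x) ≤ f y r := fun y hy r hr =>
      (hxmin y hy).trans ((hτ y hy).2 r hr)
    have hfin : 0 ≤ f x (τ x) := by
      by_contra hneg
      push Not at hneg
      obtain ⟨hτx, hτm⟩ := hτ x hx
      have hne : a < τ x := by
        refine lt_of_le_of_ne hτx.1 fun h => ?_
        have := h0 x hx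
        rw [← h] at hneg
        simp only [f, sub_self, mul_zero, add_zero] at hneg
        linarith
      have hτo : τ x ∈ Set.Ioo a b := ⟨hne, lt_of_le_of_lt hτx.2 ht₁.2⟩
      obtain ⟨z', hz', hL⟩ := hder x hx (τ x) hτo
      have hd : HasDerivAt (f x) (z' + η) (τ x) := by
        have h2 : HasDerivAt (fun t : ℝ => η * (t - a)) η (τ x) := by
          simpa using ((hasDerivAt_id (τ x)).sub_const a).const_mul η
        exact hz'.add h2
      have h1 := deriv_nonpos_of_left_min hne hd fun r hr => hτm r ⟨hr.1, hr.2.trans hτx.2⟩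
      have hzx : z (τ x) x < 0 := by
        have : 0 ≤ η * (τ x - a) := mul_nonneg hηpos.le (by linarith)
        simp only [f] at hneg
        linarith
      have h2 : 0 ≤ W.laplacian s (z (τ x)) x := by
        refine hW.laplacian_nonneg_of_le fun y hy => ?_
        by_cases hyD : y ∈ D
        · have := hall y hyD (τ x) hτx
          simp only [f] at this
          linarith
        · exact hzx.le.trans (hout _ hτo x hx y hyD hy)
      linarith
    have h3 := hfin.trans (hall x₁ hx₁ t₁ ⟨ht₁.1.le, le_rfl⟩)
    have h4 : η * (t₁ - a) ≤ ε := by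
      rw [hη, div_mul_eq_mul_div, div_le_iff₀ hab]
      exact mul_le_mul_of_nonneg_left (by linarith [ht₁.2]) hε.le
    simp only [f] at h3
    linarith
  intro t ht x hx
  rcases eq_or_lt_of_le ht.1 with h | h
  · rw [← h]; exact h0 x hx
  · rcases eq_or_lt_of_le ht.2 with h' | h'
    · have hab : a < b := h'.symm ▸ h
      have hcl : b ∈ _root_.closure (Set.Ioo a b) := by
        rw [closure_Ioo hab.ne]; exact ⟨hab.le, le_rfl⟩
      have hc : ContinuousWithinAt (fun t => z t x) (Set.Ioo a b) b :=
        ((hcont x hx) b ⟨hab.le, le_rfl⟩).mono Set.Ioo_subset_Icc_self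
      rw [h']
      have : Filter.NeBot (nhdsWithin b (Set.Ioo a b)) := mem_closure_iff_nhdsWithin_neBot.1 hcl
      refine ge_of_tendsto hc ?_
      filter_upwards [self_mem_nhdsWithin] with r hr using key r hr x hx
    · exact key t ⟨h, h'⟩ x hx

/-! ### The killed heat semigroup -/

section semigroup

variable (hW : W.Regular) (s) (D : Finset G)

theorem Regular.killed_nonneg {t : ℝ} (ht : 0 ≤ t) (x y : G) : 0 ≤ hW.killed s D t x y := by
  classical
  by_cases hx : x ∈ D
  swap
  · rw [hW.killed_off_left s D t y hx]
  by_cases hy : y ∈ D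
  swap
  · rw [hW.killed_off_right s D t x hy]
  refine hW.parabolic_nonneg (s := s) (D := D) (a := 0) (b := t)
    (z := fun t x => hW.killed s D t x y)
    (fun x _ => (hW.continuous_killed s D x y).continuousOn)
    (fun x hx t _ => ⟨_, hW.hasDerivAt_killed s D t y hx, le_rfl⟩)
    (fun t _ _ _ z hz _ => (hW.killed_off_left s D t y hz).ge) (fun x hx => ?_) t ⟨ht, le_rfl⟩ x hx
  rw [hW.killed_zero s D hx hy]
  split_ifs
  · exact (one_div_pos.2 (hW.theta_pos s x)).le
  · exact le_rfl

/-- The killed heat semigroup `P^D_t f(x) = ∑_{y ∈ D} p^D_t(x,y) f(y) θ(y)`. -/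
def Regular.flow (t : ℝ) (f : G → ℝ) (x : G) : ℝ :=
  ∑ y ∈ D, hW.killed s D t x y * f y * W.theta s y

theorem Regular.flow_off (t : ℝ) (f : G → ℝ) {x : G} (hx : x ∉ D) : hW.flow s D t f x = 0 :=
  Finset.sum_eq_zero fun y _ => by rw [hW.killed_off_left s D t y hx]; ring

theorem Regular.flow_zero (f : G → ℝ) {x : G} (hx : x ∈ D) : hW.flow s D 0 f x = f x := by
  classical
  unfold Regular.flow
  rw [Finset.sum_eq_single_of_mem x hx]
  · rw [hW.killed_zero s D hx hx, if_pos rfl]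
    field_simp [(hW.theta_pos s x).ne']
  · intro y hy hyx
    rw [hW.killed_zero s D hx hy, if_neg (Ne.symm hyx)]; ring

theorem Regular.continuous_flow (f : G → ℝ) (x : G) : Continuous fun t => hW.flow s D t f x := by
  have := hW.continuous_killed s D
  unfold Regular.flow; fun_prop

theorem Regular.laplacian_flow (t : ℝ) (f : G → ℝ) (x : G) :
    W.laplacian s (hW.flow s D t f) x =
      ∑ y ∈ D, W.laplacian s (fun z => hW.killed s D t z y) x * f y * W.theta s y := by
  have : hW.flow s D t f = fun z => ∑ y ∈ D, (f y * W.theta s y) * hW.killed s D t z y := by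
    funext z
    exact Finset.sum_congr rfl fun y _ => by ring
  rw [this, hW.laplacian_sum]
  refine Finset.sum_congr rfl fun y _ => ?_
  rw [hW.laplacian_const_mul]; ring

theorem Regular.hasDerivAt_flow (t : ℝ) (f : G → ℝ) {x : G} (hx : x ∈ D) :
    HasDerivAt (fun r => hW.flow s D r f x) (W.laplacian s (hW.flow s D t f) x) t := by
  rw [hW.laplacian_flow]
  exact HasDerivAt.fun_sum fun y _ =>
    ((hW.hasDerivAt_killed s D t y hx).mul_const (f y)).mul_const _

/-- The semigroup commutes with the Laplacian on functions that vanish off `D`. -/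
theorem Regular.laplacian_flow_eq (t : ℝ) {f : G → ℝ} (hf : ∀ y ∉ D, f y = 0) {x : G}
    (hx : x ∈ D) : W.laplacian s (hW.flow s D t f) x = hW.flow s D t (W.laplacian s f) x := by
  have h1 : ∀ y ∈ D, W.laplacian s (fun z => hW.killed s D t z y) x =
      W.laplacian s (fun z => hW.killed s D t x z) y := fun y hy => by
    have : (fun z => hW.killed s D t x z) = fun z => hW.killed s D t z x :=
      funext fun z => hW.killed_comm s D t x z
    rw [this, hW.laplacian_killed s D t y hx, hW.laplacian_killed s D t x hy]
    exact Finset.sum_congr rfl fun i _ => by ring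
  rw [hW.laplacian_flow]
  unfold Regular.flow
  rw [← hW.sum_mul_laplacian_comm s (fun y hy => hW.killed_off_right s D t x hy) hf]
  exact Finset.sum_congr rfl fun y hy => by rw [h1 y hy]

theorem Regular.flow_one_le {t : ℝ} (ht : 0 ≤ t) (x : G) : hW.flow s D t (fun _ => 1) x ≤ 1 := by
  by_cases hx : x ∈ D
  swap
  · rw [hW.flow_off s D t _ hx]; exact zero_le_one
  have := hW.parabolic_nonneg (s := s) (D := D) (a := 0) (b := t)
    (z := fun t x => 1 - hW.flow s D t (fun _ => 1) x)
    (fun x _ => (continuous_const.sub (hW.continuous_flow s D _ x)).continuousOn)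
    (fun x hx t _ => ⟨_, (hasDerivAt_const t 1).sub (hW.hasDerivAt_flow s D t _ hx), by
      rw [hW.laplacian_sub, laplacian_const]⟩)
    (fun t _ _ _ z hz _ => by rw [hW.flow_off s D t _ hz]; norm_num)
    (fun x hx => by rw [hW.flow_zero s D _ hx]; norm_num) t ⟨ht, le_rfl⟩ x hx
  linarith

theorem Regular.flow_le_mul {t B : ℝ} (ht : 0 ≤ t) {f : G → ℝ} (hf : ∀ y ∈ D, f y ≤ B) (x : G) :
    hW.flow s D t f x ≤ B * hW.flow s D t (fun _ => 1) x := by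
  unfold Regular.flow
  rw [Finset.mul_sum]
  refine Finset.sum_le_sum fun y hy => ?_
  have h := mul_nonneg (hW.killed_nonneg s D ht x y) (hW.theta_pos s y).le
  calc _ = f y * (hW.killed s D t x y * W.theta s y) := by ring
    _ ≤ B * (hW.killed s D t x y * W.theta s y) := mul_le_mul_of_nonneg_right (hf y hy) h
    _ = _ := by ring

theorem Regular.abs_flow_le {t B : ℝ} (ht : 0 ≤ t) {f : G → ℝ} (hf : ∀ y ∈ D, |f y| ≤ B) (x : G) :
    |hW.flow s D t f x| ≤ B * hW.flow s D t (fun _ => 1) x := by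
  refine abs_le.2 ⟨?_, hW.flow_le_mul s D ht (fun y hy => (abs_le.1 (hf y hy)).2) x⟩
  have h1 := hW.flow_le_mul s D ht (f := fun y => -f y) (B := B)
    (fun y hy => by linarith [(abs_le.1 (hf y hy)).1]) x
  have : hW.flow s D t (fun y => -f y) x = -hW.flow s D t f x := by
    unfold Regular.flow
    rw [← Finset.sum_neg_distrib]
    exact Finset.sum_congr rfl fun y _ => by ring
  linarith

end semigroup

end

/-! ### Weighted `ℓ²` estimates for the killed semigroup -/

section

variable {G : Type*} {W : WeightedGraph G} {s : WalkSpeed}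

/-- The norm of `ℓ²(D, θ)`. -/
def l2 (W : WeightedGraph G) (s : WalkSpeed) (D : Finset G) (f : G → ℝ) : ℝ :=
  Real.sqrt (∑ z ∈ D, f z ^ 2 * W.theta s z)

theorem l2_nonneg (D : Finset G) (f : G → ℝ) : 0 ≤ W.l2 s D f := Real.sqrt_nonneg _

section l2

variable (hW : W.Regular) (s) (D : Finset G)
include hW

theorem Regular.l2_sq (f : G → ℝ) : W.l2 s D f ^ 2 = ∑ z ∈ D, f z ^ 2 * W.theta s z :=
  Real.sq_sqrt (Finset.sum_nonneg fun z _ => mul_nonneg (sq_nonneg _) (hW.theta_pos s z).le)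

theorem Regular.l2_mono {f g : G → ℝ} (h : ∀ z ∈ D, f z ^ 2 ≤ g z ^ 2) :
    W.l2 s D f ≤ W.l2 s D g :=
  Real.sqrt_le_sqrt (Finset.sum_le_sum fun z hz =>
    mul_le_mul_of_nonneg_right (h z hz) (hW.theta_pos s z).le)

theorem Regular.sum_mul_le_l2 (f g : G → ℝ) :
    ∑ z ∈ D, f z * g z * W.theta s z ≤ W.l2 s D f * W.l2 s D g := by
  have h := Finset.sum_mul_sq_le_sq_mul_sq D (fun z => f z * Real.sqrt (W.theta s z))
    (fun z => g z * Real.sqrt (W.theta s z))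
  have hs : ∀ z, Real.sqrt (W.theta s z) ^ 2 = W.theta s z :=
    fun z => Real.sq_sqrt (hW.theta_pos s z).le
  have e1 : ∀ z, f z * Real.sqrt (W.theta s z) * (g z * Real.sqrt (W.theta s z)) =
      f z * g z * W.theta s z := fun z => by rw [← hs z, Real.sqrt_sq (Real.sqrt_nonneg _)]; ring
  simp only [mul_pow, hs, e1] at h
  rw [← hW.l2_sq, ← hW.l2_sq, ← mul_pow] at h
  exact (abs_le_of_sq_le_sq' h (mul_nonneg (l2_nonneg D f) (l2_nonneg D g))).2

theorem Regular.l2_add_le (f g : G → ℝ) :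
    W.l2 s D (fun z => f z + g z) ≤ W.l2 s D f + W.l2 s D g := by
  refine Real.sqrt_le_iff.2 ⟨add_nonneg (l2_nonneg D f) (l2_nonneg D g), ?_⟩
  have h : ∑ z ∈ D, (f z + g z) ^ 2 * W.theta s z = ∑ z ∈ D, f z ^ 2 * W.theta s z +
      2 * ∑ z ∈ D, f z * g z * W.theta s z + ∑ z ∈ D, g z ^ 2 * W.theta s z := by
    rw [Finset.mul_sum, ← Finset.sum_add_distrib, ← Finset.sum_add_distrib]
    exact Finset.sum_congr rfl fun z _ => by ring
  rw [h, ← hW.l2_sq, ← hW.l2_sq]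
  nlinarith [hW.sum_mul_le_l2 s D f g]

theorem Regular.l2_killed (t : ℝ) (x : G) :
    W.l2 s D (hW.killed s D t x) = Real.sqrt (hW.killed s D (2 * t) x x) := by
  rw [← hW.sum_killed_sq]; rfl

end l2

theorem exp_add_exp_neg_le {z : ℝ} (h : |z| ≤ 1) : Real.exp z + Real.exp (-z) ≤ 2 * (1 + z ^ 2) := by
  have h1 := Real.cosh_le_exp_half_sq z
  rw [Real.cosh_eq] at h1
  have hz : z ^ 2 ≤ 1 := by rw [← sq_abs]; nlinarith [abs_nonneg z]
  have h2 := Real.one_sub_le_exp_neg (z ^ 2 / 2)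
  have h3 : Real.exp (z ^ 2 / 2) * Real.exp (-(z ^ 2 / 2)) = 1 := by
    rw [← Real.exp_add]; simp
  have h4 := Real.exp_pos (z ^ 2 / 2)
  have h5 : Real.exp (z ^ 2 / 2) * (1 - z ^ 2 / 2) ≤ 1 := by nlinarith
  nlinarith [sq_nonneg z]

/-- A function whose gradient is adapted to the reference measure: it varies by at most one along
edges and its energy density is at most `Γ`. -/
structure AdaptedTo (W : WeightedGraph G) (s : WalkSpeed) (Γ : ℝ) (ψ : G → ℝ) : Prop where
  lip : ∀ y z, 0 < W.ω y z → |ψ y - ψ z| ≤ 1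
  energy : ∀ y, ∀ D : Finset G, ∑ z ∈ D, W.ω y z * (ψ y - ψ z) ^ 2 ≤ Γ * W.theta s y

/-- The energy inequality behind Davies' method. In terms of `h = e^{lψ} F`, and after symmetrizing in
the two end points of an edge, the weight enters only through `2 cosh (l (ψ x - ψ y))`, which is at
most `2 (1 + l² (ψ x - ψ y)²)`. -/
theorem Regular.davies_energy (hW : W.Regular) {Γ : ℝ} {ψ : G → ℝ} (hψ : W.AdaptedTo s Γ ψ)
    {l : ℝ} (hl : |l| ≤ 1) {D : Finset G} {F : G → ℝ} (hF : ∀ y ∉ D, F y = 0) :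
    ∑ x ∈ D, Real.exp (2 * l * ψ x) * F x * (W.theta s x * W.laplacian s F x) ≤
      l ^ 2 * Γ * ∑ x ∈ D, Real.exp (2 * l * ψ x) * F x ^ 2 * W.theta s x := by
  set h : G → ℝ := fun x => Real.exp (l * ψ x) * F x with hh
  set a : G → G → ℝ := fun x y => W.ω x y * Real.exp (l * (ψ x - ψ y)) * (h x * h y) with ha
  set c : G → G → ℝ := fun x y => W.ω x y * (1 + l ^ 2 * (ψ x - ψ y) ^ 2) with hc
  have hsq : ∀ x, Real.exp (2 * l * ψ x) * F x ^ 2 = h x ^ 2 := fun x => by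
    simp only [hh, mul_pow, ← Real.exp_nat_mul]
    congr 2; push_cast; ring
  have h1 : ∀ x, Real.exp (2 * l * ψ x) * F x * (W.theta s x * W.laplacian s F x) =
      ∑ y ∈ D, a x y - W.weight x * h x ^ 2 := fun x => by
    rw [hW.theta_mul_laplacian_of_zero s hF, mul_sub, Finset.mul_sum, ← hsq]
    congr 1
    · refine Finset.sum_congr rfl fun y _ => ?_
      have : Real.exp (2 * l * ψ x) =
          Real.exp (l * (ψ x - ψ y)) * (Real.exp (l * ψ x) * Real.exp (l * ψ y)) := by
        rw [← Real.exp_add, ← Real.exp_add]; congr 1; ring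
      simp only [ha, hh]
      rw [this]; ring
    · ring
  have h2 : ∀ x y, a x y + a y x ≤ c x y * h x ^ 2 + c y x * h y ^ 2 := by
    intro x y
    have hcs : c y x = c x y := by simp only [hc]; rw [W.symm y x]; ring
    rw [hcs]
    by_cases hxy : 0 < W.ω x y
    · have hz : |l * (ψ x - ψ y)| ≤ 1 := by
        rw [abs_mul]
        exact mul_le_one₀ hl (abs_nonneg _) (hψ.lip x y hxy)
      have h3 := exp_add_exp_neg_le hz
      have e : a x y + a y x = W.ω x y * (Real.exp (l * (ψ x - ψ y)) +
          Real.exp (-(l * (ψ x - ψ y)))) * (h x * h y) := by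
        simp only [ha]
        rw [W.symm y x, show -(l * (ψ x - ψ y)) = l * (ψ y - ψ x) by ring]; ring
      rw [e]
      have h4 : h x * h y ≤ (h x ^ 2 + h y ^ 2) / 2 := by nlinarith [sq_nonneg (h x - h y)]
      calc _ ≤ W.ω x y * (Real.exp (l * (ψ x - ψ y)) +
          Real.exp (-(l * (ψ x - ψ y)))) * ((h x ^ 2 + h y ^ 2) / 2) := by gcongr
        _ ≤ W.ω x y * (2 * (1 + (l * (ψ x - ψ y)) ^ 2)) * ((h x ^ 2 + h y ^ 2) / 2) := by gcongr
        _ = _ := by simp only [hc]; ring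
    · have h0 := omega_eq_zero_of_not_pos hxy
      simp only [ha, hc]
      rw [W.symm y x, h0]; simp
  have h3 : ∑ x ∈ D, ∑ y ∈ D, a x y ≤ ∑ x ∈ D, ∑ y ∈ D, c x y * h x ^ 2 := by
    have e1 := Finset.sum_comm (s := D) (t := D) (f := a)
    have e2 := Finset.sum_comm (s := D) (t := D) (f := fun x y => c x y * h x ^ 2)
    have e3 := Finset.sum_le_sum fun x (_ : x ∈ D) => Finset.sum_le_sum fun y (_ : y ∈ D) => h2 x y
    simp only [Finset.sum_add_distrib] at e3
    linarith
  have h4 : ∑ x ∈ D, ∑ y ∈ D, c x y * h x ^ 2 ≤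
      ∑ x ∈ D, (W.weight x * h x ^ 2 + l ^ 2 * Γ * (h x ^ 2 * W.theta s x)) := by
    refine Finset.sum_le_sum fun x _ => ?_
    have e1 : ∑ y ∈ D, c x y * h x ^ 2 =
        ((∑ y ∈ D, W.ω x y) + l ^ 2 * ∑ y ∈ D, W.ω x y * (ψ x - ψ y) ^ 2) * h x ^ 2 := by
      rw [Finset.mul_sum, ← Finset.sum_add_distrib, Finset.sum_mul]
      exact Finset.sum_congr rfl fun y _ => by simp only [hc]; ring
    rw [e1]
    have := hW.sum_le_weight x D
    have := hψ.energy x D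
    calc _ ≤ (W.weight x + l ^ 2 * (Γ * W.theta s x)) * h x ^ 2 := by gcongr
      _ = _ := by ring
  rw [Finset.sum_congr rfl fun x _ => h1 x, Finset.sum_sub_distrib, Finset.mul_sum]
  rw [Finset.sum_add_distrib] at h4
  have h5 : ∑ x ∈ D, l ^ 2 * Γ * (Real.exp (2 * l * ψ x) * F x ^ 2 * W.theta s x) =
      ∑ x ∈ D, l ^ 2 * Γ * (h x ^ 2 * W.theta s x) :=
    Finset.sum_congr rfl fun x _ => by rw [hsq]
  rw [h5]
  linarith

/-- Davies' weighted `ℓ²` bound for the killed semigroup. -/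
theorem Regular.davies (hW : W.Regular) {Γ : ℝ} {ψ : G → ℝ} (hψ : W.AdaptedTo s Γ ψ)
    {l : ℝ} (hl : |l| ≤ 1) (D : Finset G) (f : G → ℝ) {t : ℝ} (ht : 0 ≤ t) :
    ∑ x ∈ D, Real.exp (2 * l * ψ x) * hW.flow s D t f x ^ 2 * W.theta s x ≤
      Real.exp (2 * (l ^ 2 * Γ) * t) *
        ∑ x ∈ D, Real.exp (2 * l * ψ x) * f x ^ 2 * W.theta s x := by
  set N : ℝ → ℝ := fun t =>
    ∑ x ∈ D, Real.exp (2 * l * ψ x) * hW.flow s D t f x ^ 2 * W.theta s x with hN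
  have hder : ∀ t, HasDerivAt N (2 * ∑ x ∈ D, Real.exp (2 * l * ψ x) * hW.flow s D t f x *
      (W.theta s x * W.laplacian s (hW.flow s D t f) x)) t := by
    intro t
    rw [Finset.mul_sum]
    refine HasDerivAt.fun_sum fun x hx => ?_
    have := (((hW.hasDerivAt_flow s D t f hx).pow 2).const_mul
      (Real.exp (2 * l * ψ x))).mul_const (W.theta s x)
    refine this.congr_deriv ?_
    simp only [Nat.cast_ofNat, Nat.add_one_sub_one, pow_one]
    ring
  have hle : ∀ t, 2 * ∑ x ∈ D, Real.exp (2 * l * ψ x) * hW.flow s D t f x *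
      (W.theta s x * W.laplacian s (hW.flow s D t f) x) ≤ 2 * (l ^ 2 * Γ) * N t := by
    intro t
    have := hW.davies_energy hψ hl (D := D) (F := hW.flow s D t f)
      (fun y hy => hW.flow_off s D t f hy)
    rw [mul_assoc]
    exact mul_le_mul_of_nonneg_left this zero_le_two
  have hd2 : ∀ t, HasDerivAt (fun t => Real.exp (-(2 * (l ^ 2 * Γ)) * t) * N t)
      (Real.exp (-(2 * (l ^ 2 * Γ)) * t) * (-(2 * (l ^ 2 * Γ))) * N t +
        Real.exp (-(2 * (l ^ 2 * Γ)) * t) * (2 * ∑ x ∈ D, Real.exp (2 * l * ψ x) *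
          hW.flow s D t f x * (W.theta s x * W.laplacian s (hW.flow s D t f) x))) t := by
    intro t
    have h1 : HasDerivAt (fun t : ℝ => -(2 * (l ^ 2 * Γ)) * t) (-(2 * (l ^ 2 * Γ))) t := by
      simpa using (hasDerivAt_id t).const_mul (-(2 * (l ^ 2 * Γ)))
    exact h1.exp.mul (hder t)
  have hanti : Antitone fun t => Real.exp (-(2 * (l ^ 2 * Γ)) * t) * N t := by
    refine antitone_of_deriv_nonpos (fun t => (hd2 t).differentiableAt) fun t => ?_
    rw [(hd2 t).deriv]
    nlinarith [hle t, Real.exp_pos (-(2 * (l ^ 2 * Γ)) * t)]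
  have h := hanti ht
  simp only [mul_zero, Real.exp_zero, one_mul] at h
  have h0 : N 0 = ∑ x ∈ D, Real.exp (2 * l * ψ x) * f x ^ 2 * W.theta s x :=
    Finset.sum_congr rfl fun x hx => by rw [hW.flow_zero s D f hx]
  rw [← h0]
  have h1 : Real.exp (2 * (l ^ 2 * Γ) * t) * Real.exp (-(2 * (l ^ 2 * Γ)) * t) = 1 := by
    rw [← Real.exp_add, ← Real.exp_zero]; congr 1; ring
  calc N t = Real.exp (2 * (l ^ 2 * Γ) * t) * (Real.exp (-(2 * (l ^ 2 * Γ)) * t) * N t) := by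
        rw [← mul_assoc, h1, one_mul]
    _ ≤ _ := mul_le_mul_of_nonneg_left h (Real.exp_pos _).le

open scoped Classical in
/-- The part of `f` that lives where `ψ ≥ r`. -/
def outer (ψ : G → ℝ) (r : ℝ) (f : G → ℝ) (z : G) : ℝ := if r ≤ ψ z then f z else 0

/-- Propagation estimate: mass that starts in `{ψ ≤ r}` and ends in `{ψ ≥ r'}`. -/
theorem Regular.l2_outer_flow_le (hW : W.Regular) {Γ : ℝ} {ψ : G → ℝ} (hψ : W.AdaptedTo s Γ ψ)
    {l : ℝ} (hl0 : 0 ≤ l) (hl : l ≤ 1) (D : Finset G) {f : G → ℝ} {r : ℝ} (r' : ℝ)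
    (hf : ∀ z ∈ D, r < ψ z → f z = 0) {t : ℝ} (ht : 0 ≤ t) :
    W.l2 s D (outer ψ r' (hW.flow s D t f)) ≤
      Real.exp (-(l * (r' - r)) + Γ * l ^ 2 * t) * W.l2 s D f := by
  have hdav := hW.davies hψ (l := l) (by rwa [abs_of_nonneg hl0]) D f ht
  have h1 : Real.exp (2 * l * r') * W.l2 s D (outer ψ r' (hW.flow s D t f)) ^ 2 ≤
      ∑ x ∈ D, Real.exp (2 * l * ψ x) * hW.flow s D t f x ^ 2 * W.theta s x := by
    rw [hW.l2_sq, Finset.mul_sum]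
    refine Finset.sum_le_sum fun z _ => ?_
    rw [← mul_assoc]
    refine mul_le_mul_of_nonneg_right ?_ (hW.theta_pos s z).le
    unfold outer
    split_ifs with h
    · exact mul_le_mul_of_nonneg_right (Real.exp_le_exp.2 (by gcongr)) (sq_nonneg _)
    · rw [zero_pow two_ne_zero, mul_zero]
      positivity
  have h2 : ∑ x ∈ D, Real.exp (2 * l * ψ x) * f x ^ 2 * W.theta s x ≤
      Real.exp (2 * l * r) * W.l2 s D f ^ 2 := by
    rw [hW.l2_sq, Finset.mul_sum]
    refine Finset.sum_le_sum fun z hz => ?_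
    rw [← mul_assoc]
    refine mul_le_mul_of_nonneg_right ?_ (hW.theta_pos s z).le
    by_cases h : r < ψ z
    · rw [hf z hz h]; simp
    · push Not at h
      exact mul_le_mul_of_nonneg_right (Real.exp_le_exp.2 (by gcongr)) (sq_nonneg _)
  refine (pow_le_pow_iff_left₀ (l2_nonneg _ _)
    (mul_nonneg (Real.exp_pos _).le (l2_nonneg D f)) two_ne_zero).1 ?_
  rw [mul_pow, ← Real.exp_nat_mul]
  refine le_of_mul_le_mul_left ?_ (Real.exp_pos (2 * l * r'))
  calc _ ≤ Real.exp (2 * (l ^ 2 * Γ) * t) * (Real.exp (2 * l * r) * W.l2 s D f ^ 2) :=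
        h1.trans (hdav.trans (mul_le_mul_of_nonneg_left h2 (Real.exp_pos _).le))
    _ = _ := by
        rw [← mul_assoc (Real.exp _), ← mul_assoc (Real.exp (2 * l * r')), ← Real.exp_add,
          ← Real.exp_add]
        congr 2; push_cast; ring

/-- The propagation estimate started from the point mass at `x`. -/
theorem Regular.l2_outer_killed_zero_le (hW : W.Regular) {Γ : ℝ} {ψ : G → ℝ}
    (hψ : W.AdaptedTo s Γ ψ) {l : ℝ} (hl0 : 0 ≤ l) (hl : l ≤ 1) {D : Finset G} {x : G}
    (hx : ψ x = 0) (hxD : x ∈ D) (r : ℝ) {t : ℝ} (ht : 0 ≤ t) :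
    W.l2 s D (outer ψ r (hW.killed s D t x)) ≤
      Real.exp (-(l * r) + Γ * l ^ 2 * t) * (1 / Real.sqrt (W.theta s x)) := by
  classical
  have hθ := hW.theta_pos s x
  set f : G → ℝ := fun z => if z = x then 1 / W.theta s x else 0 with hf
  have h1 : hW.flow s D t f = hW.killed s D t x := by
    funext z
    unfold Regular.flow
    rw [Finset.sum_eq_single_of_mem x hxD]
    · simp only [hf, if_true]
      rw [hW.killed_comm]; field_simp
    · intro y _ hy; simp only [hf, if_neg hy]; ring
  have h2 : W.l2 s D f = 1 / Real.sqrt (W.theta s x) := by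
    unfold l2
    rw [Finset.sum_eq_single_of_mem x hxD]
    · simp only [hf, if_true]
      rw [show (1 / W.theta s x) ^ 2 * W.theta s x = (W.theta s x)⁻¹ by field_simp,
        Real.sqrt_inv, one_div]
    · intro y _ hy; simp only [hf, if_neg hy]; ring
  have := hW.l2_outer_flow_le hψ hl0 hl D (f := f) (r := 0) r (fun z _ hz => by
    simp only [hf]
    rw [if_neg]
    rintro rfl
    linarith) ht
  rwa [h1, h2, sub_zero] at this

/-- One step of the integrated maximum principle: mass in `{ψ ≥ r'}` at time `τ + t` either was in
`{ψ ≥ r}` at time `t`, or has travelled from `{ψ < r}` during the time `τ`. -/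
theorem Regular.l2_outer_killed_step (hW : W.Regular) {Γ : ℝ} {ψ : G → ℝ}
    (hψ : W.AdaptedTo s Γ ψ) {l : ℝ} (hl0 : 0 ≤ l) (hl : l ≤ 1) (D : Finset G) (x : G)
    (r r' : ℝ) (t : ℝ) {τ : ℝ} (hτ : 0 ≤ τ) :
    W.l2 s D (outer ψ r' (hW.killed s D (τ + t) x)) ≤ W.l2 s D (outer ψ r (hW.killed s D t x)) +
      Real.exp (-(l * (r' - r)) + Γ * l ^ 2 * τ) * Real.sqrt (hW.killed s D (2 * t) x x) := by
  classical
  set f := hW.killed s D t x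
  set f₁ : G → ℝ := fun z => if r ≤ ψ z then 0 else f z with hf₁
  have hsplit : ∀ z, outer ψ r' (hW.killed s D (τ + t) x) z =
      outer ψ r' (hW.flow s D τ (outer ψ r f)) z + outer ψ r' (hW.flow s D τ f₁) z := by
    intro z
    have h1 : hW.killed s D (τ + t) x z =
        hW.flow s D τ (outer ψ r f) z + hW.flow s D τ f₁ z := by
      rw [hW.killed_comm, ← hW.killed_add]
      unfold Regular.flow
      rw [← Finset.sum_add_distrib]
      refine Finset.sum_congr rfl fun y _ => ?_
      simp only [hf₁, outer]
      rw [hW.killed_comm s D t y x]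
      split_ifs <;> ring
    unfold outer at h1 ⊢
    split_ifs with h
    · exact h1
    · simp
  have h0 : W.l2 s D (outer ψ r' (hW.flow s D τ (outer ψ r f))) ≤ W.l2 s D (outer ψ r f) := by
    have h1 : W.l2 s D (outer ψ r' (hW.flow s D τ (outer ψ r f))) ≤
        W.l2 s D (hW.flow s D τ (outer ψ r f)) := hW.l2_mono s D fun z _ => by
      rw [outer.eq_1 ψ r']
      split_ifs
      · exact le_rfl
      · rw [zero_pow two_ne_zero]; positivity
    refine h1.trans ?_
    have := hW.davies hψ (l := 0) (by simp) D (outer ψ r f) hτ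
    simp only [mul_zero, zero_mul, Real.exp_zero, one_mul, ne_eq, OfNat.ofNat_ne_zero,
      not_false_eq_true, zero_pow] at this
    exact Real.sqrt_le_sqrt this
  have h2 : W.l2 s D (outer ψ r' (hW.flow s D τ f₁)) ≤
      Real.exp (-(l * (r' - r)) + Γ * l ^ 2 * τ) * Real.sqrt (hW.killed s D (2 * t) x x) := by
    refine (hW.l2_outer_flow_le hψ hl0 hl D (f := f₁) (r := r) r'
      (fun z _ hz => if_pos hz.le) hτ).trans ?_
    refine mul_le_mul_of_nonneg_left ?_ (Real.exp_pos _).le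
    rw [← hW.l2_killed]
    refine hW.l2_mono s D fun z _ => ?_
    simp only [hf₁]
    split_ifs
    · rw [zero_pow two_ne_zero]; positivity
    · exact le_rfl
  rw [show outer ψ r' (hW.killed s D (τ + t) x) = _ from funext hsplit]
  exact (hW.l2_add_le s D _ _).trans (add_le_add h0 h2)

end

/-! ### Off-diagonal upper bounds -/

section

universe u

theorem exists_exp_neg_le_rpow {d : ℝ} (hd : 0 < d) : ∃ K : ℝ, 0 < K ∧ ∀ z : ℝ, 0 < z →
    Real.exp (-z) ≤ K * z ^ (-d) := by
  set n := ⌈d⌉₊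
  refine ⟨n.factorial, by exact_mod_cast n.factorial_pos, fun z hz => ?_⟩
  have hf : (1 : ℝ) ≤ n.factorial := by exact_mod_cast n.factorial_pos
  have h1 : z ^ d ≤ n.factorial * Real.exp z := by
    rcases le_total 1 z with h | h
    · calc z ^ d ≤ z ^ (n : ℝ) := Real.rpow_le_rpow_of_exponent_le h (Nat.le_ceil d)
        _ = z ^ n := Real.rpow_natCast z n
        _ ≤ _ := by
          have := Real.pow_div_factorial_le_exp z hz.le n
          rwa [div_le_iff₀ (by positivity), mul_comm] at this
    · have := Real.rpow_le_one hz.le h hd.le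
      have := Real.one_le_exp hz.le
      nlinarith
  rw [Real.rpow_neg hz.le, Real.exp_neg, ← div_eq_mul_inv, inv_eq_one_div,
    div_le_div_iff₀ (Real.exp_pos _) (Real.rpow_pos_of_pos hz d), one_mul]
  exact h1

/-- The contribution of the `k`-th dyadic time scale to the off-diagonal bound decays
geometrically in `k`. The base `81 / 50 = 2 (9 / 10)²` reflects times decreasing by the factor `1 / 2`
and distances by the factor `9 / 10`. -/
theorem exists_dyadic_term_le {d C b c : ℝ} (hd : 0 < d) (hC : 0 < C) (hb : 0 < b) (hc : 0 < c) :
    ∃ K : ℝ, 0 < K ∧ ∃ ρ : ℝ, 0 < ρ ∧ ρ < 1 ∧ ∀ L t : ℝ, 0 < L → 0 < t → t ≤ b * L ^ 2 → ∀ k : ℕ,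
      Real.exp (-(c * (L ^ 2 / t) * (81 / 50) ^ k)) * Real.sqrt (C * (t / 2 ^ k) ^ (-d / 2)) ≤
        K * ρ ^ k * (t ^ (d / 4) * L ^ (-d)) := by
  obtain ⟨K, hK, hKz⟩ := exists_exp_neg_le_rpow hd
  refine ⟨K * c ^ (-d) * Real.sqrt C * b ^ (d / 2), by positivity,
    (81 / 50 : ℝ) ^ (-d) * 2 ^ (d / 4), by positivity, ?_, fun L t hL ht htb k => ?_⟩
  · have h1 : (2 : ℝ) ^ (d / 4) < (81 / 50 : ℝ) ^ d := by
      have h2 : (81 / 50 : ℝ) ^ d = ((81 / 50 : ℝ) ^ (4 : ℕ)) ^ (d / 4) := by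
        rw [← Real.rpow_natCast, ← Real.rpow_mul (by norm_num)]
        congr 1; push_cast; ring
      rw [h2]
      exact Real.rpow_lt_rpow (by norm_num) (by norm_num) (by positivity)
    rw [Real.rpow_neg (by norm_num), inv_mul_eq_div, div_lt_one (by positivity)]
    exact h1
  have h1 : Real.exp (-(c * (L ^ 2 / t) * (81 / 50) ^ k)) ≤
      K * (c ^ (-d) * (L ^ 2 / t) ^ (-d) * ((81 / 50 : ℝ) ^ (-d)) ^ k) := by
    refine (hKz _ (by positivity)).trans_eq ?_
    rw [Real.mul_rpow (by positivity) (by positivity), Real.mul_rpow (by positivity) (by positivity),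
      Real.rpow_pow_comm (by norm_num)]
  have h2 : Real.sqrt (C * (t / 2 ^ k) ^ (-d / 2)) =
      Real.sqrt C * (t ^ (-d / 4) * ((2 : ℝ) ^ (d / 4)) ^ k) := by
    rw [Real.sqrt_mul hC.le, Real.sqrt_eq_rpow ((t / 2 ^ k) ^ (-d / 2)),
      ← Real.rpow_mul (by positivity), Real.div_rpow ht.le (by positivity),
      show -d / 2 * (1 / 2) = -d / 4 by ring, div_eq_mul_inv (t ^ (-d / 4)),
      ← Real.rpow_neg (by positivity), show -(-d / 4) = d / 4 by ring, ← Real.rpow_natCast,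
      ← Real.rpow_natCast, ← Real.rpow_mul (by positivity), ← Real.rpow_mul (by positivity),
      mul_comm (k : ℝ)]
  have h3 : (L ^ 2 / t) ^ (-d) * t ^ (-d / 4) ≤ b ^ (d / 2) * (t ^ (d / 4) * L ^ (-d)) := by
    have e1 : (L ^ 2 / t) ^ (-d) * t ^ (-d / 4) =
        (t / L ^ 2) ^ (d / 2) * (t ^ (d / 4) * L ^ (-d)) := by
      have e2 : (L ^ 2 / t) ^ (-d) = (t / L ^ 2) ^ (d / 2) * (t / L ^ 2) ^ (d / 2) := by
        rw [← Real.rpow_add (by positivity), Real.rpow_neg (by positivity),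
          ← Real.inv_rpow (by positivity), inv_div]
        congr 1; ring
      have e3 : (t / L ^ 2) ^ (d / 2) = t ^ (d / 2) * L ^ (-d) := by
        rw [Real.div_rpow ht.le (by positivity), Real.rpow_neg hL.le, ← Real.rpow_natCast L 2,
          ← Real.rpow_mul hL.le, div_eq_mul_inv]
        congr 3; push_cast; ring
      have e4 : t ^ (d / 2) * t ^ (-d / 4) = t ^ (d / 4) := by
        rw [← Real.rpow_add ht]; congr 1; ring
      rw [e2, mul_assoc]
      congr 1
      rw [e3, ← e4]; ring
    rw [e1]
    refine mul_le_mul_of_nonneg_right (Real.rpow_le_rpow (by positivity) ?_ (by positivity))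
      (by positivity)
    rwa [div_le_iff₀ (by positivity)]
  rw [h2]
  calc _ ≤ K * (c ^ (-d) * (L ^ 2 / t) ^ (-d) * ((81 / 50 : ℝ) ^ (-d)) ^ k) *
        (Real.sqrt C * (t ^ (-d / 4) * ((2 : ℝ) ^ (d / 4)) ^ k)) :=
        mul_le_mul_of_nonneg_right h1 (by positivity)
    _ = K * c ^ (-d) * Real.sqrt C * (((81 / 50 : ℝ) ^ (-d)) ^ k * ((2 : ℝ) ^ (d / 4)) ^ k) *
        ((L ^ 2 / t) ^ (-d) * t ^ (-d / 4)) := by ring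
    _ ≤ K * c ^ (-d) * Real.sqrt C * (((81 / 50 : ℝ) ^ (-d)) ^ k * ((2 : ℝ) ^ (d / 4)) ^ k) *
        (b ^ (d / 2) * (t ^ (d / 4) * L ^ (-d))) :=
        mul_le_mul_of_nonneg_left h3 (by positivity)
    _ = _ := by rw [mul_pow]; ring

/-- For times up to `2 t₀` the mass at distance at least `L / 4` is negligible, if
`exp(-L² / (128 Γ t₀))` is. -/
theorem Regular.l2_outer_killed_short {G : Type u} {W : WeightedGraph G} {s : WalkSpeed}
    (hW : W.Regular) {Γ : ℝ} (hΓ : 1 ≤ Γ) {D : Finset G} {ψ : G → ℝ} (hψ : W.AdaptedTo s Γ ψ)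
    {x : G} (hxD : x ∈ D) (hx : ψ x = 0) {L t₀ m d : ℝ} (hL : 0 < L) (hLt : L ≤ t₀)
    (hm : 0 < m) (hmθ : m ≤ W.theta s x)
    (hsmall : Real.exp (-(L ^ 2 / (128 * Γ * t₀))) ≤ m * L ^ (-d)) {t r : ℝ} (ht : 0 ≤ t)
    (ht2 : t ≤ 2 * t₀) (hr : L / 4 ≤ r) :
    W.l2 s D (outer ψ r (hW.killed s D t x)) ≤ Real.sqrt m * L ^ (-d) := by
  have ht₀ : 0 < t₀ := hL.trans_le hLt
  have hΓ0 : 0 < Γ := by linarith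
  set l := L / (16 * Γ * t₀) with hl
  have hl0 : 0 ≤ l := by positivity
  have hl1 : l ≤ 1 := by
    rw [hl, div_le_one (by positivity)]
    nlinarith [mul_le_mul hΓ hLt hL.le hΓ0.le]
  refine (hW.l2_outer_killed_zero_le hψ hl0 hl1 hx hxD r ht).trans ?_
  have h1 : -(l * r) + Γ * l ^ 2 * t ≤ -(L ^ 2 / (128 * Γ * t₀)) := by
    have h2 : l * (L / 4) ≤ l * r := mul_le_mul_of_nonneg_left hr hl0
    have h3 : Γ * l ^ 2 * t ≤ Γ * l ^ 2 * (2 * t₀) := mul_le_mul_of_nonneg_left ht2 (by positivity)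
    have h4 : -(l * (L / 4)) + Γ * l ^ 2 * (2 * t₀) = -(L ^ 2 / (128 * Γ * t₀)) := by
      rw [hl]; field_simp; ring
    linarith
  have hs : Real.sqrt m * Real.sqrt m = m := Real.mul_self_sqrt hm.le
  have hsp := Real.sqrt_pos.2 hm
  calc _ ≤ (m * L ^ (-d)) * (1 / Real.sqrt m) := by
        refine mul_le_mul ((Real.exp_le_exp.2 h1).trans hsmall) ?_ (by positivity) (by positivity)
        exact one_div_le_one_div_of_le hsp (Real.sqrt_le_sqrt hmθ)
    _ = (Real.sqrt m * Real.sqrt m * L ^ (-d)) * (1 / Real.sqrt m) := by rw [hs]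
    _ = _ := by field_simp

/-- Iteration of the integrated maximum principle over dyadic times `t / 2 ^ k`. The radii `R k`
decrease from `L / 2` towards `L / 4`, and the iteration stops at the last dyadic time that is at least
`t₀`, where almost no mass has travelled the distance `L / 4`. -/
theorem exists_l2_outer_killed_le {d C b Γ : ℝ} (hd : 0 < d) (hC : 0 < C) (hb : 0 < b)
    (hΓ : 1 ≤ Γ) :
    ∃ K : ℝ, 0 < K ∧ ∀ {G : Type u} {W : WeightedGraph G} {s : WalkSpeed} (hW : W.Regular)
      {D : Finset G} {ψ : G → ℝ}, W.AdaptedTo s Γ ψ → ∀ {x : G}, x ∈ D → ψ x = 0 →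
      ∀ {L t₀ m : ℝ}, 0 < L → L ≤ t₀ → 1 ≤ t₀ → 0 < m → m ≤ 1 → m ≤ W.theta s x →
      Real.exp (-(L ^ 2 / (128 * Γ * t₀))) ≤ m * L ^ (-d) →
      (∀ t ≥ t₀, hW.killed s D t x x ≤ C * t ^ (-d / 2)) →
      ∀ t, t₀ ≤ t → t ≤ b * L ^ 2 →
        W.l2 s D (outer ψ (L / 2) (hW.killed s D t x)) ≤ K * (t ^ (d / 4) * L ^ (-d)) := by
  have hΓ0 : 0 < Γ := by linarith
  obtain ⟨K, hK, ρ, hρ0, hρ1, hterm⟩ := exists_dyadic_term_le hd hC hb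
    (show 0 < 1 / (3200 * Γ) by positivity)
  have hρ2 : 0 < 1 - ρ := by linarith
  refine ⟨K / (1 - ρ) + 1, by positivity, ?_⟩
  intro G W s hW D ψ hψ x hxD hx L t₀ m hL hLt ht1 hm hm1 hmθ hsmall hdiag t htt htb
  have ht₀ : 0 < t₀ := by linarith
  have ht : 0 < t := by linarith
  set a := t ^ (d / 4) * L ^ (-d) with ha
  have ha0 : 0 < a := by positivity
  set R : ℕ → ℝ := fun k => L / 4 + L / 4 * (9 / 10) ^ k with hR
  have hstep : ∀ k : ℕ, t₀ ≤ t / 2 ^ (k + 1) →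
      W.l2 s D (outer ψ (R k) (hW.killed s D (t / 2 ^ k) x)) ≤
        W.l2 s D (outer ψ (R (k + 1)) (hW.killed s D (t / 2 ^ (k + 1)) x)) + K * ρ ^ k * a := by
    intro k hk
    set τ := t / 2 ^ (k + 1) with hτ
    have hτ0 : 0 < τ := by positivity
    have h2τ : t / 2 ^ k = 2 * τ := by rw [hτ, pow_succ]; field_simp
    set g := L / 40 * (9 / 10 : ℝ) ^ k with hg
    have hg0 : 0 < g := by positivity
    have hgL : g ≤ L := by
      have : (9 / 10 : ℝ) ^ k ≤ 1 := pow_le_one₀ (by norm_num) (by norm_num)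
      rw [hg]; nlinarith
    have hRg : R k - R (k + 1) = g := by simp only [hR, hg, pow_succ]; ring
    -- This slope minimizes `-l g + Γ l² τ`.
    set l := g / (2 * Γ * τ) with hl
    have hl0 : 0 ≤ l := by positivity
    have hl1 : l ≤ 1 := by
      rw [hl, div_le_one (by positivity)]
      nlinarith [mul_le_mul hΓ (hgL.trans (hLt.trans hk)) hg0.le hΓ0.le]
    have h := hW.l2_outer_killed_step hψ hl0 hl1 D x (R (k + 1)) (R k) τ hτ0.le
    rw [hRg, ← two_mul, ← h2τ] at h
    refine h.trans (add_le_add le_rfl ?_)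
    refine le_trans ?_ (hterm L t hL ht htb k)
    refine mul_le_mul (Real.exp_le_exp.2 (le_of_eq ?_)) (Real.sqrt_le_sqrt (hdiag _ ?_))
      (Real.sqrt_nonneg _) (Real.exp_pos _).le
    · have e1 : (81 / 50 : ℝ) ^ k = (9 / 10) ^ k * (9 / 10) ^ k * 2 ^ k := by
        rw [← mul_pow, ← mul_pow]; norm_num
      rw [hl, hg, hτ, e1, pow_succ]
      field_simp; ring
    · rw [h2τ]; linarith
  have hsum : ∀ k : ℕ, t₀ ≤ t / 2 ^ k →
      W.l2 s D (outer ψ (L / 2) (hW.killed s D t x)) ≤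
        (∑ j ∈ Finset.range k, K * ρ ^ j * a) +
          W.l2 s D (outer ψ (R k) (hW.killed s D (t / 2 ^ k) x)) := by
    intro k
    induction k with
    | zero =>
      intro _
      have e : R 0 = L / 2 := by simp only [hR, pow_zero]; ring
      simp [e]
    | succ k ih =>
      intro hk
      have hk' : t₀ ≤ t / 2 ^ k := hk.trans
        (div_le_div_of_nonneg_left ht.le (by positivity) (pow_le_pow_right₀ one_le_two k.le_succ))
      have h1 := ih hk'
      have h2 := hstep k hk
      rw [Finset.sum_range_succ]
      linarith
  obtain ⟨N, hN1, hN2⟩ := exists_nat_pow_near (x := t / t₀) (y := 2)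
    ((one_le_div ht₀).2 htt) one_lt_two
  have hN1' : t₀ ≤ t / 2 ^ N := by
    rw [le_div_iff₀ (by positivity)]
    rwa [le_div_iff₀ ht₀, mul_comm] at hN1
  have hN2' : t / 2 ^ N ≤ 2 * t₀ := by
    rw [div_le_iff₀ (by positivity)]
    rw [div_lt_iff₀ ht₀, pow_succ] at hN2
    nlinarith
  have hfin : W.l2 s D (outer ψ (R N) (hW.killed s D (t / 2 ^ N) x)) ≤ a := by
    refine (hW.l2_outer_killed_short hΓ hψ hxD hx hL hLt hm hmθ hsmall (by positivity) hN2'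
      (by simp only [hR]; have : 0 < L / 4 * (9 / 10) ^ N := by positivity
          linarith)).trans ?_
    refine mul_le_mul_of_nonneg_right ?_ (by positivity)
    have h1 : Real.sqrt m ≤ 1 := Real.sqrt_le_one.2 hm1
    have h2 : 1 ≤ t ^ (d / 4) := Real.one_le_rpow (by linarith) (by positivity)
    linarith
  have hgeom : ∑ j ∈ Finset.range N, K * ρ ^ j * a ≤ K / (1 - ρ) * a := by
    rw [← Finset.sum_mul, ← Finset.mul_sum]
    refine mul_le_mul_of_nonneg_right ?_ ha0.le
    rw [div_eq_mul_inv]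
    refine mul_le_mul_of_nonneg_left ?_ hK.le
    have := Summable.sum_le_tsum (Finset.range N) (fun j _ => pow_nonneg hρ0.le j)
      (summable_geometric_of_lt_one hρ0.le hρ1)
    rwa [tsum_geometric_of_lt_one hρ0.le hρ1] at this
  have := hsum N hN1'
  rw [add_mul, one_mul]
  linarith

/-- Off-diagonal upper bound of order `L^{-d}`, uniformly over all times up to a multiple of `L²`,
for two points at distance at least `L` in an adapted metric `ρ`. The on-diagonal bound is needed
only for times beyond some `t₀` that is small compared with `L²`. -/
theorem exists_killed_le_of_far {d C b Γ : ℝ} (hd : 0 < d) (hC : 0 < C) (hb : 0 < b)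
    (hΓ : 1 ≤ Γ) :
    ∃ K : ℝ, 0 < K ∧ ∀ {G : Type u} {W : WeightedGraph G} {s : WalkSpeed} (hW : W.Regular)
      {D : Finset G} {ρ : G → G → ℝ}, (∀ x, W.AdaptedTo s Γ (ρ x)) → (∀ x, ρ x x = 0) →
      (∀ x y z, ρ x y ≤ ρ x z + ρ y z) → ∀ {x y : G}, x ∈ D → y ∈ D →
      ∀ {L t₀ m : ℝ}, 0 < L → L ≤ t₀ → 1 ≤ t₀ → 0 < m → m ≤ 1 → m ≤ W.theta s x →
      m ≤ W.theta s y → Real.exp (-(L ^ 2 / (128 * Γ * t₀))) ≤ m * L ^ (-d) →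
      (∀ t ≥ t₀, ∀ z ∈ D, hW.killed s D t z z ≤ C * t ^ (-d / 2)) → L ≤ ρ x y →
      ∀ t, 0 ≤ t → t ≤ b * L ^ 2 → hW.killed s D t x y ≤ K * L ^ (-d) := by
  obtain ⟨K, hK, hmain⟩ := exists_l2_outer_killed_le.{u} hd hC hb hΓ
  refine ⟨2 * K * Real.sqrt C + 2, by positivity, ?_⟩
  intro G W s hW D ρ hρ hρ0 hρt x y hx hy L t₀ m hL hLt ht1 hm hm1 hmx hmy hsmall hdiag hxy t ht htb
  classical
  set u := t / 2 with hu
  have htu : t = u + u := by rw [hu]; ring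
  have hsp := Real.sqrt_pos.2 hm
  -- Every intermediate point is far from `x` or far from `y`.
  have hsplit : hW.killed s D t x y ≤
      W.l2 s D (outer (ρ x) (L / 2) (hW.killed s D u x)) * W.l2 s D (hW.killed s D u y) +
      W.l2 s D (outer (ρ y) (L / 2) (hW.killed s D u y)) * W.l2 s D (hW.killed s D u x) := by
    rw [htu, ← hW.killed_add]
    refine le_trans ?_ (add_le_add (hW.sum_mul_le_l2 s D _ _) (hW.sum_mul_le_l2 s D _ _))
    rw [← Finset.sum_add_distrib]
    refine Finset.sum_le_sum fun z _ => ?_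
    rw [hW.killed_comm s D u z y, ← add_mul]
    refine mul_le_mul_of_nonneg_right ?_ (hW.theta_pos s z).le
    have h1 := hW.killed_nonneg s D (show 0 ≤ u by positivity) x z
    have h2 := hW.killed_nonneg s D (show 0 ≤ u by positivity) y z
    have h3 := mul_nonneg h1 h2
    unfold outer
    split_ifs with h4 h5 h5
    · nlinarith
    · linarith
    · linarith
    · have := hρt x y z
      push Not at h4 h5
      linarith
  have hle : ∀ z ∈ D, m ≤ W.theta s z → W.l2 s D (hW.killed s D u z) ≤ 1 / Real.sqrt m := by
    intro z hz hmz
    have h := hW.l2_outer_killed_zero_le (hρ z) (l := 0) le_rfl zero_le_one (hρ0 z) hz 0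
      (show 0 ≤ u by positivity)
    simp only [zero_mul, ne_eq, OfNat.ofNat_ne_zero, not_false_eq_true, zero_pow, mul_zero,
      neg_zero, add_zero, Real.exp_zero, one_mul] at h
    have h0 : outer (ρ z) 0 (hW.killed s D u z) = hW.killed s D u z := by
      funext y
      have := hρt z z y
      rw [hρ0] at this
      exact if_pos (by linarith)
    rw [h0] at h
    exact h.trans (one_div_le_one_div_of_le hsp (Real.sqrt_le_sqrt hmz))
  rcases le_total u t₀ with hut | hut
  · have key : ∀ z ∈ D, m ≤ W.theta s z →
        W.l2 s D (outer (ρ z) (L / 2) (hW.killed s D u z)) ≤ Real.sqrt m * L ^ (-d) :=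
      fun z hz hmz => hW.l2_outer_killed_short hΓ (hρ z) hz (hρ0 z) hL hLt hm hmz hsmall
        (by positivity) (by linarith) (by linarith)
    have h1 := mul_le_mul (key x hx hmx) (hle y hy hmy) (l2_nonneg _ _) (by positivity)
    have h2 := mul_le_mul (key y hy hmy) (hle x hx hmx) (l2_nonneg _ _) (by positivity)
    have e : Real.sqrt m * L ^ (-d) * (1 / Real.sqrt m) = L ^ (-d) := by field_simp
    rw [e] at h1 h2
    have h3 : 0 ≤ 2 * K * Real.sqrt C * L ^ (-d) := by positivity
    rw [add_mul]
    linarith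
  · have hu0 : 0 < u := by linarith
    have key : ∀ z ∈ D, m ≤ W.theta s z →
        W.l2 s D (outer (ρ z) (L / 2) (hW.killed s D u z)) ≤ K * (u ^ (d / 4) * L ^ (-d)) :=
      fun z hz hmz => hmain hW (hρ z) hz (hρ0 z) hL hLt ht1 hm hm1 hmz hsmall
        (fun t ht => hdiag t ht z hz) u hut (by linarith)
    have key2 : ∀ z ∈ D, W.l2 s D (hW.killed s D u z) ≤ Real.sqrt C * u ^ (-d / 4) := by
      intro z hz
      rw [hW.l2_killed]
      have h1 : hW.killed s D (2 * u) z z ≤ C * u ^ (-d / 2) :=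
        (hW.killed_self_antitone s D z (by linarith : u ≤ 2 * u)).trans (hdiag u hut z hz)
      refine (Real.sqrt_le_sqrt h1).trans_eq ?_
      rw [Real.sqrt_mul hC.le, Real.sqrt_eq_rpow (u ^ (-d / 2)), ← Real.rpow_mul hu0.le]
      congr 2; ring
    have e : K * (u ^ (d / 4) * L ^ (-d)) * (Real.sqrt C * u ^ (-d / 4)) =
        K * Real.sqrt C * L ^ (-d) := by
      have : u ^ (d / 4) * u ^ (-d / 4) = 1 := by
        rw [← Real.rpow_add hu0, ← Real.rpow_zero u]; congr 1; ring
      calc _ = K * Real.sqrt C * L ^ (-d) * (u ^ (d / 4) * u ^ (-d / 4)) := by ring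
        _ = _ := by rw [this, mul_one]
    have h1 := mul_le_mul (key x hx hmx) (key2 y hy) (l2_nonneg _ _) (by positivity)
    have h2 := mul_le_mul (key y hy hmy) (key2 x hx) (l2_nonneg _ _) (by positivity)
    rw [e] at h1 h2
    have h3 : 0 ≤ L ^ (-d) := by positivity
    rw [add_mul]
    linarith

end

/-! ### The Poisson equation on a finite set -/

section

universe v

variable {G : Type*} {W : WeightedGraph G} {s : WalkSpeed}

theorem Regular.flow_one_le_half (hW : W.Regular) {A : Finset G} {t U : ℝ}
    (hU : ∀ x ∈ A, ∀ y ∈ A, hW.killed s A t x y ≤ U) (hUA : U * ∑ y ∈ A, W.theta s y ≤ 1 / 2) :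
    ∀ x ∈ A, hW.flow s A t (fun _ => 1) x ≤ 1 / 2 := by
  intro x hx
  refine le_trans ?_ hUA
  rw [Finset.mul_sum]
  refine Finset.sum_le_sum fun y hy => ?_
  rw [mul_one]
  exact mul_le_mul_of_nonneg_right (hU x hx y hy) (hW.theta_pos s y).le

theorem Regular.hasDerivAt_flow' (hW : W.Regular) {A : Finset G} {f : G → ℝ}
    (hf : ∀ y ∉ A, f y = 0) (t : ℝ) {x : G} (hx : x ∈ A) :
    HasDerivAt (fun r => hW.flow s A r f x) (hW.flow s A t (W.laplacian s f) x) t := by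
  rw [← hW.laplacian_flow_eq s A t hf hx]
  exact hW.hasDerivAt_flow s A t f hx

/-- `P_t f - f` is the time integral of `P_r L f`. -/
theorem Regular.flow_sub_le (hW : W.Regular) {A : Finset G} {f : G → ℝ}
    (hf : ∀ y ∉ A, f y = 0) {B : ℝ} (hB : 0 ≤ B) (hL : ∀ y ∈ A, W.laplacian s f y ≤ B) {t : ℝ}
    (ht : 0 ≤ t) {x : G} (hx : x ∈ A) : hW.flow s A t f x ≤ f x + B * t := by
  have hanti : AntitoneOn (fun r => hW.flow s A r f x - B * r) (Set.Icc 0 t) := by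
    refine antitoneOn_of_hasDerivWithinAt_nonpos (convex_Icc 0 t)
      (f' := fun r => hW.flow s A r (W.laplacian s f) x - B)
      ((hW.continuous_flow s A f x).sub (by fun_prop)).continuousOn (fun r _ => ?_) fun r hr => ?_
    · have h2 : HasDerivAt (fun r : ℝ => B * r) B r := by
        simpa using (hasDerivAt_id r).const_mul B
      exact ((hW.hasDerivAt_flow' hf r hx).sub h2).hasDerivWithinAt
    · rw [interior_Icc] at hr
      have h1 := hW.flow_le_mul s A hr.1.le hL x
      have h2 := hW.flow_one_le s A hr.1.le x
      nlinarith
  have := hanti ⟨le_rfl, ht⟩ ⟨ht, le_rfl⟩ ht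
  simp only [mul_zero, sub_zero, hW.flow_zero s A f hx] at this
  linarith

/-- If the walk leaves `A` before time `t` with probability at least one half, then functions
vanishing off `A` are bounded by `2t` times the supremum of their Laplacian. -/
theorem Regular.le_of_laplacian_ge (hW : W.Regular) {A : Finset G} {t : ℝ} (ht : 0 ≤ t)
    (hhalf : ∀ x ∈ A, hW.flow s A t (fun _ => 1) x ≤ 1 / 2) {e : G → ℝ} (he : ∀ y ∉ A, e y = 0)
    {B : ℝ} (hB : 0 ≤ B) (hL : ∀ y ∈ A, -B ≤ W.laplacian s e y) :
    ∀ x, e x ≤ 2 * t * B := by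
  intro x
  by_cases hx : x ∈ A
  swap
  · rw [he x hx]; positivity
  obtain ⟨z, hz, hmax⟩ := A.exists_max_image e ⟨x, hx⟩
  refine (hmax x hx).trans ?_
  by_contra hcon
  push Not at hcon
  have h0 : 0 ≤ e z := (by positivity : 0 ≤ 2 * t * B).trans hcon.le
  have h1 := hW.flow_sub_le (s := s) (A := A) (f := fun y => -1 * e y)
    (fun y hy => by simp [he y hy]) hB (fun y hy => by
      rw [hW.laplacian_const_mul]; linarith [hL y hy]) ht hz
  have h2 := hW.flow_le_mul s A ht hmax z
  have h3 := hhalf z hz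
  have h4 : hW.flow s A t (fun y => -1 * e y) z = -hW.flow s A t e z := by
    unfold Regular.flow
    rw [← Finset.sum_neg_distrib]
    exact Finset.sum_congr rfl fun y _ => by ring
  nlinarith

theorem Regular.abs_le_of_abs_laplacian_le (hW : W.Regular) {A : Finset G} {t : ℝ} (ht : 0 ≤ t)
    (hhalf : ∀ x ∈ A, hW.flow s A t (fun _ => 1) x ≤ 1 / 2) {e : G → ℝ} (he : ∀ y ∉ A, e y = 0)
    {B : ℝ} (hB : 0 ≤ B) (hL : ∀ y ∈ A, |W.laplacian s e y| ≤ B) (x : G) :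
    |e x| ≤ 2 * t * B := by
  have h1 := hW.le_of_laplacian_ge ht hhalf he hB (fun y hy => (abs_le.1 (hL y hy)).1) x
  have h2 := hW.le_of_laplacian_ge ht hhalf (e := fun y => -1 * e y)
    (fun y hy => by simp [he y hy]) hB (fun y hy => by
      rw [hW.laplacian_const_mul]; linarith [(abs_le.1 (hL y hy)).2]) x
  exact abs_le.2 ⟨by linarith, h1⟩

open scoped Classical in
/-- The Poisson equation `L e = g` on `A`, `e = 0` off `A`, is solvable. -/
theorem Regular.exists_poisson (hW : W.Regular) {A : Finset G} {t : ℝ} (ht : 0 ≤ t)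
    (hhalf : ∀ x ∈ A, hW.flow s A t (fun _ => 1) x ≤ 1 / 2) (g : G → ℝ) :
    ∃ e : G → ℝ, (∀ y ∉ A, e y = 0) ∧ ∀ y ∈ A, W.laplacian s e y = g y := by
  let ext : (A → ℝ) → G → ℝ := fun f x => if h : x ∈ A then f ⟨x, h⟩ else 0
  have hext : ∀ f, ∀ y ∉ A, ext f y = 0 := fun f y hy => dif_neg hy
  have hext' : ∀ f (y : A), ext f y = f y := fun f y => dif_pos y.2
  let T : (A → ℝ) →ₗ[ℝ] (A → ℝ) :=
    { toFun := fun f x => W.laplacian s (ext f) x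
      map_add' := fun f g => by
        funext x
        have : ext (f + g) = fun y => ext f y + ext g y := by
          funext y; simp only [ext]; split_ifs <;> simp
        rw [this, hW.laplacian_add]; rfl
      map_smul' := fun c f => by
        funext x
        have : ext (c • f) = fun y => c * ext f y := by
          funext y; simp only [ext]; split_ifs <;> simp
        rw [this, hW.laplacian_const_mul]; rfl }
  have hinj : Function.Injective T := by
    rw [← LinearMap.ker_eq_bot, LinearMap.ker_eq_bot']
    intro f hf
    funext x
    have h1 : ∀ y ∈ A, |W.laplacian s (ext f) y| ≤ 0 := fun y hy => by
      have := congrFun hf ⟨y, hy⟩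
      rw [show W.laplacian s (ext f) y = 0 from this, abs_zero]
    have h2 := hW.abs_le_of_abs_laplacian_le ht hhalf (hext f) le_rfl h1 x
    rw [mul_zero, hext'] at h2
    exact abs_nonpos_iff.1 h2
  obtain ⟨f, hf⟩ := LinearMap.injective_iff_surjective.1 hinj fun x => g x
  exact ⟨ext f, hext f, fun y hy => congrFun hf ⟨y, hy⟩⟩

/-- Superharmonic functions on `A` that vanish off `A` are non-negative. -/
theorem Regular.nonneg_of_laplacian_nonpos (hW : W.Regular) {A : Finset G} {t : ℝ} (ht : 0 ≤ t)
    (hhalf : ∀ x ∈ A, hW.flow s A t (fun _ => 1) x ≤ 1 / 2) {e : G → ℝ} (he : ∀ y ∉ A, e y = 0)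
    (hL : ∀ y ∈ A, W.laplacian s e y ≤ 0) (x : G) : 0 ≤ e x := by
  have := hW.le_of_laplacian_ge ht hhalf (e := fun y => -1 * e y)
    (fun y hy => by simp [he y hy]) le_rfl (fun y hy => by
      rw [hW.laplacian_const_mul]; linarith [hL y hy]) x
  linarith

/-! ### Oscillation of harmonic functions -/

/-- `h` oscillates by at most `o` on the set `S`. -/
def OscLE (h : G → ℝ) (S : Set G) (o : ℝ) : Prop := ∀ x ∈ S, ∀ y ∈ S, h x - h y ≤ o

/-- The elliptic Harnack inequality makes oscillations contract. -/
theorem Regular.osc_contract (hW : W.Regular) (hc : W.graph.Connected) {x₀ : G} {C R : ℝ}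
    (hC : 1 ≤ C)
    (hH : ∀ h : G → ℝ, (∀ x ∈ W.closure (W.ball x₀ R), 0 < h x) →
      W.HarmonicOn s h (W.ball x₀ R) →
        sSup (h '' W.ball x₀ (R / 2)) ≤ C * sInf (h '' W.ball x₀ (R / 2)))
    (hR : 1 ≤ R) {h : G → ℝ} (hh : W.HarmonicOn s h (W.ball x₀ R)) {o : ℝ}
    (ho : OscLE h (W.ball x₀ (2 * R)) o) :
    OscLE h (W.ball x₀ (R / 2)) ((C - 1) / (C + 1) * o) := by
  have hfin := ball_finite hc hW.locFin x₀
  have hcl : W.closure (W.ball x₀ R) ⊆ W.ball x₀ (2 * R) :=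
    (closure_ball_subset hc x₀ R).trans (ball_mono (by linarith))
  have hne : (W.ball x₀ (2 * R)).Nonempty := ⟨x₀, mem_ball_self (by linarith)⟩
  have hhalf : W.ball x₀ (R / 2) ⊆ W.ball x₀ (2 * R) := ball_mono (by linarith)
  obtain ⟨a, ha, hmin⟩ := Set.exists_min_image _ h (hfin (2 * R)) hne
  obtain ⟨b, hb, hmax⟩ := Set.exists_max_image _ h (hfin (2 * R)) hne
  -- The Harnack inequality in pointwise form, for functions that are only non-negative.
  have key : ∀ g : G → ℝ, (∀ x ∈ W.ball x₀ (2 * R), 0 ≤ g x) → W.HarmonicOn s g (W.ball x₀ R) →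
      ∀ x ∈ W.ball x₀ (R / 2), ∀ y ∈ W.ball x₀ (R / 2), g x ≤ C * g y := by
    intro g hg hgh x hx y hy
    refine le_of_forall_pos_le_add fun ε hε => ?_
    -- The Harnack inequality applies to `g + η`, which is positive.
    set η := ε / C
    have hη : 0 < η := by positivity
    have h1 := hH (fun z => g z + η) (fun z hz => by linarith [hg z (hcl hz)])
      (fun z hz => by rw [hW.laplacian_add, hgh z hz, laplacian_const, add_zero])
    have himf := (hfin (R / 2)).image (fun z => g z + η)
    have h2 := le_csSup himf.bddAbove (Set.mem_image_of_mem _ hx)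
    have h3 := csInf_le himf.bddBelow (Set.mem_image_of_mem _ hy)
    have h4 : C * η = ε := by simp only [η]; field_simp
    have h5 := mul_le_mul_of_nonneg_left h3 (by linarith : 0 ≤ C)
    nlinarith
  intro x hx y hy
  have h1 := key (fun z => h z - h a) (fun z hz => sub_nonneg.2 (hmin z hz))
    (fun z hz => by rw [hW.laplacian_sub, hh z hz, laplacian_const, sub_zero]) x hx y hy
  have h2 := key (fun z => h b - h z) (fun z hz => sub_nonneg.2 (hmax z hz))
    (fun z hz => by
      rw [hW.laplacian_sub (s := s) (fun _ => h b), hh z hz, laplacian_const, sub_zero]) y hy x hx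
  have h3 := ho b hb a ha
  rw [div_mul_eq_mul_div, le_div_iff₀ (by linarith)]
  nlinarith

/-- Iterated contraction, down to the smallest scale at which the elliptic Harnack inequality holds. -/
theorem Regular.osc_iterate (hW : W.Regular) (hc : W.graph.Connected) {x₀ : G} {C R₁ : ℝ}
    (hC : 1 ≤ C) (hR₁ : 1 ≤ R₁)
    (hH : ∀ R ≥ R₁, ∀ h : G → ℝ, (∀ x ∈ W.closure (W.ball x₀ R), 0 < h x) →
      W.HarmonicOn s h (W.ball x₀ R) →
        sSup (h '' W.ball x₀ (R / 2)) ≤ C * sInf (h '' W.ball x₀ (R / 2)))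
    {r : ℝ} {h : G → ℝ} (hh : W.HarmonicOn s h (W.ball x₀ r)) {o : ℝ}
    (ho : OscLE h (W.ball x₀ r) o) (n : ℕ) (hn : 2 * R₁ * 4 ^ n ≤ r) :
    OscLE h (W.ball x₀ (r / 4 ^ n)) (((C - 1) / (C + 1)) ^ n * o) := by
  induction n with
  | zero => simpa using ho
  | succ n ih =>
    have h4 : (0 : ℝ) < 4 ^ n := by positivity
    rw [pow_succ] at hn
    have hr : 0 < r := by
      have : 0 < 2 * R₁ * (4 ^ n * 4) := by positivity
      linarith
    have hR : R₁ ≤ r / 4 ^ n / 2 := by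
      rw [div_div, le_div_iff₀ (by positivity)]; nlinarith
    have := hW.osc_contract hc hC (hH _ hR) (hR₁.trans hR) (h := h)
      (fun z hz => hh z (ball_mono (by
        rw [div_div]; exact div_le_self hr.le (by
          have : (1 : ℝ) ≤ 4 ^ n := one_le_pow₀ (by norm_num)
          linarith)) hz))
      (o := ((C - 1) / (C + 1)) ^ n * o) (by
        rw [show 2 * (r / 4 ^ n / 2) = r / 4 ^ n by ring]
        exact ih (by nlinarith))
    rw [show r / 4 ^ n / 2 / 2 = r / 4 ^ (n + 1) by rw [pow_succ]; field_simp; norm_num,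
      ← mul_assoc] at this
    rwa [pow_succ ((C - 1) / (C + 1)), mul_comm (_ ^ n)]

/-- Oscillation of a function near `x₀` in terms of its size and the size of its Laplacian: the
function is a harmonic function plus the solution of a Poisson equation. -/
theorem Regular.osc_of_laplacian (hW : W.Regular) (hc : W.graph.Connected) {x₀ : G} {C R₁ : ℝ}
    (hC : 1 ≤ C) (hR₁ : 1 ≤ R₁)
    (hH : ∀ R ≥ R₁, ∀ h : G → ℝ, (∀ x ∈ W.closure (W.ball x₀ R), 0 < h x) →
      W.HarmonicOn s h (W.ball x₀ R) →
        sSup (h '' W.ball x₀ (R / 2)) ≤ C * sInf (h '' W.ball x₀ (R / 2)))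
    {r t : ℝ} {A : Finset G} (hA : ∀ y, y ∈ A ↔ y ∈ W.ball x₀ r) (ht : 0 ≤ t)
    (hhalf : ∀ x ∈ A, hW.flow s A t (fun _ => 1) x ≤ 1 / 2) {w : G → ℝ} {S B : ℝ} (hB : 0 ≤ B)
    (hS : ∀ y ∈ W.ball x₀ r, |w y| ≤ S) (hwB : ∀ y ∈ W.ball x₀ r, |W.laplacian s w y| ≤ B)
    (n : ℕ) (hn : 2 * R₁ * 4 ^ n ≤ r) :
    OscLE w (W.ball x₀ (r / 4 ^ n))
      (((C - 1) / (C + 1)) ^ n * (2 * (S + 2 * t * B)) + 2 * (2 * t * B)) := by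
  obtain ⟨e, he0, he⟩ := hW.exists_poisson ht hhalf (W.laplacian s w)
  have heB := hW.abs_le_of_abs_laplacian_le ht hhalf he0 hB
    fun y hy => by rw [he y hy]; exact hwB y ((hA y).1 hy)
  have hosc := hW.osc_iterate hc hC hR₁ hH (r := r) (h := fun y => w y - e y)
    (fun z hz => by rw [hW.laplacian_sub, he z ((hA z).2 hz), sub_self])
    (o := 2 * (S + 2 * t * B)) (fun x hx y hy => by
      have h1 := abs_le.1 (hS x hx)
      have h2 := abs_le.1 (hS y hy)
      have h3 := abs_le.1 (heB x)
      have h4 := abs_le.1 (heB y)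
      linarith [h1.2, h2.1, h3.1, h4.2]) n hn
  intro x hx y hy
  have h1 := hosc x hx y hy
  have h3 := abs_le.1 (heB x)
  have h4 := abs_le.1 (heB y)
  linarith [h3.2, h4.1]

/-! ### Lower bounds at earlier times -/

open Polynomial in
/-- On `[0,1]` the power `y^{5n}` is approximated, with exponentially small error, by a combination
of the powers `y^j`, `2n ≤ j < 4n`: expand `y^{3n} = (1 - (1 - y))^{3n}` and drop the terms of order
at least `2n`, using `y (1 - y) ≤ 1/4`. -/
theorem exists_pow_approx (n : ℕ) : ∃ β : ℕ → ℝ, ∀ y : ℝ, 0 ≤ y → y ≤ 1 →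
    |y ^ (5 * n) - ∑ k ∈ Finset.range (2 * n), β k * y ^ (2 * n + k)| ≤ (1 / 2) ^ n := by
  set P : ℝ[X] := ∑ j ∈ Finset.range (2 * n),
    Polynomial.C (((3 * n).choose j : ℝ) * (-1) ^ j) * (1 - X) ^ j with hP
  refine ⟨P.coeff, fun y hy0 hy1 => ?_⟩
  rcases Nat.eq_zero_or_pos n with rfl | hn
  · simp
  have hdeg : P.natDegree < 2 * n := by
    refine lt_of_le_of_lt (Polynomial.natDegree_sum_le_of_forall_le (n := 2 * n - 1) _ _
      fun j hj => ?_) (by omega)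
    refine (Polynomial.natDegree_C_mul_le _ _).trans ?_
    refine Polynomial.natDegree_pow_le.trans ?_
    have h1 : (1 - X : ℝ[X]).natDegree ≤ 1 :=
      (Polynomial.natDegree_sub_le _ _).trans (by simp)
    have := Finset.mem_range.1 hj
    calc j * (1 - X : ℝ[X]).natDegree ≤ j * 1 := Nat.mul_le_mul_left _ h1
      _ ≤ _ := by omega
  have heval : ∑ k ∈ Finset.range (2 * n), P.coeff k * y ^ (2 * n + k) =
      y ^ (2 * n) * P.eval y := by
    rw [Polynomial.eval_eq_sum_range' hdeg, Finset.mul_sum]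
    exact Finset.sum_congr rfl fun k _ => by rw [pow_add]; ring
  have heval2 : P.eval y = ∑ j ∈ Finset.range (2 * n),
      ((3 * n).choose j : ℝ) * (-1) ^ j * (1 - y) ^ j := by
    rw [hP, Polynomial.eval_finsetSum]
    exact Finset.sum_congr rfl fun j _ => by simp
  have hbin : y ^ (3 * n) = ∑ j ∈ Finset.range (3 * n + 1),
      ((3 * n).choose j : ℝ) * (-1) ^ j * (1 - y) ^ j := by
    have := add_pow (-(1 - y)) 1 (3 * n)
    rw [show -(1 - y) + 1 = y by ring] at this
    rw [this]
    refine Finset.sum_congr rfl fun j _ => ?_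
    rw [neg_pow, one_pow]; ring
  have hsplit : Finset.range (2 * n) ⊆ Finset.range (3 * n + 1) :=
    Finset.range_subset_range.2 (by omega)
  rw [heval, heval2, show 5 * n = 2 * n + 3 * n by ring, pow_add, hbin,
    ← Finset.sum_sdiff hsplit, mul_add, add_sub_cancel_right, Finset.mul_sum]
  have h1y : 0 ≤ 1 - y := by linarith
  have hq : (y * (1 - y)) ^ (2 * n) ≤ (1 / 4 : ℝ) ^ (2 * n) :=
    pow_le_pow_left₀ (mul_nonneg hy0 h1y) (by nlinarith [sq_nonneg (y - 1 / 2)]) _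
  calc _ ≤ ∑ j ∈ Finset.range (3 * n + 1) \ Finset.range (2 * n),
        |y ^ (2 * n) * (((3 * n).choose j : ℝ) * (-1) ^ j * (1 - y) ^ j)| :=
        Finset.abs_sum_le_sum_abs _ _
    _ ≤ ∑ j ∈ Finset.range (3 * n + 1) \ Finset.range (2 * n),
        ((3 * n).choose j : ℝ) * (1 / 4 : ℝ) ^ (2 * n) := by
        refine Finset.sum_le_sum fun j hj => ?_
        have hj2 : 2 * n ≤ j := by
          rw [Finset.mem_sdiff, Finset.mem_range, Finset.mem_range] at hj; omega
        have e1 : (1 - y) ^ j ≤ (1 - y) ^ (2 * n) := pow_le_pow_of_le_one h1y (by linarith) hj2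
        rw [abs_mul, abs_mul, abs_mul, abs_pow (-1 : ℝ), abs_neg, abs_one, one_pow, mul_one,
          Nat.abs_cast, abs_of_nonneg (pow_nonneg hy0 _), abs_of_nonneg (pow_nonneg h1y _)]
        calc _ = ((3 * n).choose j : ℝ) * (y ^ (2 * n) * (1 - y) ^ j) := by ring
          _ ≤ ((3 * n).choose j : ℝ) * (y ^ (2 * n) * (1 - y) ^ (2 * n)) := by gcongr
          _ ≤ _ := by rw [← mul_pow]; gcongr
    _ ≤ ∑ j ∈ Finset.range (3 * n + 1), ((3 * n).choose j : ℝ) * (1 / 4 : ℝ) ^ (2 * n) :=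
        Finset.sum_le_sum_of_subset_of_nonneg Finset.sdiff_subset fun _ _ _ => by positivity
    _ = (1 / 2) ^ n := by
        rw [← Finset.sum_mul, ← Nat.cast_sum, Nat.sum_range_choose, Nat.cast_pow, pow_mul, pow_mul,
          ← mul_pow]
        norm_num

/-- A non-negative combination of decaying exponentials that is bounded below at time `t` is bounded
below at some earlier time. By `exists_pow_approx` with `y = e^{-λ t / (5N)}`, its value at time `t` is
up to a small error a fixed linear combination of its values at times between `2t/5` and `4t/5`. -/
theorem exists_earlier_step {A c : ℝ} (hA : 0 < A) (hc : 0 < c) : ∃ c' : ℝ, 0 < c' ∧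
    ∀ {ι : Type v} [Fintype ι] (a lam : ι → ℝ), (∀ i, 0 ≤ lam i) → ∑ i, |a i| ≤ A →
      (∀ σ, 0 ≤ σ → 0 ≤ ∑ i, a i * Real.exp (-lam i * σ)) → ∀ t, 0 < t →
      c ≤ ∑ i, a i * Real.exp (-lam i * t) →
      ∃ σ, 0 < σ ∧ σ ≤ 4 / 5 * t ∧ c' ≤ ∑ i, a i * Real.exp (-lam i * σ) := by
  obtain ⟨n, hn⟩ := exists_pow_lt_of_lt_one (show 0 < c / (2 * A) by positivity)
    (show (1 / 2 : ℝ) < 1 by norm_num)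
  have hn' : A * (1 / 2) ^ (n + 1) ≤ c / 2 := by
    have h1 : (1 / 2 : ℝ) ^ (n + 1) ≤ (1 / 2) ^ n :=
      pow_le_pow_of_le_one (by norm_num) (by norm_num) n.le_succ
    rw [lt_div_iff₀ (by positivity)] at hn
    nlinarith
  set N := n + 1 with hN
  have hN0 : (0 : ℝ) < N := by rw [hN]; positivity
  obtain ⟨β, hβ⟩ := exists_pow_approx N
  set B := ∑ k ∈ Finset.range (2 * N), |β k| + 1 with hB
  have hBpos : 0 < B := by positivity
  refine ⟨c / (2 * B), by positivity, ?_⟩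
  intro ι _ a lam hlam hAa hpos t ht hct
  by_contra hcon
  push Not at hcon
  set g : ℝ → ℝ := fun σ => ∑ i, a i * Real.exp (-lam i * σ) with hg
  set σ : ℕ → ℝ := fun k => (2 * N + k) * t / (5 * N) with hσ
  have hσb : ∀ k ∈ Finset.range (2 * N), |β k| * g (σ k) ≤ |β k| * (c / (2 * B)) := by
    intro k hk
    have hk' : (k : ℝ) < 2 * N := by exact_mod_cast Finset.mem_range.1 hk
    refine mul_le_mul_of_nonneg_left (hcon (σ k) (by simp only [hσ]; positivity) ?_).le
      (abs_nonneg _)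
    simp only [hσ]
    rw [div_le_iff₀ (by positivity)]
    nlinarith
  have hkey : ∀ l, 0 ≤ l → |Real.exp (-l * t) -
      ∑ k ∈ Finset.range (2 * N), β k * Real.exp (-l * σ k)| ≤ (1 / 2) ^ N := by
    intro l hl
    have h := hβ (Real.exp (-l * t / (5 * N))) (Real.exp_pos _).le
      (Real.exp_le_one_iff.2 (div_nonpos_of_nonpos_of_nonneg (by nlinarith) (by positivity)))
    have e1 : Real.exp (-l * t / (5 * N)) ^ (5 * N) = Real.exp (-l * t) := by
      rw [← Real.exp_nat_mul]; congr 1; push_cast; field_simp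
    have e2 : ∀ k, Real.exp (-l * t / (5 * N)) ^ (2 * N + k) = Real.exp (-l * σ k) := by
      intro k
      rw [← Real.exp_nat_mul]; congr 1; simp only [hσ]; push_cast; field_simp
    rwa [e1, Finset.sum_congr rfl fun k _ => by rw [e2 k]] at h
  have hdiff : g t - ∑ k ∈ Finset.range (2 * N), β k * g (σ k) ≤ A * (1 / 2) ^ N := by
    have e : g t - ∑ k ∈ Finset.range (2 * N), β k * g (σ k) = ∑ i, a i * (Real.exp (-lam i * t) -
        ∑ k ∈ Finset.range (2 * N), β k * Real.exp (-lam i * σ k)) := by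
      simp only [hg, mul_sub, Finset.sum_sub_distrib, Finset.mul_sum]
      rw [Finset.sum_comm]
      congr 1
      exact Finset.sum_congr rfl fun i _ => Finset.sum_congr rfl fun k _ => by ring
    rw [e]
    calc _ ≤ ∑ i, |a i| * (1 / 2) ^ N := Finset.sum_le_sum fun i _ =>
          (le_abs_self _).trans (by
            rw [abs_mul]; exact mul_le_mul_of_nonneg_left (hkey _ (hlam i)) (abs_nonneg _))
      _ ≤ _ := by
          rw [← Finset.sum_mul]
          exact mul_le_mul_of_nonneg_right hAa (by positivity)
  have h1 : ∑ k ∈ Finset.range (2 * N), β k * g (σ k) ≤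
      (∑ k ∈ Finset.range (2 * N), |β k|) * (c / (2 * B)) := by
    rw [Finset.sum_mul]
    refine Finset.sum_le_sum fun k hk => ?_
    refine le_trans ?_ (hσb k hk)
    exact mul_le_mul_of_nonneg_right (le_abs_self _) (hpos _ (by simp only [hσ]; positivity))
  have h2 : (∑ k ∈ Finset.range (2 * N), |β k|) * (c / (2 * B)) < c / 2 := by
    have e : B * (c / (2 * B)) = c / 2 := by field_simp
    have : 0 < c / (2 * B) := by positivity
    nlinarith
  have : c ≤ g t := hct
  linarith

/-- A non-negative combination of decaying exponentials that is bounded below at time `t` is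
bounded below at some time in `(0, κ t]`, for any prescribed `κ > 0`. -/
theorem exists_earlier {A c κ : ℝ} (hA : 0 < A) (hc : 0 < c) (hκ : 0 < κ) : ∃ c' : ℝ, 0 < c' ∧
    ∀ {ι : Type v} [Fintype ι] (a lam : ι → ℝ), (∀ i, 0 ≤ lam i) → ∑ i, |a i| ≤ A →
      (∀ σ, 0 ≤ σ → 0 ≤ ∑ i, a i * Real.exp (-lam i * σ)) → ∀ t, 0 < t →
      c ≤ ∑ i, a i * Real.exp (-lam i * t) →
      ∃ σ, 0 < σ ∧ σ ≤ κ * t ∧ c' ≤ ∑ i, a i * Real.exp (-lam i * σ) := by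
  have key : ∀ n : ℕ, ∃ c' : ℝ, 0 < c' ∧
    ∀ {ι : Type v} [Fintype ι] (a lam : ι → ℝ), (∀ i, 0 ≤ lam i) → ∑ i, |a i| ≤ A →
      (∀ σ, 0 ≤ σ → 0 ≤ ∑ i, a i * Real.exp (-lam i * σ)) → ∀ t, 0 < t →
      c ≤ ∑ i, a i * Real.exp (-lam i * t) →
      ∃ σ, 0 < σ ∧ σ ≤ (4 / 5) ^ n * t ∧ c' ≤ ∑ i, a i * Real.exp (-lam i * σ) := by
    intro n
    induction n with
    | zero => exact ⟨c, hc, fun a lam _ _ _ t ht h => ⟨t, ht, by simp, h⟩⟩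
    | succ n ih =>
      obtain ⟨c₁, hc₁, h₁⟩ := ih
      obtain ⟨c₂, hc₂, h₂⟩ := exists_earlier_step.{v} hA hc₁
      refine ⟨c₂, hc₂, fun a lam hl ha hp t ht h => ?_⟩
      obtain ⟨σ, hσ, hσt, hg⟩ := h₁ a lam hl ha hp t ht h
      obtain ⟨σ', hσ', hσt', hg'⟩ := h₂ a lam hl ha hp σ hσ hg
      exact ⟨σ', hσ', by rw [pow_succ]; nlinarith, hg'⟩
  obtain ⟨n, hn⟩ := exists_pow_lt_of_lt_one hκ (show (4 / 5 : ℝ) < 1 by norm_num)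
  obtain ⟨c', hc', h⟩ := key n
  refine ⟨c', hc', fun a lam hl ha hp t ht hct => ?_⟩
  obtain ⟨σ, hσ, hσt, hg⟩ := h a lam hl ha hp t ht hct
  exact ⟨σ, hσ, hσt.trans (mul_le_mul_of_nonneg_right hn.le ht.le), hg⟩

end

/-! ### The Markov property of the path law at the first jump -/

section

variable {G : Type*} {W : WeightedGraph G} {s : WalkSpeed}

/-- The sequence `a, f 0, f 1, …`. -/
def seqCons {α : Type*} (a : α) (f : ℕ → α) : ℕ → α
  | 0 => a
  | n + 1 => f n

theorem measurable_seqCons {α : Type*} [MeasurableSpace α] :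
    Measurable fun q : α × (ℕ → α) => seqCons q.1 q.2 := by
  refine measurable_pi_iff.2 fun n => ?_
  cases n with
  | zero => exact measurable_fst
  | succ n => exact (measurable_pi_apply n).comp measurable_snd

/-- An i.i.d. sequence is an independent first term followed by an i.i.d. sequence. -/
theorem map_seqCons_infinitePi {α : Type*} [MeasurableSpace α] (μ : Measure α)
    [IsProbabilityMeasure μ] :
    (μ.prod (Measure.infinitePi fun _ : ℕ => μ)).map (fun q => seqCons q.1 q.2) =
      Measure.infinitePi fun _ : ℕ => μ := by
  classical
  refine Measure.eq_infinitePi (μ := fun _ : ℕ => μ) fun S t ht => ?_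
  obtain ⟨n, hn⟩ : ∃ n, S ⊆ Finset.range (n + 1) :=
    ⟨S.sup id, fun i hi => Finset.mem_range.2 (Nat.lt_succ_of_le (Finset.le_sup (f := id) hi))⟩
  set t' : ℕ → Set α := fun i => if i ∈ S then t i else Set.univ with ht'
  have ht'm : ∀ i, MeasurableSet (t' i) := fun i => by
    simp only [ht']; split_ifs
    · exact ht i
    · exact MeasurableSet.univ
  have hpi : Set.pi (S : Set ℕ) t = Set.pi (Finset.range (n + 1) : Finset ℕ) t' := by
    ext f
    simp only [Set.mem_pi, Finset.mem_coe]
    constructor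
    · intro h i _
      simp only [ht']
      split_ifs with hi
      · exact h i hi
      · exact Set.mem_univ _
    · intro h i hi
      have := h i (hn hi)
      simpa only [ht', if_pos hi] using this
  have hprod : ∏ i ∈ S, μ (t i) = ∏ i ∈ Finset.range (n + 1), μ (t' i) := by
    rw [← Finset.prod_subset hn]
    · exact Finset.prod_congr rfl fun i hi => by simp only [ht', if_pos hi]
    · intro i _ hi
      simp only [ht', if_neg hi, measure_univ]
  have hpre : (fun q : α × (ℕ → α) => seqCons q.1 q.2) ⁻¹'
      Set.pi (Finset.range (n + 1) : Finset ℕ) t' =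
      t' 0 ×ˢ Set.pi (Finset.range n : Finset ℕ) (fun i => t' (i + 1)) := by
    ext q
    simp only [Set.mem_preimage, Set.mem_pi, Finset.mem_coe, Set.mem_prod, Finset.mem_range]
    constructor
    · exact fun h => ⟨h 0 (Nat.succ_pos n), fun i hi => h (i + 1) (Nat.succ_lt_succ hi)⟩
    · rintro ⟨h0, h⟩ i hi
      cases i with
      | zero => exact h0
      | succ i => exact h i (Nat.lt_of_succ_lt_succ hi)
  rw [hpi, hprod, Measure.map_apply measurable_seqCons
    (MeasurableSet.pi (Set.to_countable _) fun i _ => ht'm i), hpre, Measure.prod_prod,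
    Measure.infinitePi_pi _ fun i _ => ht'm (i + 1), Finset.prod_range_succ', mul_comm]

section chain

variable [Countable G] [MeasurableSpace G] [DiscreteMeasurableSpace G]

theorem jumpChainLaw_cylinder_zero (W : WeightedGraph G) (x : G) (y : ℕ → G) :
    W.jumpChainLaw x {Y | ∀ i ≤ 0, Y i = y i} = Measure.dirac x {y 0} := by
  rw [← W.jumpChainLaw_map_zero, Measure.map_apply (measurable_pi_apply 0) (measurableSet_singleton _)]
  congr 1
  ext Y
  simp

theorem jumpChainLaw_cylinder_succ (W : WeightedGraph G) (x : G) (y : ℕ → G) (n : ℕ) :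
    W.jumpChainLaw x {Y | ∀ i ≤ n + 1, Y i = y i} =
      W.jumpChainLaw x {Y | ∀ i ≤ n, Y i = y i} * W.jumpKernel (y n) {y (n + 1)} := by
  have h := Kernel.map_frestrictLe_trajMeasure_compProd_eq_map_trajMeasure
    (X := fun _ => G) (κ := W.stepKernel) (μ₀ := Measure.dirac x) (a := n)
  have h1 := DFunLike.congr_fun h ({Preorder.frestrictLe (π := fun _ => G) n y} ×ˢ {y (n + 1)})
  rw [Measure.compProd_apply_prod (measurableSet_singleton _) (measurableSet_singleton _),
    lintegral_singleton, Measure.map_apply (by fun_prop) (measurableSet_singleton _),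
    Measure.map_apply (by fun_prop) ((measurableSet_singleton _).prod (measurableSet_singleton _))]
    at h1
  have e0 : ∀ Y : ℕ → G, Preorder.frestrictLe (π := fun _ => G) n Y =
      Preorder.frestrictLe (π := fun _ => G) n y ↔ ∀ i ≤ n, Y i = y i := by
    intro Y
    constructor
    · intro hY i hi
      exact congrFun hY ⟨i, Finset.mem_Iic.2 hi⟩
    · intro hY
      funext i
      exact hY i (Finset.mem_Iic.1 i.2)
  have e1 : {Y : ℕ → G | ∀ i ≤ n + 1, Y i = y i} =
      (fun Y => (Preorder.frestrictLe (π := fun _ => G) n Y, Y (n + 1))) ⁻¹'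
        ({Preorder.frestrictLe (π := fun _ => G) n y} ×ˢ {y (n + 1)}) := by
    ext Y
    simp only [Set.mem_ofPred_eq, Set.mem_preimage, Set.mem_prod, Set.mem_singleton_iff, e0]
    constructor
    · exact fun hY => ⟨fun i hi => hY i (by omega), hY _ le_rfl⟩
    · rintro ⟨ha, hb⟩ i hi
      rcases Nat.lt_or_ge n i with hni | hni
      · rw [show i = n + 1 by omega]; exact hb
      · exact ha i hni
  have e2 : {Y : ℕ → G | ∀ i ≤ n, Y i = y i} =
      Preorder.frestrictLe (π := fun _ => G) n ⁻¹' {Preorder.frestrictLe (π := fun _ => G) n y} := by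
    ext Y
    simp only [Set.mem_ofPred_eq, Set.mem_preimage, Set.mem_singleton_iff, e0]
  have e3 : W.stepKernel n (Preorder.frestrictLe (π := fun _ => G) n y) {y (n + 1)} =
      W.jumpKernel (y n) {y (n + 1)} := by
    unfold stepKernel
    rw [Kernel.comap_apply]
    rfl
  rw [e1, e2]
  unfold jumpChainLaw
  rw [← h1, e3, mul_comm]

/-- The law of the jump chain on cylinders. -/
theorem jumpChainLaw_cylinder (W : WeightedGraph G) (x : G) (y : ℕ → G) (n : ℕ) :
    W.jumpChainLaw x {Y | ∀ i ≤ n, Y i = y i} =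
      Measure.dirac x {y 0} * ∏ i ∈ Finset.range n, W.jumpKernel (y i) {y (i + 1)} := by
  induction n with
  | zero => rw [jumpChainLaw_cylinder_zero]; simp
  | succ n ih => rw [jumpChainLaw_cylinder_succ, ih, Finset.prod_range_succ, mul_assoc]

/-- Finite measures on sequences agree if they agree on all initial cylinders. -/
theorem measure_eq_of_cylinder {μ ν : Measure (ℕ → G)} [IsFiniteMeasure μ] [IsFiniteMeasure ν]
    (h : ∀ (n : ℕ) (y : ℕ → G), μ {Y | ∀ i ≤ n, Y i = y i} = ν {Y | ∀ i ≤ n, Y i = y i}) : μ = ν := by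
  rcases isEmpty_or_nonempty G with hG | hG
  · have : IsEmpty (ℕ → G) := ⟨fun f => hG.elim (f 0)⟩
    exact Measure.eq_zero_of_isEmpty μ |>.trans (Measure.eq_zero_of_isEmpty ν).symm
  have hn : ∀ n, μ.map (Preorder.frestrictLe (π := fun _ => G) n) =
      ν.map (Preorder.frestrictLe (π := fun _ => G) n) := by
    intro n
    refine Measure.ext_of_singleton fun z => ?_
    rw [Measure.map_apply (by fun_prop) (measurableSet_singleton _),
      Measure.map_apply (by fun_prop) (measurableSet_singleton _)]
    have : Preorder.frestrictLe (π := fun _ => G) n ⁻¹' {z} =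
        {Y | ∀ i ≤ n, Y i = if hi : i ≤ n then z ⟨i, Finset.mem_Iic.2 hi⟩ else hG.some} := by
      ext Y
      simp only [Set.mem_preimage, Set.mem_singleton_iff, Set.mem_ofPred_eq]
      constructor
      · rintro rfl i hi
        rw [dif_pos hi]; rfl
      · intro hY
        funext i
        have := hY i (Finset.mem_Iic.1 i.2)
        rw [dif_pos (Finset.mem_Iic.1 i.2)] at this
        exact this
    rw [this]
    exact h n _
  have hI : ∀ I : Finset ℕ, μ.map I.restrict = ν.map I.restrict := by
    intro I
    have hsub : I ⊆ Finset.Iic (I.sup id) :=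
      fun i hi => Finset.mem_Iic.2 (Finset.le_sup (f := id) hi)
    have e : (I.restrict : (ℕ → G) → _) = Finset.restrict₂ (π := fun _ => G) hsub ∘
        Preorder.frestrictLe (π := fun _ => G) (I.sup id) := rfl
    rw [e, ← Measure.map_map (by fun_prop) (by fun_prop), hn,
      Measure.map_map (by fun_prop) (by fun_prop)]
  have hμ : IsProjectiveLimit μ fun I => ν.map I.restrict := fun I => hI I
  have hν : IsProjectiveLimit ν fun I => ν.map I.restrict := fun I => rfl
  exact hμ.unique hν

/-- The Markov property of the jump chain at time one. -/
theorem jumpChainLaw_eq_bind (W : WeightedGraph G) (x : G) :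
    W.jumpChainLaw x =
      (W.jumpKernel x).bind fun z => (W.jumpChainLaw z).map (seqCons x) := by
  have hmx : Measurable (seqCons x : (ℕ → G) → ℕ → G) :=
    measurable_seqCons.comp measurable_prodMk_left
  have hmeas : Measurable fun z => (W.jumpChainLaw z).map (seqCons x) := measurable_of_countable _
  have hcyl : ∀ (n : ℕ) (y : ℕ → G), MeasurableSet {Y : ℕ → G | ∀ i ≤ n, Y i = y i} := by
    intro n y
    have : {Y : ℕ → G | ∀ i ≤ n, Y i = y i} = ⋂ i ∈ Set.Iic n, (fun Y : ℕ → G => Y i) ⁻¹' {y i} := by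
      ext; simp
    rw [this]
    exact MeasurableSet.biInter (Set.to_countable _)
      fun i _ => measurable_pi_apply i (measurableSet_singleton _)
  have happ : ∀ S, MeasurableSet S → ((W.jumpKernel x).bind
      fun z => (W.jumpChainLaw z).map (seqCons x)) S =
      ∫⁻ z, W.jumpChainLaw z (seqCons x ⁻¹' S) ∂W.jumpKernel x := by
    intro S hS
    rw [Measure.bind_apply hS hmeas.aemeasurable]
    exact lintegral_congr fun z => Measure.map_apply hmx hS
  have hfin : IsFiniteMeasure ((W.jumpKernel x).bind
      fun z => (W.jumpChainLaw z).map (seqCons x)) := by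
    refine ⟨?_⟩
    rw [happ _ MeasurableSet.univ]
    simp
  have hsucc : ∀ (n : ℕ) (y : ℕ → G), W.jumpChainLaw x {Y | ∀ i ≤ n + 1, Y i = y i} =
      ((W.jumpKernel x).bind fun z => (W.jumpChainLaw z).map (seqCons x))
        {Y | ∀ i ≤ n + 1, Y i = y i} := by
    intro n y
    rw [happ _ (hcyl _ _), jumpChainLaw_cylinder, Finset.prod_range_succ']
    have hpre : seqCons x ⁻¹' {Y : ℕ → G | ∀ i ≤ n + 1, Y i = y i} =
        {Y | x = y 0 ∧ ∀ i ≤ n, Y i = y (i + 1)} := by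
      ext Y
      constructor
      · exact fun h => ⟨h 0 (Nat.zero_le _), fun i hi => h (i + 1) (by omega)⟩
      · rintro ⟨h0, h⟩ i hi
        cases i with
        | zero => exact h0
        | succ i => exact h i (by omega)
    rw [hpre]
    by_cases hx : x = y 0
    · subst hx
      simp only [true_and]
      rw [Measure.dirac_apply_of_mem (Set.mem_singleton _), one_mul]
      have : ∀ z, W.jumpChainLaw z {Y | ∀ i ≤ n, Y i = y (i + 1)} =
          Set.indicator {y (0 + 1)} (fun _ => ∏ i ∈ Finset.range n,
            W.jumpKernel (y (i + 1)) {y (i + 1 + 1)}) z := by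
        intro z
        rw [jumpChainLaw_cylinder W z (fun i => y (i + 1)) n, Measure.dirac_apply' _
          (measurableSet_singleton _)]
        by_cases hz : z = y (0 + 1)
        · rw [hz]; simp
        · rw [Set.indicator_of_notMem (by simpa using hz),
            Set.indicator_of_notMem (by simpa using hz), zero_mul]
      rw [lintegral_congr this, lintegral_indicator (measurableSet_singleton _), lintegral_const,
        Measure.restrict_apply_univ]
    · simp only [hx, false_and, Set.ofPred_false, measure_empty, lintegral_zero]
      rw [Measure.dirac_apply' _ (measurableSet_singleton _), Set.indicator_of_notMem (by simpa using hx),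
        zero_mul]
  refine measure_eq_of_cylinder fun n y => ?_
  -- The cylinder over `0, …, n` is the disjoint union of those over `0, …, n + 1`.
  have hunion : {Y : ℕ → G | ∀ i ≤ n, Y i = y i} =
      ⋃ a : G, {Y | ∀ i ≤ n + 1, Y i = Function.update y (n + 1) a i} := by
    ext Y
    simp only [Set.mem_ofPred_eq, Set.mem_iUnion]
    constructor
    · intro h
      refine ⟨Y (n + 1), fun i hi => ?_⟩
      rcases Nat.lt_or_ge n i with hni | hni
      · rw [show i = n + 1 by omega, Function.update_self]
      · rw [Function.update_of_ne (by omega)]; exact h i hni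
    · rintro ⟨a, h⟩ i hi
      have := h i (by omega)
      rwa [Function.update_of_ne (by omega)] at this
  have hdisj : Pairwise (Function.onFun Disjoint fun a : G =>
      {Y : ℕ → G | ∀ i ≤ n + 1, Y i = Function.update y (n + 1) a i}) := by
    intro a b hab
    refine Set.disjoint_left.2 fun Y ha hb => hab ?_
    have h1 := ha (n + 1) le_rfl
    have h2 := hb (n + 1) le_rfl
    rw [Function.update_self] at h1 h2
    rw [← h1, h2]
  rw [hunion, measure_iUnion hdisj fun a => hcyl _ _, measure_iUnion hdisj fun a => hcyl _ _]
  exact tsum_congr fun a => hsucc n _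

theorem isProbabilityMeasure_exp : IsProbabilityMeasure (expMeasure 1) :=
  isProbabilityMeasure_expMeasure one_pos

/-- The Markov property of the path law at the first jump. -/
theorem lintegral_pathLaw (W : WeightedGraph G) (x : G) {F : (ℕ → G) × (ℕ → ℝ) → ℝ≥0∞}
    (hF : Measurable F) :
    ∫⁻ p, F p ∂W.pathLaw x = ∫⁻ e, ∫⁻ z, ∫⁻ p, F (seqCons x p.1, seqCons e p.2) ∂W.pathLaw z
      ∂W.jumpKernel x ∂expMeasure 1 := by
  have := isProbabilityMeasure_exp
  have hmx : Measurable (seqCons x : (ℕ → G) → ℕ → G) :=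
    measurable_seqCons.comp measurable_prodMk_left
  have hme : ∀ e : ℝ, Measurable (seqCons e : (ℕ → ℝ) → ℕ → ℝ) :=
    fun e => measurable_seqCons.comp measurable_prodMk_left
  have hF3 : Measurable fun q : (ℕ → G) × ℝ × (ℕ → ℝ) => F (seqCons x q.1, seqCons q.2.1 q.2.2) :=
    hF.comp ((hmx.comp measurable_fst).prodMk (measurable_seqCons.comp measurable_snd))
  have hmeas : Measurable fun z => (W.jumpChainLaw z).map (seqCons x) := measurable_of_countable _
  have hinner : ∀ Y, ∫⁻ f, F (Y, f) ∂(Measure.infinitePi fun _ : ℕ => expMeasure 1) =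
      ∫⁻ e, ∫⁻ f, F (Y, seqCons e f) ∂(Measure.infinitePi fun _ : ℕ => expMeasure 1)
        ∂expMeasure 1 := by
    intro Y
    have hFY : Measurable fun f => F (Y, f) := hF.comp measurable_prodMk_left
    conv_lhs => rw [← map_seqCons_infinitePi (expMeasure 1)]
    rw [lintegral_map hFY measurable_seqCons]
    exact lintegral_prod (fun q : ℝ × (ℕ → ℝ) => F (Y, seqCons q.1 q.2))
      (hFY.comp measurable_seqCons).aemeasurable
  have h1 : ∫⁻ p, F p ∂W.pathLaw x = ∫⁻ z, ∫⁻ Y, ∫⁻ e, ∫⁻ f, F (seqCons x Y, seqCons e f)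
      ∂(Measure.infinitePi fun _ : ℕ => expMeasure 1) ∂expMeasure 1 ∂W.jumpChainLaw z
      ∂W.jumpKernel x := by
    unfold pathLaw
    rw [lintegral_prod _ hF.aemeasurable]
    conv_lhs => rw [jumpChainLaw_eq_bind W x]
    rw [Measure.lintegral_bind hmeas.aemeasurable hF.lintegral_prod_right'.aemeasurable]
    refine lintegral_congr fun z => ?_
    rw [lintegral_map hF.lintegral_prod_right' hmx]
    exact lintegral_congr fun Y => hinner _
  have h2 : ∀ z, ∫⁻ Y, ∫⁻ e, ∫⁻ f, F (seqCons x Y, seqCons e f)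
      ∂(Measure.infinitePi fun _ : ℕ => expMeasure 1) ∂expMeasure 1 ∂W.jumpChainLaw z =
      ∫⁻ e, ∫⁻ p, F (seqCons x p.1, seqCons e p.2) ∂W.pathLaw z ∂expMeasure 1 := by
    intro z
    rw [lintegral_lintegral_swap]
    · refine lintegral_congr fun e => ?_
      unfold pathLaw
      rw [lintegral_prod]
      exact (hF.comp ((hmx.comp measurable_fst).prodMk
        ((hme e).comp measurable_snd))).aemeasurable
    · have : Measurable fun q : ((ℕ → G) × ℝ) × (ℕ → ℝ) =>
          F (seqCons x q.1.1, seqCons q.1.2 q.2) :=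
        hF3.comp ((measurable_fst.comp measurable_fst).prodMk
          ((measurable_snd.comp measurable_fst).prodMk measurable_snd))
      exact this.lintegral_prod_right'.aemeasurable
  rw [h1, lintegral_congr h2, lintegral_lintegral_swap]
  have hm : Measurable fun q : (G × ℝ) × ((ℕ → G) × (ℕ → ℝ)) =>
      F (seqCons x q.2.1, seqCons q.1.2 q.2.2) :=
    hF3.comp ((measurable_fst.comp measurable_snd).prodMk
      ((measurable_snd.comp measurable_fst).prodMk (measurable_snd.comp measurable_snd)))
  refine (measurable_from_prod_countable_right fun z => ?_).aemeasurable
  have : Measurable fun q : ℝ × ((ℕ → G) × (ℕ → ℝ)) => F (seqCons x q.2.1, seqCons q.1 q.2.2) :=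
    hF3.comp ((measurable_fst.comp measurable_snd).prodMk
      (measurable_fst.prodMk (measurable_snd.comp measurable_snd)))
  exact this.lintegral_prod_right' (ν := W.pathLaw z)

end chain

end

/-! ### Mean exit times of the random walk -/

section

variable {G : Type*} {W : WeightedGraph G} {s : WalkSpeed}

theorem lintegral_expMeasure {f : ℝ → ℝ≥0∞} (hf : Measurable f) :
    ∫⁻ e, f e ∂expMeasure 1 = ∫⁻ e in Set.Ici 0, ENNReal.ofReal (Real.exp (-e)) * f e := by
  have h1 : ∫⁻ e, f e ∂expMeasure 1 = ∫⁻ e, exponentialPDF 1 e * f e := by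
    have : expMeasure 1 = volume.withDensity (exponentialPDF 1) := rfl
    have hm : Measurable (exponentialPDF 1) := (measurable_exponentialPDFReal 1).ennreal_ofReal
    rw [this, lintegral_withDensity_eq_lintegral_mul _ hm hf]
    rfl
  rw [h1, ← lintegral_indicator measurableSet_Ici]
  refine lintegral_congr fun e => ?_
  by_cases he : 0 ≤ e
  · rw [Set.indicator_of_mem (show e ∈ Set.Ici 0 from he), exponentialPDF_of_nonneg he]
    simp
  · rw [Set.indicator_of_notMem (show e ∉ Set.Ici 0 from he), exponentialPDF_of_neg (not_le.1 he),
      zero_mul]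

theorem ae_pos_expMeasure : ∀ᵐ e ∂expMeasure 1, 0 < e := by
  have h : expMeasure 1 (Set.Iic 0) = 0 := by
    have : expMeasure 1 = volume.withDensity (exponentialPDF 1) := rfl
    rw [this, withDensity_apply _ measurableSet_Iic, setLIntegral_congr Iio_ae_eq_Iic.symm]
    exact lintegral_exponentialPDF_of_nonpos le_rfl
  rw [ae_iff]
  convert h using 2
  ext e; simp

theorem lintegral_exp_neg_expMeasure :
    ∫⁻ e, ENNReal.ofReal (Real.exp (-e)) ∂expMeasure 1 = ENNReal.ofReal (1 / 2) := by
  have hm : Measurable (exponentialPDF 2) := (measurable_exponentialPDFReal 2).ennreal_ofReal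
  rw [lintegral_expMeasure (by fun_prop), ← lintegral_indicator measurableSet_Ici,
    ← mul_one (ENNReal.ofReal (1 / 2)), ← lintegral_exponentialPDF_eq_one two_pos,
    ← lintegral_const_mul _ hm]
  refine lintegral_congr fun e => ?_
  by_cases he : 0 ≤ e
  · rw [Set.indicator_of_mem (show e ∈ Set.Ici 0 from he), exponentialPDF_of_nonneg he,
      ← ENNReal.ofReal_mul (Real.exp_pos _).le, ← ENNReal.ofReal_mul (by norm_num),
      ← Real.exp_add]
    congr 1
    rw [← mul_assoc, show (1 / 2 : ℝ) * 2 = 1 by norm_num, one_mul]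
    congr 1; ring
  · rw [Set.indicator_of_notMem (show e ∉ Set.Ici 0 from he), exponentialPDF_of_neg (not_le.1 he),
      mul_zero]

theorem lintegral_ofReal_expMeasure : ∫⁻ e, ENNReal.ofReal e ∂expMeasure 1 = 1 := by
  rw [lintegral_expMeasure ENNReal.measurable_ofReal,
    ← lintegral_gammaPDF_eq_one (a := 2) (r := 1) two_pos one_pos,
    ← lintegral_indicator measurableSet_Ici]
  refine lintegral_congr fun e => ?_
  by_cases he : 0 ≤ e
  · rw [Set.indicator_of_mem (show e ∈ Set.Ici 0 from he), gammaPDF_of_nonneg he,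
      ← ENNReal.ofReal_mul (Real.exp_pos _).le, Real.Gamma_two,
      show (2 : ℝ) - 1 = 1 by norm_num, Real.rpow_one]
    congr 1
    simp [mul_comm]
  · rw [Set.indicator_of_notMem (show e ∉ Set.Ici 0 from he), gammaPDF_of_neg (not_le.1 he)]

theorem Regular.rate_pos (hW : W.Regular) (s : WalkSpeed) (x : G) : 0 < W.rate s x := by
  cases s
  · exact one_pos
  · exact hW.weight_pos x

theorem rate_mul_theta (W : WeightedGraph G) (s : WalkSpeed) (x : G) :
    W.rate s x * W.theta s x = W.weight x := by
  cases s
  · exact one_mul _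
  · exact mul_one _

/-- The mean of `f` after a jump, in terms of the generator. -/
theorem Regular.sum_jump (hW : W.Regular) (s : WalkSpeed) (f : G → ℝ) (x : G) :
    ∑ z ∈ hW.nbr x, W.ω x z / W.weight x * f z = f x + W.laplacian s f x / W.rate s x := by
  have h1 := hW.theta_mul_laplacian s f x
  have h2 := hW.weight_pos x
  have h3 := hW.rate_pos s x
  have h4 := hW.theta_pos s x
  have h5 := rate_mul_theta W s x
  have : ∑ z ∈ hW.nbr x, W.ω x z / W.weight x * f z =
      (∑ z ∈ hW.nbr x, W.ω x z * f z) / W.weight x := by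
    rw [Finset.sum_div]
    exact Finset.sum_congr rfl fun z _ => by ring
  rw [this, div_eq_iff h2.ne']
  have h6 : W.laplacian s f x / W.rate s x * W.weight x = W.theta s x * W.laplacian s f x := by
    rw [← h5]; field_simp
  rw [add_mul, h6, h1]; ring

theorem jumpTime_cons (W : WeightedGraph G) (s : WalkSpeed) (x : G) (e : ℝ)
    (p : (ℕ → G) × (ℕ → ℝ)) (n : ℕ) :
    W.jumpTime s (seqCons x p.1, seqCons e p.2) (n + 1) =
      ENNReal.ofReal e / ENNReal.ofReal (W.rate s x) + W.jumpTime s p n := by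
  unfold jumpTime
  rw [Finset.sum_range_succ', add_comm]
  rfl

theorem jumpTime_mono (W : WeightedGraph G) (s : WalkSpeed) (p : (ℕ → G) × (ℕ → ℝ)) :
    Monotone (W.jumpTime s p) := by
  intro m n hmn
  exact Finset.sum_le_sum_of_subset (Finset.range_subset_range.2 hmn)

open scoped Classical in
/-- The time spent in `A` during the first `n` holding times, up to the exit of the jump chain. -/
def timeIn (W : WeightedGraph G) (s : WalkSpeed) (A : Set G) (n : ℕ) (p : (ℕ → G) × (ℕ → ℝ)) :
    ℝ≥0∞ :=
  ∑ k ∈ Finset.range n, if ∀ i ≤ k, p.1 i ∈ A then W.holdTime s p k else 0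

open scoped Classical in
theorem timeIn_cons (W : WeightedGraph G) (s : WalkSpeed) (A : Set G) (x : G) (e : ℝ)
    (p : (ℕ → G) × (ℕ → ℝ)) (n : ℕ) :
    W.timeIn s A (n + 1) (seqCons x p.1, seqCons e p.2) =
      if x ∈ A then ENNReal.ofReal e / ENNReal.ofReal (W.rate s x) + W.timeIn s A n p else 0 := by
  unfold timeIn
  rw [Finset.sum_range_succ']
  have h0 : (∀ i ≤ 0, seqCons x p.1 i ∈ A) ↔ x ∈ A := by
    simp [seqCons]
  have h1 : ∀ k, (∀ i ≤ k + 1, seqCons x p.1 i ∈ A) ↔ x ∈ A ∧ ∀ i ≤ k, p.1 i ∈ A := by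
    intro k
    constructor
    · exact fun h => ⟨h 0 (Nat.zero_le _), fun i hi => h (i + 1) (by omega)⟩
    · rintro ⟨h0, h⟩ i hi
      cases i with
      | zero => exact h0
      | succ i => exact h i (by omega)
  simp only [h0, h1]
  by_cases hx : x ∈ A
  · simp only [hx, true_and, if_true]
    rw [add_comm]
    rfl
  · simp [hx]

theorem timeIn_mono (W : WeightedGraph G) (s : WalkSpeed) (A : Set G) :
    Monotone (W.timeIn s A) := by
  intro m n hmn p
  exact Finset.sum_le_sum_of_subset (Finset.range_subset_range.2 hmn)

/-- The walk has left `A` by the time the jump chain has: if the chain never leaves `A`, all holding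
times count on the right, and the exit happens at the explosion time at the latest. -/
theorem exitTime_le (W : WeightedGraph G) (s : WalkSpeed) (A : Set G) {p : (ℕ → G) × (ℕ → ℝ)}
    (hp : ∀ n, 0 < p.2 n) : W.exitTime s A p ≤ ⨆ n, W.timeIn s A n p := by
  classical
  by_cases htop : (⨆ n, W.timeIn s A n p) = ∞
  · rw [htop]; exact le_top
  unfold exitTime
  by_cases hex : ∃ n, p.1 n ∉ A
  · obtain ⟨h1, h2⟩ : p.1 (Nat.find hex) ∉ A ∧ ∀ k < Nat.find hex, p.1 k ∈ A :=
      ⟨Nat.find_spec hex, fun k hk => not_not.1 (Nat.find_min hex hk)⟩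
    set N := Nat.find hex
    have hT : W.timeIn s A N p = W.jumpTime s p N :=
      Finset.sum_congr rfl fun k hk => if_pos fun i hi =>
        h2 i (lt_of_le_of_lt hi (Finset.mem_range.1 hk))
    have hle : W.jumpTime s p N ≤ ⨆ n, W.timeIn s A n p :=
      hT ▸ le_iSup (fun n => W.timeIn s A n p) N
    refine le_trans (sInf_le ?_) hle
    rintro ⟨y, hy, m, hm1, hm2, hm3⟩
    rcases lt_trichotomy m N with h | h | h
    · exact absurd (lt_of_lt_of_le hm2 (jumpTime_mono W s p h)) (lt_irrefl _)
    · rw [h] at hm3; exact h1 (hm3 ▸ hy)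
    · have h3 : W.jumpTime s p (N + 1) ≤ W.jumpTime s p N := (jumpTime_mono W s p h).trans hm1
      have h4 : W.jumpTime s p (N + 1) = W.jumpTime s p N + W.holdTime s p N :=
        Finset.sum_range_succ _ _
      have h5 : 0 < W.holdTime s p N :=
        ENNReal.div_pos (ENNReal.ofReal_pos.2 (hp N)).ne' ENNReal.ofReal_ne_top
      have h6 : W.jumpTime s p N ≠ ∞ := ne_top_of_le_ne_top htop hle
      rw [h4] at h3
      exact absurd h3 (not_le.2 (ENNReal.lt_add_right h6 h5.ne'))
  · push Not at hex
    have hT : ∀ n, W.timeIn s A n p = W.jumpTime s p n := fun n =>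
      Finset.sum_congr rfl fun k _ => if_pos fun i _ => hex i
    refine sInf_le ?_
    rintro ⟨y, _, m, _, hm2, _⟩
    rw [← hT] at hm2
    exact absurd (lt_of_lt_of_le hm2 (le_iSup (fun n => W.timeIn s A n p) (m + 1))) (lt_irrefl _)

section walk

variable [Countable G] [MeasurableSpace G] [DiscreteMeasurableSpace G]

theorem Regular.lintegral_jumpKernel (hW : W.Regular) (x : G) (f : G → ℝ≥0∞) :
    ∫⁻ z, f z ∂W.jumpKernel x =
      ∑ z ∈ hW.nbr x, ENNReal.ofReal (W.ω x z / W.weight x) * f z := by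
  have hsum : ∑' y, ENNReal.ofReal (W.ω x y) = ENNReal.ofReal (W.weight x) := by
    rw [tsum_eq_sum (s := hW.nbr x) fun y hy => by rw [hW.omega_eq_zero hy, ENNReal.ofReal_zero],
      hW.weight_eq, ENNReal.ofReal_sum_of_nonneg fun y _ => W.nonneg x y]
  have hpos := hW.weight_pos x
  have hcond : (∑' y, ENNReal.ofReal (W.ω x y)) ≠ 0 ∧ (∑' y, ENNReal.ofReal (W.ω x y)) ≠ ∞ := by
    rw [hsum]
    exact ⟨(ENNReal.ofReal_pos.2 hpos).ne', ENNReal.ofReal_ne_top⟩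
  have hJ : ∀ z, W.jumpKernel x {z} = ENNReal.ofReal (W.ω x z / W.weight x) := by
    intro z
    have : W.jumpKernel x = (W.jumpPMF x).toMeasure := rfl
    rw [this, PMF.toMeasure_apply_singleton _ _ (measurableSet_singleton z), jumpPMF, dif_pos hcond,
      PMF.normalize_apply, hsum, ENNReal.ofReal_div_of_pos hpos, div_eq_mul_inv]
  rw [lintegral_countable', tsum_eq_sum (s := hW.nbr x)]
  · exact Finset.sum_congr rfl fun z _ => by rw [hJ, mul_comm]
  · intro z hz
    rw [hJ, hW.omega_eq_zero hz, zero_div, ENNReal.ofReal_zero, mul_zero]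

theorem measurable_holdTime (W : WeightedGraph G) (s : WalkSpeed) (n : ℕ) :
    Measurable fun p : (ℕ → G) × (ℕ → ℝ) => W.holdTime s p n := by
  have h1 : Measurable fun p : (ℕ → G) × (ℕ → ℝ) => p.2 n :=
    (measurable_pi_apply n).comp measurable_snd
  have h2 : Measurable fun p : (ℕ → G) × (ℕ → ℝ) => p.1 n :=
    (measurable_pi_apply n).comp measurable_fst
  have h3 : Measurable fun x : G => ENNReal.ofReal (W.rate s x) := measurable_of_countable _
  exact h1.ennreal_ofReal.div (h3.comp h2)

theorem measurable_jumpTime (W : WeightedGraph G) (s : WalkSpeed) (n : ℕ) :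
    Measurable fun p : (ℕ → G) × (ℕ → ℝ) => W.jumpTime s p n :=
  Finset.measurable_fun_sum _ fun k _ => measurable_holdTime W s k

theorem measurable_timeIn (W : WeightedGraph G) (s : WalkSpeed) (A : Set G) (n : ℕ) :
    Measurable (W.timeIn s A n) := by
  classical
  refine Finset.measurable_fun_sum _ fun k _ => Measurable.ite ?_ (measurable_holdTime W s k)
    measurable_const
  have : {p : (ℕ → G) × (ℕ → ℝ) | ∀ i ≤ k, p.1 i ∈ A} =
      ⋂ i ∈ Set.Iic k, (fun p : (ℕ → G) × (ℕ → ℝ) => p.1 i) ⁻¹' A := by ext; simp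
  rw [this]
  exact MeasurableSet.biInter (Set.to_countable _) fun i _ =>
    ((measurable_pi_apply i).comp measurable_fst) (Set.to_countable A).measurableSet

/-- By induction on `n`, decomposing at the first jump: `v(x)` is the mean of the first holding time
plus the mean of `v` after the first jump. -/
theorem Regular.lintegral_timeIn_le (hW : W.Regular) {A : Set G} {v : G → ℝ} (hv0 : ∀ x, 0 ≤ v x)
    (hv : ∀ x ∈ A, W.laplacian s v x = -1) (n : ℕ) (x : G) :
    ∫⁻ p, W.timeIn s A n p ∂W.pathLaw x ≤ ENNReal.ofReal (v x) := by
  classical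
  have := isProbabilityMeasure_exp
  induction n generalizing x with
  | zero => simp [timeIn]
  | succ n ih =>
    rw [lintegral_pathLaw W x (measurable_timeIn W s A (n + 1))]
    simp only [timeIn_cons]
    by_cases hx : x ∈ A
    swap
    · simp [hx]
    simp only [hx, if_true]
    have hr := hW.rate_pos s x
    have h1 : ∀ e : ℝ, ∫⁻ z, ∫⁻ p, (ENNReal.ofReal e / ENNReal.ofReal (W.rate s x) +
        W.timeIn s A n p) ∂W.pathLaw z ∂W.jumpKernel x ≤
        ENNReal.ofReal e / ENNReal.ofReal (W.rate s x) +
          ∫⁻ z, ENNReal.ofReal (v z) ∂W.jumpKernel x := by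
      intro e
      have h2 : ∀ z, ∫⁻ p, (ENNReal.ofReal e / ENNReal.ofReal (W.rate s x) +
          W.timeIn s A n p) ∂W.pathLaw z ≤
          ENNReal.ofReal e / ENNReal.ofReal (W.rate s x) + ENNReal.ofReal (v z) := by
        intro z
        rw [lintegral_add_left measurable_const, lintegral_const, measure_univ, mul_one]
        exact add_le_add le_rfl (ih z)
      refine (lintegral_mono h2).trans_eq ?_
      rw [lintegral_add_left measurable_const, lintegral_const, measure_univ, mul_one]
    refine (lintegral_mono h1).trans ?_
    rw [lintegral_add_right _ measurable_const, lintegral_const, measure_univ, mul_one]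
    simp only [div_eq_mul_inv]
    rw [lintegral_mul_const _ ENNReal.measurable_ofReal, lintegral_ofReal_expMeasure, one_mul,
      hW.lintegral_jumpKernel]
    have h3 : ∑ z ∈ hW.nbr x, ENNReal.ofReal (W.ω x z / W.weight x) * ENNReal.ofReal (v z) =
        ENNReal.ofReal (∑ z ∈ hW.nbr x, W.ω x z / W.weight x * v z) := by
      have hnn : ∀ z, 0 ≤ W.ω x z / W.weight x :=
        fun z => div_nonneg (W.nonneg x z) (hW.weight_pos x).le
      rw [ENNReal.ofReal_sum_of_nonneg fun z _ => mul_nonneg (hnn z) (hv0 z)]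
      exact Finset.sum_congr rfl fun z _ => (ENNReal.ofReal_mul (hnn z)).symm
    have h4 : 0 ≤ ∑ z ∈ hW.nbr x, W.ω x z / W.weight x * v z :=
      Finset.sum_nonneg fun z _ =>
        mul_nonneg (div_nonneg (W.nonneg x z) (hW.weight_pos x).le) (hv0 z)
    rw [h3, ← ENNReal.ofReal_inv_of_pos hr, ← ENNReal.ofReal_add (inv_nonneg.2 hr.le) h4,
      hW.sum_jump s, hv x hx]
    refine ENNReal.ofReal_le_ofReal (le_of_eq ?_)
    field_simp
    ring

theorem ae_exp_pos (W : WeightedGraph G) (x : G) : ∀ᵐ p ∂W.pathLaw x, ∀ n, 0 < p.2 n := by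
  have := isProbabilityMeasure_exp
  have h1 := ae_pos_expMeasure
  refine ae_all_iff.2 fun n => ?_
  have h2 : ((W.pathLaw x).map fun p => p.2 n) = expMeasure 1 := by
    have e : (fun p : (ℕ → G) × (ℕ → ℝ) => p.2 n) = (fun f : ℕ → ℝ => f n) ∘ Prod.snd := rfl
    rw [e, ← Measure.map_map (measurable_pi_apply n) measurable_snd]
    unfold pathLaw
    rw [Measure.map_snd_prod, measure_univ, one_smul]
    exact Measure.infinitePi_map_eval (fun _ : ℕ => expMeasure 1) n
  rw [← h2] at h1
  exact ae_of_ae_map ((measurable_pi_apply n).comp measurable_snd).aemeasurable h1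

/-- The mean exit time from `A` is at most any non-negative solution of `L v = -1` on `A`. -/
theorem Regular.meanExitTime_le (hW : W.Regular) {A : Set G} {v : G → ℝ} (hv0 : ∀ x, 0 ≤ v x)
    (hv : ∀ x ∈ A, W.laplacian s v x = -1) (x : G) :
    W.meanExitTime s A x ≤ ENNReal.ofReal (v x) := by
  unfold meanExitTime
  calc _ ≤ ∫⁻ p, ⨆ n, W.timeIn s A n p ∂W.pathLaw x := by
        refine lintegral_mono_ae ?_
        filter_upwards [ae_exp_pos W x] with p hp using exitTime_le W s A hp
    _ = ⨆ n, ∫⁻ p, W.timeIn s A n p ∂W.pathLaw x :=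
        lintegral_iSup (fun n => measurable_timeIn W s A n) (timeIn_mono W s A)
    _ ≤ _ := iSup_le fun n => hW.lintegral_timeIn_le hv0 hv n x

end walk

end

/-! ### Domination of the killed semigroup by the random walk -/

section

variable {G : Type*} {W : WeightedGraph G} {s : WalkSpeed}

open scoped Classical in
/-- First-jump decomposition of the killed semigroup. -/
theorem Regular.ofReal_killed_eq_lintegral (hW : W.Regular) {D : Finset G} {x y : G} (hx : x ∈ D)
    (hy : y ∈ D) {t : ℝ} (ht : 0 ≤ t) :
    ENNReal.ofReal (hW.killed s D t x y * W.theta s y) = ∫⁻ e, (if t < e / W.rate s x then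
      (if x = y then 1 else 0) else ENNReal.ofReal (∑ z ∈ hW.nbr x, W.ω x z / W.weight x *
        (hW.killed s D (t - e / W.rate s x) z y * W.theta s y))) ∂expMeasure 1 := by
  set r := W.rate s x with hr
  have hr0 : 0 < r := hW.rate_pos s x
  set k : ℝ → G → ℝ := fun t z => hW.killed s D t z y * W.theta s y with hk
  set q : ℝ → ℝ := fun e => ∑ z ∈ hW.nbr x, W.ω x z / W.weight x * k (t - e / r) z with hq
  have hkc : ∀ z, Continuous fun t => k t z := fun z =>
    (hW.continuous_killed s D z y).mul continuous_const
  have hqc : Continuous q := by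
    refine continuous_finsetSum _ fun z _ => continuous_const.mul ((hkc z).comp ?_)
    fun_prop
  have hq0 : ∀ e, e ≤ r * t → 0 ≤ q e := by
    intro e he
    refine Finset.sum_nonneg fun z _ => mul_nonneg
      (div_nonneg (W.nonneg x z) (hW.weight_pos x).le) (mul_nonneg (hW.killed_nonneg s D ?_ z y)
        (hW.theta_pos s y).le)
    rw [sub_nonneg, div_le_iff₀ hr0]; linarith
  have hmeas : Measurable fun e => (if t < e / r then (if x = y then (1 : ℝ≥0∞) else 0)
      else ENNReal.ofReal (q e)) :=
    Measurable.ite (measurableSet_lt measurable_const (by fun_prop)) measurable_const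
      hqc.measurable.ennreal_ofReal
  rw [lintegral_expMeasure hmeas]
  have hrt : 0 ≤ r * t := by positivity
  rw [← Set.Icc_union_Ioi_eq_Ici hrt, lintegral_union measurableSet_Ioi
    (Set.disjoint_left.2 fun e h1 h2 => absurd h1.2 (not_le.2 h2))]
  have h1 : ∫⁻ e in Set.Icc 0 (r * t), ENNReal.ofReal (Real.exp (-e)) *
      (if t < e / r then (if x = y then (1 : ℝ≥0∞) else 0) else ENNReal.ofReal (q e)) =
      ENNReal.ofReal (∫ e in (0)..(r * t), Real.exp (-e) * q e) := by
    have hc : Continuous fun e => Real.exp (-e) * q e := by fun_prop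
    rw [intervalIntegral.integral_of_le hrt, ← integral_Icc_eq_integral_Ioc,
      ofReal_integral_eq_lintegral_ofReal hc.continuousOn.integrableOn_Icc]
    · refine setLIntegral_congr_fun measurableSet_Icc fun e he => ?_
      have : ¬ t < e / r := by
        rw [not_lt, div_le_iff₀ hr0]; linarith [he.2]
      simp only [if_neg this]
      rw [← ENNReal.ofReal_mul (Real.exp_pos _).le]
    · refine (ae_restrict_iff' measurableSet_Icc).2 (Filter.Eventually.of_forall fun e he => ?_)
      exact mul_nonneg (Real.exp_pos _).le (hq0 e he.2)
  have h2 : ∫⁻ e in Set.Ioi (r * t), ENNReal.ofReal (Real.exp (-e)) *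
      (if t < e / r then (if x = y then (1 : ℝ≥0∞) else 0) else ENNReal.ofReal (q e)) =
      ENNReal.ofReal (Real.exp (-(r * t)) * (if x = y then 1 else 0)) := by
    have : ∫⁻ e in Set.Ioi (r * t), ENNReal.ofReal (Real.exp (-e)) *
        (if t < e / r then (if x = y then (1 : ℝ≥0∞) else 0) else ENNReal.ofReal (q e)) =
        ∫⁻ e in Set.Ioi (r * t), ENNReal.ofReal (Real.exp (-e)) * (if x = y then 1 else 0) := by
      refine setLIntegral_congr_fun measurableSet_Ioi fun e he => ?_
      have : t < e / r := by
        rw [lt_div_iff₀ hr0]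
        have : r * t < e := he
        linarith
      simp only [if_pos this]
    rw [this, lintegral_mul_const _ (by fun_prop), ENNReal.ofReal_mul (Real.exp_pos _).le]
    congr 1
    · rw [← ofReal_integral_eq_lintegral_ofReal, integral_exp_neg_Ioi]
      · have := exp_neg_integrableOn_Ioi (r * t) one_pos
        simp only [neg_mul, one_mul] at this
        exact this
      · exact Filter.Eventually.of_forall fun e => (Real.exp_pos _).le
    · split_ifs <;> simp
  have h3 : ∫ e in (0)..(r * t), Real.exp (-e) * q e =
      k t x - Real.exp (-(r * t)) * (if x = y then 1 else 0) := by
    have hd : ∀ e ∈ Set.uIcc 0 (r * t),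
        HasDerivAt (fun e => -(Real.exp (-e) * k (t - e / r) x)) (Real.exp (-e) * q e) e := by
      intro e _
      have d1 : HasDerivAt (fun e : ℝ => t - e / r) (-(1 / r)) e := by
        simpa using ((hasDerivAt_id e).div_const r).const_sub t
      have d2 : HasDerivAt (fun t => k t x)
          (W.laplacian s (fun z => hW.killed s D (t - e / r) z y) x * W.theta s y) (t - e / r) :=
        (hW.hasDerivAt_killed s D _ y hx).mul_const _
      have d3 : HasDerivAt (fun e : ℝ => Real.exp (-e)) (-Real.exp (-e)) e := by
        simpa using (hasDerivAt_neg e).exp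
      have d4 := (d3.mul (d2.comp e d1)).neg
      refine d4.congr_deriv ?_
      have e1 : q e = k (t - e / r) x + W.laplacian s (k (t - e / r)) x / r := hW.sum_jump s _ x
      have e2 : W.laplacian s (k (t - e / r)) x =
          W.laplacian s (fun z => hW.killed s D (t - e / r) z y) x * W.theta s y := by
        have : k (t - e / r) = fun z => W.theta s y * hW.killed s D (t - e / r) z y := by
          funext z; simp only [hk]; ring
        rw [this, hW.laplacian_const_mul]; ring
      rw [e1, e2]
      simp only [Function.comp]
      ring
    rw [intervalIntegral.integral_eq_sub_of_hasDerivAt hd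
      (Continuous.intervalIntegrable (by fun_prop) _ _)]
    have e1 : t - r * t / r = 0 := by field_simp; ring
    have e2 : k 0 x = if x = y then 1 else 0 := by
      simp only [hk]
      rw [hW.killed_zero s D hx hy]
      split_ifs with h
      · rw [h]; field_simp [(hW.theta_pos s y).ne']
      · simp
    rw [e1, e2]
    simp
    ring
  have h4 : 0 ≤ ∫ e in (0)..(r * t), Real.exp (-e) * q e :=
    intervalIntegral.integral_nonneg hrt fun e he =>
      mul_nonneg (Real.exp_pos _).le (hq0 e he.2)
  rw [h1, h2, ← ENNReal.ofReal_add h4 (by split_ifs <;> positivity), h3]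
  congr 1
  ring

/-- The event that the walk is at `y` at time `t` after fewer than `n` jumps. -/
def isAtBefore (W : WeightedGraph G) (s : WalkSpeed) (y : G) (n : ℕ) (t : ℝ) :
    Set ((ℕ → G) × (ℕ → ℝ)) :=
  {p | ∃ m < n, W.jumpTime s p m ≤ ENNReal.ofReal t ∧
    ENNReal.ofReal t < W.jumpTime s p (m + 1) ∧ p.1 m = y}

theorem Regular.cons_mem_isAtBefore_zero (hW : W.Regular) {x : G} {n : ℕ} {t e : ℝ} (ht0 : 0 ≤ t)
    (ht : t < e / W.rate s x) (p : (ℕ → G) × (ℕ → ℝ)) :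
    (seqCons x p.1, seqCons e p.2) ∈ W.isAtBefore s x (n + 1) t := by
  refine ⟨0, Nat.succ_pos n, by simp [jumpTime], ?_, rfl⟩
  rw [jumpTime_cons, ← ENNReal.ofReal_div_of_pos (hW.rate_pos s x)]
  have h0 : W.jumpTime s p 0 = 0 := by simp [jumpTime]
  rw [h0, add_zero]
  exact (ENNReal.ofReal_lt_ofReal_iff (ht0.trans_lt ht)).2 ht

theorem Regular.cons_mem_isAtBefore_succ (hW : W.Regular) {x y : G} {n : ℕ} {t e : ℝ} (he : 0 ≤ e)
    (ht : e / W.rate s x ≤ t) {p : (ℕ → G) × (ℕ → ℝ)}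
    (hp : p ∈ W.isAtBefore s y n (t - e / W.rate s x)) :
    (seqCons x p.1, seqCons e p.2) ∈ W.isAtBefore s y (n + 1) t := by
  obtain ⟨m, hm, h1, h2, h3⟩ := hp
  have hτ : 0 ≤ e / W.rate s x := div_nonneg he (hW.rate_pos s x).le
  have ht' : ENNReal.ofReal t =
      ENNReal.ofReal (e / W.rate s x) + ENNReal.ofReal (t - e / W.rate s x) := by
    rw [← ENNReal.ofReal_add hτ (sub_nonneg.2 ht)]; congr 1; ring
  refine ⟨m + 1, Nat.succ_lt_succ hm, ?_, ?_, h3⟩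
  · rw [jumpTime_cons, ← ENNReal.ofReal_div_of_pos (hW.rate_pos s x), ht']
    exact add_le_add le_rfl h1
  · rw [jumpTime_cons, ← ENNReal.ofReal_div_of_pos (hW.rate_pos s x), ht']
    exact ENNReal.add_lt_add_left ENNReal.ofReal_ne_top h2

section walk

variable [Countable G] [MeasurableSpace G] [DiscreteMeasurableSpace G]

theorem measurableSet_isAtBefore (W : WeightedGraph G) (s : WalkSpeed) (y : G) (n : ℕ) (t : ℝ) :
    MeasurableSet (W.isAtBefore s y n t) := by
  have : W.isAtBefore s y n t = ⋃ m ∈ Set.Iio n,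
      ({p | W.jumpTime s p m ≤ ENNReal.ofReal t} ∩ {p | ENNReal.ofReal t < W.jumpTime s p (m + 1)} ∩
        (fun p : (ℕ → G) × (ℕ → ℝ) => p.1 m) ⁻¹' {y}) := by
    ext p
    simp only [isAtBefore, Set.mem_ofPred_eq, Set.mem_iUnion, Set.mem_Iio, Set.mem_inter_iff,
      Set.mem_preimage, Set.mem_singleton_iff, exists_prop, and_assoc]
  rw [this]
  refine MeasurableSet.biUnion (Set.to_countable _) fun m _ => ?_
  exact ((measurableSet_le (measurable_jumpTime W s m) measurable_const).inter
    (measurableSet_lt measurable_const (measurable_jumpTime W s (m + 1)))).inter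
    (((measurable_pi_apply m).comp measurable_fst) (measurableSet_singleton y))

/-- The bound `e^{ρ t} / 2 ^ n` for the probability of `n` jumps by time `t`, at jump rates at most `ρ`,
propagates through a first-jump decomposition. -/
theorem lintegral_error_le {ρ r t : ℝ} (hr : 0 < r) (hρ : r ≤ ρ) (n : ℕ) :
    ∫⁻ e, (if t < e / r then 0 else ENNReal.ofReal (Real.exp (ρ * (t - e / r)) / 2 ^ n))
      ∂expMeasure 1 ≤ ENNReal.ofReal (Real.exp (ρ * t) / 2 ^ (n + 1)) := by
  have h1 : ∀ᵐ e ∂expMeasure 1,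
      (if t < e / r then 0 else ENNReal.ofReal (Real.exp (ρ * (t - e / r)) / 2 ^ n)) ≤
        ENNReal.ofReal (Real.exp (ρ * t) / 2 ^ n) * ENNReal.ofReal (Real.exp (-e)) := by
    filter_upwards [ae_pos_expMeasure] with e he
    split_ifs
    · exact zero_le
    · rw [← ENNReal.ofReal_mul (by positivity)]
      refine ENNReal.ofReal_le_ofReal ?_
      rw [div_mul_eq_mul_div, ← Real.exp_add]
      refine div_le_div_of_nonneg_right (Real.exp_le_exp.2 ?_) (by positivity)
      have : e ≤ ρ * (e / r) := by
        rw [mul_div_assoc', le_div_iff₀ hr]; nlinarith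
      linarith
  refine (lintegral_mono_ae h1).trans_eq ?_
  rw [lintegral_const_mul _ (by fun_prop), lintegral_exp_neg_expMeasure,
    ← ENNReal.ofReal_mul (by positivity)]
  congr 1
  rw [pow_succ]; field_simp

/-- The killed semigroup is dominated by the walk with fewer than `n` jumps, up to an error that
vanishes as `n → ∞`. -/
theorem Regular.ofReal_killed_le (hW : W.Regular) {D : Finset G} {y : G} (hy : y ∈ D) {ρ : ℝ}
    (hρ : ∀ x ∈ D, W.rate s x ≤ ρ) (n : ℕ) {x : G} (hx : x ∈ D) {t : ℝ} (ht : 0 ≤ t) :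
    ENNReal.ofReal (hW.killed s D t x y * W.theta s y) ≤
      W.pathLaw x (W.isAtBefore s y n t) + ENNReal.ofReal (Real.exp (ρ * t) / 2 ^ n) := by
  classical
  have := isProbabilityMeasure_exp
  induction n generalizing x t with
  | zero =>
    refine le_trans (ENNReal.ofReal_le_ofReal ?_) le_add_self
    have h1 : hW.killed s D t x y * W.theta s y ≤ hW.flow s D t (fun _ => 1) x := by
      have h := Finset.single_le_sum (f := fun y => hW.killed s D t x y * 1 * W.theta s y)
        (fun z _ => mul_nonneg (mul_nonneg (hW.killed_nonneg s D ht x z) zero_le_one)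
          (hW.theta_pos s z).le) hy
      unfold Regular.flow
      simpa only [mul_one] using h
    have h2 := hW.flow_one_le s D ht x
    have h3 : 0 ≤ ρ := (hW.rate_pos s x).le.trans (hρ x hx)
    have h4 : 1 ≤ Real.exp (ρ * t) := Real.one_le_exp (by positivity)
    simp only [pow_zero, div_one]
    linarith
  | succ n ih =>
    have hr := hW.rate_pos s x
    set r := W.rate s x
    have hmeas := measurableSet_isAtBefore W s y (n + 1) t
    have hP : W.pathLaw x (W.isAtBefore s y (n + 1) t) = ∫⁻ e, ∫⁻ z, ∫⁻ p,
        (W.isAtBefore s y (n + 1) t).indicator 1 (seqCons x p.1, seqCons e p.2) ∂W.pathLaw z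
        ∂W.jumpKernel x ∂expMeasure 1 := by
      rw [← lintegral_indicator_one hmeas]
      exact lintegral_pathLaw W x (measurable_one.indicator hmeas)
    rw [hW.ofReal_killed_eq_lintegral hx hy ht, hP]
    refine le_trans ?_ (add_le_add le_rfl (lintegral_error_le (t := t) hr (hρ x hx) n))
    rw [← lintegral_add_right _ (Measurable.ite (measurableSet_lt measurable_const (by fun_prop))
      measurable_const (by fun_prop))]
    refine lintegral_mono_ae ?_
    filter_upwards [ae_pos_expMeasure] with e he
    by_cases hte : t < e / r
    · rw [if_pos hte, if_pos hte, add_zero]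
      split_ifs with hxy
      · subst hxy
        have : ∀ p : (ℕ → G) × (ℕ → ℝ), (W.isAtBefore s x (n + 1) t).indicator
            (1 : (ℕ → G) × (ℕ → ℝ) → ℝ≥0∞) (seqCons x p.1, seqCons e p.2) = 1 := fun p =>
          Set.indicator_of_mem (hW.cons_mem_isAtBefore_zero ht hte p) _
        simp only [this, lintegral_const, measure_univ, mul_one, le_refl]
      · exact zero_le
    · rw [if_neg hte, if_neg hte]
      push Not at hte
      have hnn : ∀ z, 0 ≤ W.ω x z / W.weight x :=
        fun z => div_nonneg (W.nonneg x z) (hW.weight_pos x).le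
      have hkn : ∀ z, 0 ≤ hW.killed s D (t - e / r) z y * W.theta s y := fun z =>
        mul_nonneg (hW.killed_nonneg s D (sub_nonneg.2 hte) z y) (hW.theta_pos s y).le
      rw [ENNReal.ofReal_sum_of_nonneg fun z _ => mul_nonneg (hnn z) (hkn z)]
      have h1 : ∑ z ∈ hW.nbr x, ENNReal.ofReal (W.ω x z / W.weight x *
          (hW.killed s D (t - e / r) z y * W.theta s y)) ≤
          ∫⁻ z, (W.pathLaw z (W.isAtBefore s y n (t - e / r)) +
            ENNReal.ofReal (Real.exp (ρ * (t - e / r)) / 2 ^ n)) ∂W.jumpKernel x := by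
        rw [hW.lintegral_jumpKernel]
        refine Finset.sum_le_sum fun z _ => ?_
        rw [ENNReal.ofReal_mul (hnn z)]
        refine mul_le_mul le_rfl ?_ zero_le zero_le
        by_cases hz : z ∈ D
        · exact ih hz (sub_nonneg.2 hte)
        · rw [hW.killed_off_left s D _ y hz]; simp
      refine h1.trans ?_
      rw [lintegral_add_right _ measurable_const, lintegral_const, measure_univ, mul_one]
      refine add_le_add (lintegral_mono fun z => ?_) le_rfl
      rw [← lintegral_indicator_one (measurableSet_isAtBefore W s y n (t - e / r))]
      refine lintegral_mono fun p => ?_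
      by_cases hp : p ∈ W.isAtBefore s y n (t - e / r)
      · rw [Set.indicator_of_mem hp,
          Set.indicator_of_mem (hW.cons_mem_isAtBefore_succ he.le hte hp)]
        simp
      · rw [Set.indicator_of_notMem hp]
        exact zero_le

/-- The killed heat kernel is dominated by the heat kernel. -/
theorem Regular.killed_le_heatKernel (hW : W.Regular) (s : WalkSpeed) (D : Finset G) {t : ℝ}
    (ht : 0 ≤ t) (x y : G) : hW.killed s D t x y ≤ W.heatKernel s t x y := by
  have hnn : 0 ≤ W.heatKernel s t x y :=
    div_nonneg ENNReal.toReal_nonneg (hW.theta_pos s y).le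
  by_cases hx : x ∈ D
  swap
  · rwa [hW.killed_off_left s D t y hx]
  by_cases hy : y ∈ D
  swap
  · rwa [hW.killed_off_right s D t x hy]
  obtain ⟨z, _, hz⟩ := D.exists_max_image (W.rate s) ⟨x, hx⟩
  unfold heatKernel
  rw [le_div_iff₀ (hW.theta_pos s y)]
  set P := W.pathLaw x {p | W.IsAt s p (ENNReal.ofReal t) y} with hP
  have hkey : ∀ n : ℕ, hW.killed s D t x y * W.theta s y ≤
      P.toReal + Real.exp (W.rate s z * t) * (1 / 2) ^ n := by
    intro n
    have h1 := hW.ofReal_killed_le hy hz n hx ht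
    have h2 : W.pathLaw x (W.isAtBefore s y n t) ≤ P :=
      measure_mono fun p ⟨m, _, h⟩ => ⟨m, h⟩
    have h3 := h1.trans (add_le_add h2 le_rfl)
    have hPt : P ≠ ∞ := measure_ne_top _ _
    rw [← ENNReal.ofReal_toReal hPt, ← ENNReal.ofReal_add ENNReal.toReal_nonneg (by positivity),
      ENNReal.ofReal_le_ofReal_iff (by positivity)] at h3
    rw [one_div_pow, mul_one_div]
    exact h3
  have hlim : Filter.Tendsto (fun n : ℕ => P.toReal + Real.exp (W.rate s z * t) * (1 / 2) ^ n)
      Filter.atTop (nhds (P.toReal + Real.exp (W.rate s z * t) * 0)) :=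
    tendsto_const_nhds.add ((tendsto_pow_atTop_nhds_zero_of_lt_one (by norm_num)
      (by norm_num)).const_mul _)
  rw [mul_zero, add_zero] at hlim
  exact ge_of_tendsto' hlim hkey

end walk

end

end WeightedGraph

end

end RCM

namespace RCM

noncomputable section

open Filter

/-- The factor by which the exit domains at scale `r` may exceed the graph ball of radius `r`. -/
def Constants.spread (k : Constants) : ℝ := max 1 (1 / k.c₅)

theorem Constants.one_le_spread (k : Constants) : 1 ≤ k.spread := le_max_left _ _

theorem Constants.spread_pos (k : Constants) : 0 < k.spread := one_pos.trans_le k.one_le_spread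

namespace WeightedGraph

/-! ### The standing assumption in terms of killed heat kernels -/

section

variable {G : Type*} {W : WeightedGraph G} {s : WalkSpeed}

/-- What the analysis uses of the standing assumption: finite domains `D r`, comparable with the
balls of radius `r` around `x₀`, with heat kernel, volume, torsion and Harnack estimates at all
large scales. The torsion function is not constructed here; the bound is stated for any
non-negative solution of `L v = -1`. -/
structure Scales (hW : W.Regular) (s : WalkSpeed) (d : ℝ) (k : Constants) (x₀ : G)
    (D : ℝ → Finset G) : Prop where
  conn : W.graph.Connected
  ball_subset : ∀ᶠ r in atTop, ∀ y ∈ W.ball x₀ r, y ∈ D r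
  subset_ball : ∀ᶠ r in atTop, ∀ y ∈ D r, y ∈ W.ball x₀ (k.spread * r)
  upper : ∃ T₀ : ℝ, ∀ t ≥ T₀, ∀ A : Finset G, (∀ y ∈ A, y ∈ W.ball x₀ (t ^ ((1 + k.δ) / 2))) →
    ∀ x ∈ A, ∀ y ∈ A, hW.killed s A t x y ≤ k.c₁ * t ^ (-d / 2)
  volume_le : ∀ᶠ r in atTop, ∀ A : Finset G, (∀ y ∈ A, y ∈ W.ball x₀ r) →
    ∑ y ∈ A, W.theta s y ≤ k.c₄ * r ^ d
  le_volume : ∀ᶠ r in atTop, ∀ A : Finset G, (∀ y ∈ W.ball x₀ r, y ∈ A) →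
    k.c₃ * r ^ d ≤ ∑ y ∈ A, W.theta s y
  torsion : ∀ᶠ r in atTop, ∀ v : G → ℝ, (∀ x, 0 ≤ v x) →
    (∀ x ∈ D r, W.laplacian s v x = -1) → k.c₂ * r ^ 2 ≤ v x₀
  harnack : ∃ R₁ : ℝ, 1 ≤ R₁ ∧ ∀ R ≥ R₁, ∀ h : G → ℝ,
    (∀ x ∈ W.closure (W.ball x₀ R), 0 < h x) → W.HarmonicOn s h (W.ball x₀ R) →
      sSup (h '' W.ball x₀ (R / 2)) ≤ max k.CE 1 * sInf (h '' W.ball x₀ (R / 2))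

theorem thetaSet_coe (W : WeightedGraph G) (s : WalkSpeed) (A : Finset G) :
    W.thetaSet s (A : Set G) = ∑ y ∈ A, W.theta s y :=
  Finset.tsum_subtype A _

/-- The vertex weights are positive as soon as the volume of balls is unbounded: a connected graph
with an isolated vertex is a single point. -/
theorem regular_of_volumeGrowth [Countable G] [MeasurableSpace G] [DiscreteMeasurableSpace G]
    {d : ℝ} (hd : 0 < d) {M : ℕ} {k : Constants} {x₀ : G}
    (hc : W.graph.Connected) (hM : W.DegreeLE M) (hV : W.VolumeGrowth s d k x₀) : W.Regular := by
  have hnt : Nontrivial G := by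
    by_contra hcon
    rw [not_nontrivial_iff_subsingleton] at hcon
    obtain ⟨R₂, hR₂, h⟩ := hV
    have hlim : Tendsto (fun r : ℝ => k.c₃ * r ^ d) atTop atTop :=
      (tendsto_rpow_atTop hd).const_mul_atTop k.c₃_pos
    obtain ⟨R, hR, hRR⟩ := ((hlim.eventually_gt_atTop (W.thetaSet s Set.univ)).and
      (eventually_ge_atTop R₂)).exists
    have hball : W.ball x₀ R = Set.univ := by
      ext y
      rw [Subsingleton.elim y x₀]
      exact ⟨fun _ => trivial, fun _ => mem_ball_self (by linarith)⟩
    have := (h R hRR).1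
    rw [hball] at this
    linarith
  refine ⟨fun x => hM.locFin x, fun x => ?_⟩
  obtain ⟨y, hy⟩ := exists_ne x
  obtain ⟨z, hz⟩ : ∃ z, W.graph.Adj x z := by
    obtain ⟨p⟩ := hc x y
    cases p with
    | nil => exact absurd rfl hy
    | cons h _ => exact ⟨_, h⟩
  have hsum : Summable fun y => W.ω x y :=
    summable_of_ne_finset_zero (s := (hM.locFin x).toFinset) fun y hy =>
      omega_eq_zero_of_not_pos fun h => hy ((hM.locFin x).mem_toFinset.2 h)
  exact hsum.tsum_pos (fun y => W.nonneg x y) z hz.2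

/-- The standing assumption yields domains with good estimates at all large scales: the balls in
which exit times are measured. -/
theorem StandingAssumption.exists_scales [Countable G] [MeasurableSpace G]
    [DiscreteMeasurableSpace G] {d : ℝ} {k : Constants} {x₀ : G}
    (hc : W.graph.Connected) (hW : W.Regular) (h : W.StandingAssumption s d k x₀) :
    ∃ D : ℝ → Finset G, Scales hW s d k x₀ D := by
  classical
  have hfin : ∀ R, (W.ball x₀ R).Finite := ball_finite hc hW.locFin x₀
  have hsub : ∀ r, W.ball x₀ r ⊆ W.exitBall s x₀ r := by
    intro r y hy
    cases s with
    | csrw => exact hy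
    | vsrw => exact (dTilde_le_dist hc x₀ y).trans_lt hy
  have hsup : ∀ᶠ r in atTop, W.exitBall s x₀ r ⊆ W.ball x₀ (k.spread * r) := by
    cases s with
    | csrw =>
      filter_upwards [eventually_ge_atTop 0] with r hr
      exact ball_mono (by nlinarith [k.one_le_spread])
    | vsrw =>
      obtain ⟨R₄, hR₄, hloc⟩ := h.localRegularity
      filter_upwards [eventually_ge_atTop R₄] with r hr y hy
      have hr0 : 0 < r := by linarith
      have hy' : W.dTilde x₀ y < r := hy
      rw [mem_ball]
      by_cases hd : (W.graph.dist x₀ y : ℝ) < r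
      · nlinarith [k.one_le_spread]
      · have h1 := hloc r hr x₀ (mem_ball_self hr0) y (not_lt.1 hd)
        calc (W.graph.dist x₀ y : ℝ) < r / k.c₅ := by
              rw [lt_div_iff₀ k.c₅_pos]; linarith
          _ = 1 / k.c₅ * r := by ring
          _ ≤ _ := mul_le_mul_of_nonneg_right (le_max_right _ _) hr0.le
  let D : ℝ → Finset G := fun r =>
    if hf : (W.exitBall s x₀ r).Finite then hf.toFinset else ∅
  have hD : ∀ᶠ r in atTop, ∀ y, y ∈ D r ↔ y ∈ W.exitBall s x₀ r := by
    filter_upwards [hsup] with r hr y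
    have hf : (W.exitBall s x₀ r).Finite := (hfin _).subset hr
    simp only [D, dif_pos hf, Set.Finite.mem_toFinset]
  refine ⟨D, hc, ?_, ?_, ?_, ?_, ?_, ?_, ?_⟩
  · filter_upwards [hD] with r hr y hy using (hr y).2 (hsub r hy)
  · filter_upwards [hD, hsup] with r hr hs y hy using hs ((hr y).1 hy)
  · obtain ⟨T₀, hT₀, hu⟩ := h.heatKernelUpper
    refine ⟨T₀, fun t ht A hA x hx y hy => ?_⟩
    exact (hW.killed_le_heatKernel s A (by linarith) x y).trans (hu t ht x (hA x hx) y (hA y hy))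
  · obtain ⟨R₂, hR₂, hv⟩ := h.volumeGrowth
    filter_upwards [eventually_ge_atTop R₂] with r hr A hA
    have h1 := (hv r hr).2 x₀ (mem_ball_self (Real.rpow_pos_of_pos (by linarith) _))
    rw [← (hfin r).coe_toFinset, thetaSet_coe] at h1
    exact (Finset.sum_le_sum_of_subset_of_nonneg
      (fun y hy => (hfin r).mem_toFinset.2 (hA y hy))
      fun y _ _ => (hW.theta_pos s y).le).trans h1
  · obtain ⟨R₂, hR₂, hv⟩ := h.volumeGrowth
    filter_upwards [eventually_ge_atTop R₂] with r hr A hA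
    have h1 := (hv r hr).1
    rw [← (hfin r).coe_toFinset, thetaSet_coe] at h1
    exact h1.trans (Finset.sum_le_sum_of_subset_of_nonneg
      (fun y hy => hA y ((hfin r).mem_toFinset.1 hy)) fun y _ _ => (hW.theta_pos s y).le)
  · obtain ⟨R₀, hR₀, he⟩ := h.exitTimeLower
    filter_upwards [hD, eventually_ge_atTop R₀] with r hr hrR v hv hL
    have hmem : x₀ ∈ W.exitBall s x₀ (r ^ (1 + k.δ)) :=
      hsub _ (mem_ball_self (Real.rpow_pos_of_pos (by linarith) _))
    have h1 := (he r hrR x₀ hmem).trans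
      (hW.meanExitTime_le hv (fun x hx => hL x ((hr x).2 hx)) x₀)
    exact (ENNReal.ofReal_le_ofReal_iff (hv x₀)).1 h1
  · obtain ⟨R₁, hR₁, hh⟩ := h.ellipticHarnack
    refine ⟨R₁, hR₁, fun R hR f hf hharm => (hh R hR f hf hharm).trans ?_⟩
    refine mul_le_mul_of_nonneg_right (le_max_left _ _) (Real.sInf_nonneg ?_)
    rintro _ ⟨x, hx, rfl⟩
    exact (hf x (Or.inl (ball_mono (by linarith) hx))).le

end

/-! ### Heat kernel bounds on large domains -/

section

universe u

section scales

variable {G : Type u} {W : WeightedGraph G} {hW : W.Regular} {s : WalkSpeed} {d : ℝ}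
  {k : Constants} {x₀ : G} {D : ℝ → Finset G}

/-- The on-diagonal upper bound holds from any fixed multiple of the diffusive time on. -/
theorem Scales.eventually_upper (H : Scales hW s d k x₀ D) {a : ℝ} (ha : 0 < a) :
    ∀ᶠ r in atTop, ∀ t, a * r ^ 2 ≤ t → ∀ A : Finset G,
      (∀ y ∈ A, y ∈ W.ball x₀ (k.spread * r)) → ∀ x ∈ A, ∀ y ∈ A,
        hW.killed s A t x y ≤ k.c₁ * t ^ (-d / 2) := by
  obtain ⟨T₀, hT⟩ := H.upper
  have hδ := k.δ_pos
  have h1 : Tendsto (fun r : ℝ => a * r ^ 2) atTop atTop :=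
    (tendsto_pow_atTop two_ne_zero).const_mul_atTop ha
  have h2 : Tendsto (fun r : ℝ => a ^ ((1 + k.δ) / 2) * r ^ k.δ) atTop atTop :=
    (tendsto_rpow_atTop k.δ_pos).const_mul_atTop (by positivity)
  filter_upwards [h1.eventually_ge_atTop T₀, h2.eventually_ge_atTop k.spread,
    eventually_gt_atTop 0] with r hr1 hr2 hr t ht A hA
  refine hT t (hr1.trans ht) A fun y hy => ball_mono ?_ (hA y hy)
  calc k.spread * r ≤ a ^ ((1 + k.δ) / 2) * r ^ k.δ * r := mul_le_mul_of_nonneg_right hr2 hr.le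
    _ = (a * r ^ 2) ^ ((1 + k.δ) / 2) := by
        rw [Real.mul_rpow ha.le (by positivity), ← Real.rpow_natCast r 2, ← Real.rpow_mul hr.le,
          mul_assoc]
        congr 1
        nth_rewrite 2 [← Real.rpow_one r]
        rw [← Real.rpow_add hr]
        congr 1
        push_cast; ring
    _ ≤ t ^ ((1 + k.δ) / 2) := Real.rpow_le_rpow (by positivity) ht (by positivity)

theorem mul_sq_rpow {a r : ℝ} (ha : 0 ≤ a) (hr : 0 ≤ r) (d : ℝ) :
    (a * r ^ 2) ^ (-d / 2) = a ^ (-d / 2) * r ^ (-d) := by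
  rw [Real.mul_rpow ha (by positivity), ← Real.rpow_natCast r 2, ← Real.rpow_mul hr]
  congr 2
  push_cast; ring

/-- The on-diagonal upper bound in scale-invariant form. -/
theorem Scales.eventually_upper' (H : Scales hW s d k x₀ D) (hd : 0 < d) {a : ℝ} (ha : 0 < a) :
    ∀ᶠ r in atTop, ∀ t, a * r ^ 2 ≤ t → ∀ A : Finset G,
      (∀ y ∈ A, y ∈ W.ball x₀ (k.spread * r)) → ∀ x ∈ A, ∀ y ∈ A,
        hW.killed s A t x y ≤ k.c₁ * a ^ (-d / 2) * r ^ (-d) := by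
  filter_upwards [H.eventually_upper ha, eventually_gt_atTop 0] with r h hr t ht A hA x hx y hy
  refine (h t ht A hA x hx y hy).trans ?_
  rw [mul_assoc, ← mul_sq_rpow ha.le hr.le]
  refine mul_le_mul_of_nonneg_left ?_ k.c₁_pos.le
  exact Real.rpow_le_rpow_of_nonpos (by positivity) ht (by linarith)

theorem Scales.eventually_volume_le (H : Scales hW s d k x₀ D) {b : ℝ} (hb : 0 < b) :
    ∀ᶠ r in atTop, ∀ A : Finset G, (∀ y ∈ A, y ∈ W.ball x₀ (b * r)) →
      ∑ y ∈ A, W.theta s y ≤ k.c₄ * b ^ d * r ^ d := by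
  have h1 : Tendsto (fun r : ℝ => b * r) atTop atTop := tendsto_id.const_mul_atTop hb
  filter_upwards [h1.eventually H.volume_le, eventually_gt_atTop 0] with r h hr A hA
  refine (h A hA).trans_eq ?_
  rw [Real.mul_rpow hb.le hr.le]; ring

theorem Scales.eventually_le_volume (H : Scales hW s d k x₀ D) {b : ℝ} (hb : 0 < b) :
    ∀ᶠ r in atTop, ∀ A : Finset G, (∀ y ∈ W.ball x₀ (b * r), y ∈ A) →
      k.c₃ * b ^ d * r ^ d ≤ ∑ y ∈ A, W.theta s y := by
  have h1 : Tendsto (fun r : ℝ => b * r) atTop atTop := tendsto_id.const_mul_atTop hb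
  filter_upwards [h1.eventually H.le_volume, eventually_gt_atTop 0] with r h hr A hA
  refine Eq.trans_le ?_ (h A hA)
  rw [Real.mul_rpow hb.le hr.le]; ring

/-- A time factor `K` for which the heat kernel bound, multiplied by the volume, is one half. -/
theorem exists_rpow_small {d : ℝ} (hd : 0 < d) {c : ℝ} (hc : 0 < c) :
    ∃ K : ℝ, 0 < K ∧ c * K ^ (-d / 2) = 1 / 2 := by
  refine ⟨(2 * c) ^ (2 / d), by positivity, ?_⟩
  rw [← Real.rpow_mul (by positivity), show 2 / d * (-d / 2) = -1 by field_simp,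
    Real.rpow_neg_one]
  field_simp

/-- In a domain inside a ball of radius `b r`, the walk is killed with probability at least one
half by a fixed multiple of the diffusive time. -/
theorem Scales.eventually_flow_le_half (H : Scales hW s d k x₀ D) (hd : 0 < d) {b K : ℝ}
    (hb : 0 < b) (hbs : b ≤ k.spread) (hK : 0 < K)
    (hKV : k.c₁ * (k.c₄ * b ^ d) * K ^ (-d / 2) ≤ 1 / 2) :
    ∀ᶠ r in atTop, ∀ A : Finset G, (∀ y ∈ A, y ∈ W.ball x₀ (b * r)) →
      ∀ x ∈ A, hW.flow s A (K * r ^ 2) (fun _ => 1) x ≤ 1 / 2 := by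
  filter_upwards [H.eventually_upper' hd hK, H.eventually_volume_le hb, eventually_gt_atTop 0]
    with r h1 h2 hr A hA
  have hc₁ := k.c₁_pos
  refine hW.flow_one_le_half (h1 _ le_rfl A fun y hy => ball_mono
    (mul_le_mul_of_nonneg_right hbs hr.le) (hA y hy)) ?_
  calc _ ≤ k.c₁ * K ^ (-d / 2) * r ^ (-d) * (k.c₄ * b ^ d * r ^ d) :=
        mul_le_mul_of_nonneg_left (h2 A hA) (by positivity)
    _ = k.c₁ * (k.c₄ * b ^ d) * K ^ (-d / 2) * (r ^ (-d) * r ^ d) := by ring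
    _ = k.c₁ * (k.c₄ * b ^ d) * K ^ (-d / 2) := by
        rw [← Real.rpow_add hr]; simp
    _ ≤ _ := hKV

/-- The Cauchy-Schwarz lower bound for the on-diagonal heat kernel by the survival probability. -/
theorem Regular.flow_one_sq_le (hW : W.Regular) (A : Finset G) (t : ℝ) (x : G) :
    hW.flow s A t (fun _ => 1) x ^ 2 ≤ hW.killed s A (2 * t) x x * ∑ y ∈ A, W.theta s y := by
  have h := Finset.sum_mul_sq_le_sq_mul_sq A
    (fun y => hW.killed s A t x y * Real.sqrt (W.theta s y)) fun y => Real.sqrt (W.theta s y)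
  have hs : ∀ y, Real.sqrt (W.theta s y) ^ 2 = W.theta s y :=
    fun y => Real.sq_sqrt (hW.theta_pos s y).le
  simp only [mul_pow, hs, mul_assoc, ← pow_two] at h
  rw [hW.sum_killed_sq] at h
  simpa only [Regular.flow, mul_one] using h

end scales

/-- The on-diagonal lower bound at the centre, up to a multiple of the diffusive time. -/
theorem exists_diag_lower {d : ℝ} (hd : 0 < d) (k : Constants) :
    ∃ c : ℝ, 0 < c ∧ ∀ {G : Type u} {W : WeightedGraph G} {hW : W.Regular} {s : WalkSpeed} {x₀ : G}
      {D : ℝ → Finset G}, Scales hW s d k x₀ D → ∀ᶠ r in atTop, ∀ t, t ≤ k.c₂ * r ^ 2 →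
        c * r ^ (-d) ≤ hW.killed s (D r) t x₀ x₀ := by
  have hsp := k.spread_pos
  have hc₁ := k.c₁_pos
  have hc₂ := k.c₂_pos
  have hc₄ := k.c₄_pos
  set V := k.c₄ * k.spread ^ d with hV
  have hV0 : 0 < V := by positivity
  obtain ⟨K, hK, hKe⟩ := exists_rpow_small hd (show 0 < k.c₁ * V by positivity)
  refine ⟨(k.c₂ / (4 * K)) ^ 2 / V, by positivity, fun {G W hW s x₀ D} H => ?_⟩
  filter_upwards [H.eventually_flow_le_half hd hsp le_rfl hK hKe.le,
    H.eventually_volume_le hsp, H.subset_ball, H.ball_subset, H.torsion, eventually_gt_atTop 0]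
    with r hhalf hvol hsub hball htor hr t ht
  replace hhalf := hhalf (D r) hsub
  replace hvol := hvol (D r) hsub
  have hx₀ : x₀ ∈ D r := hball x₀ (mem_ball_self hr)
  have hT : 0 ≤ K * r ^ 2 := by positivity
  obtain ⟨v, hv0, hvL⟩ := hW.exists_poisson hT hhalf (fun _ => -1)
  have hvn := hW.nonneg_of_laplacian_nonpos hT hhalf hv0 fun y hy => by rw [hvL y hy]; norm_num
  have hvle := hW.le_of_laplacian_ge hT hhalf hv0 zero_le_one fun y hy => by rw [hvL y hy]
  have hv := htor v hvn hvL
  -- At this time the torsion bound forces a survival probability of at least `c₂ / (4K)`.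
  set σ := k.c₂ * r ^ 2 / 2 with hσ
  have hσ0 : 0 ≤ σ := by positivity
  set S := hW.flow s (D r) σ (fun _ => 1) x₀ with hS
  have h1 := hW.flow_sub_le (s := s) (A := D r) (f := fun x => -1 * v x)
    (fun y hy => by rw [hv0 y hy, mul_zero]) zero_le_one
    (fun y hy => by rw [hW.laplacian_const_mul, hvL y hy]; norm_num) hσ0 hx₀
  have h2 := (abs_le.1 (hW.abs_flow_le s (D r) hσ0 (f := fun x => -1 * v x)
    (B := 2 * (K * r ^ 2) * 1) (fun y _ => by
      rw [neg_one_mul, abs_neg, abs_of_nonneg (hvn y)]; exact hvle y) x₀)).1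
  have hSle : k.c₂ / (4 * K) ≤ S := by
    rw [div_le_iff₀ (by positivity)]
    have h4 : (k.c₂ / 2 - 2 * K * S) * r ^ 2 ≤ 0 := by
      simp only [← hS] at h2
      nlinarith
    have h5 : k.c₂ / 2 - 2 * K * S ≤ 0 := by
      by_contra hcon
      have : 0 < (k.c₂ / 2 - 2 * K * S) * r ^ 2 := mul_pos (not_le.1 hcon) (by positivity)
      linarith
    linarith
  have h6 := hW.flow_one_sq_le (s := s) (D r) σ x₀
  have hanti := hW.killed_self_antitone s (D r) x₀ (show t ≤ 2 * σ by rw [hσ]; linarith)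
  refine le_trans ?_ hanti
  have h7 : (k.c₂ / (4 * K)) ^ 2 ≤ hW.killed s (D r) (2 * σ) x₀ x₀ * (V * r ^ d) := by
    refine le_trans (pow_le_pow_left₀ (by positivity) hSle 2) (h6.trans ?_)
    exact mul_le_mul_of_nonneg_left hvol (hW.killed_nonneg s _ (by linarith) _ _)
  rw [Real.rpow_neg hr.le, ← div_eq_mul_inv, div_div, div_le_iff₀ (by positivity)]
  exact h7

/-- Hölder-type continuity of the heat kernel near the centre, in qualitative form: it is
approximately harmonic on a small ball, up to a time derivative of order `t⁻¹`, and the elliptic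
Harnack inequality makes oscillations decay. -/
theorem exists_killed_osc_le {d : ℝ} (hd : 0 < d) (k : Constants) {a ε : ℝ} (ha : 0 < a)
    (hε : 0 < ε) :
    ∃ η : ℝ, 0 < η ∧ η ≤ 1 ∧ ∀ {G : Type u} {W : WeightedGraph G} {hW : W.Regular} {s : WalkSpeed}
      {x₀ : G} {D : ℝ → Finset G}, Scales hW s d k x₀ D → ∀ᶠ r in atTop, ∀ t, a * r ^ 2 ≤ t →
        ∀ y ∈ D r, ∀ x ∈ W.ball x₀ (η * r), ∀ x' ∈ W.ball x₀ (η * r),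
          hW.killed s (D r) t x y - hW.killed s (D r) t x' y ≤ ε * r ^ (-d) := by
  have hsp := k.spread_pos
  have hc₁ := k.c₁_pos
  have hc₄ := k.c₄_pos
  obtain ⟨K, hK, hKe⟩ := exists_rpow_small hd (show 0 < k.c₁ * k.c₄ by positivity)
  set C := max k.CE 1 with hC
  have hC1 : 1 ≤ C := le_max_right _ _
  set γ := (C - 1) / (C + 1) with hγ
  have hγ0 : 0 ≤ γ := div_nonneg (by linarith) (by linarith)
  have hγ1 : γ < 1 := by rw [hγ, div_lt_one (by linarith)]; linarith
  set S := k.c₁ * a ^ (-d / 2) with hS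
  set Q := 2 / a * (k.c₁ * (a / 2) ^ (-d / 2)) with hQ
  have hS0 : 0 < S := by positivity
  have hQ0 : 0 < Q := by positivity
  -- `2 (2 K β² Q) ≤ ε / 2` makes the error from the time derivative small.
  obtain ⟨β, hβ0, hβ1, hβ⟩ : ∃ β : ℝ, 0 < β ∧ β ≤ 1 ∧ 4 * K * Q * β ^ 2 ≤ ε / 2 := by
    refine ⟨min 1 (ε / (8 * K * Q)), by positivity, min_le_left _ _, ?_⟩
    set β := min 1 (ε / (8 * K * Q)) with hβ
    have h1 : β ≤ 1 := min_le_left _ _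
    have h2 : β ≤ ε / (8 * K * Q) := min_le_right _ _
    have h0 : 0 ≤ β := by positivity
    rw [le_div_iff₀ (by positivity)] at h2
    nlinarith [mul_nonneg h0 (sub_nonneg.2 h1), mul_pos hK hQ0]
  obtain ⟨n, hn⟩ := exists_pow_lt_of_lt_one
    (show 0 < ε / 2 / (2 * (S + 2 * K * Q)) by positivity) hγ1
  refine ⟨β / 4 ^ n, by positivity, ?_, fun {G W hW s x₀ D} H => ?_⟩
  · exact (div_le_self hβ0.le (one_le_pow₀ (by norm_num))).trans hβ1
  obtain ⟨R₁, hR₁, hharn⟩ := H.harnack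
  have hlin : Tendsto (fun r : ℝ => β * r) atTop atTop := tendsto_id.const_mul_atTop hβ0
  have hKβ : k.c₁ * (k.c₄ * β ^ d) * (K * β ^ 2) ^ (-d / 2) ≤ 1 / 2 := by
    rw [mul_sq_rpow hK.le hβ0.le, ← hKe]
    have : β ^ d * β ^ (-d) = 1 := by rw [← Real.rpow_add hβ0]; simp
    apply le_of_eq
    calc _ = k.c₁ * k.c₄ * K ^ (-d / 2) * (β ^ d * β ^ (-d)) := by ring
      _ = _ := by rw [this, mul_one]
  filter_upwards [H.eventually_flow_le_half hd hβ0 (hβ1.trans k.one_le_spread)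
    (show 0 < K * β ^ 2 by positivity) hKβ, H.eventually_upper' hd ha,
    H.eventually_upper' hd (half_pos ha), H.subset_ball, H.ball_subset,
    hlin.eventually_ge_atTop (2 * R₁ * 4 ^ n), eventually_gt_atTop 0]
    with r hhalf hu hu2 hsub hball hn' hr t ht y hy x hx x' hx'
  have ht0 : 0 < t := lt_of_lt_of_le (by positivity) ht
  have hfin := ball_finite H.conn hW.locFin x₀ (β * r)
  have hbD : ∀ z ∈ W.ball x₀ (β * r), z ∈ D r := fun z hz =>
    hball z (ball_mono (by nlinarith) hz)
  have hB : ∀ z ∈ W.ball x₀ (β * r),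
      |W.laplacian s (fun z => hW.killed s (D r) t z y) z| ≤ Q / r ^ 2 * r ^ (-d) := by
    intro z hz
    have h1 : ∀ z ∈ D r, hW.killed s (D r) (t / 2) z z ≤
        k.c₁ * (a / 2) ^ (-d / 2) * r ^ (-d) := fun z hz =>
      hu2 (t / 2) (by linarith) (D r) hsub z hz z hz
    refine (hW.abs_laplacian_killed_le s (D r) ht0 y (hbD z hz) (h1 z (hbD z hz)) (h1 y hy)).trans ?_
    calc _ ≤ 2 / (a * r ^ 2) * (k.c₁ * (a / 2) ^ (-d / 2) * r ^ (-d)) := by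
          refine mul_le_mul_of_nonneg_right ?_ (by positivity)
          exact div_le_div_of_nonneg_left zero_le_two (by positivity) ht
      _ = _ := by rw [hQ]; field_simp
  have hosc := hW.osc_of_laplacian H.conn hC1 hR₁ hharn (A := hfin.toFinset)
    (fun z => hfin.mem_toFinset) (t := K * β ^ 2 * r ^ 2) (by positivity)
    (hhalf _ fun z hz => hfin.mem_toFinset.1 hz)
    (w := fun z => hW.killed s (D r) t z y) (S := S * r ^ (-d)) (B := Q / r ^ 2 * r ^ (-d))
    (by positivity) (fun z hz => by
      rw [abs_of_nonneg (hW.killed_nonneg s _ ht0.le _ _)]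
      exact hu t ht (D r) hsub z (hbD z hz) y hy) hB n hn'
  have hr' : β * r / 4 ^ n = β / 4 ^ n * r := by ring
  rw [hr'] at hosc
  refine (hosc x hx x' hx').trans ?_
  have hB' : 2 * (K * β ^ 2 * r ^ 2) * (Q / r ^ 2 * r ^ (-d)) = 2 * K * Q * β ^ 2 * r ^ (-d) := by
    field_simp
  rw [hB']
  have hrd : 0 < r ^ (-d) := by positivity
  have h1 : γ ^ n * (2 * (S + 2 * K * Q)) ≤ ε / 2 := by
    rw [lt_div_iff₀ (by positivity)] at hn; exact hn.le
  have h2 : γ ^ n * (2 * (S + 2 * K * Q * β ^ 2)) ≤ γ ^ n * (2 * (S + 2 * K * Q)) := by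
    refine mul_le_mul_of_nonneg_left ?_ (by positivity)
    have : β ^ 2 ≤ 1 := pow_le_one₀ hβ0.le hβ1
    nlinarith [mul_pos hK hQ0]
  calc _ = (γ ^ n * (2 * (S + 2 * K * Q * β ^ 2)) + 4 * K * Q * β ^ 2) * r ^ (-d) := by ring
    _ ≤ ε * r ^ (-d) := mul_le_mul_of_nonneg_right (by linarith) hrd.le

/-- The near-diagonal lower bound. -/
theorem exists_near_diag_lower {d : ℝ} (hd : 0 < d) (k : Constants) {a : ℝ} (ha : 0 < a) :
    ∃ c : ℝ, 0 < c ∧ ∃ η : ℝ, 0 < η ∧ η ≤ 1 ∧ ∀ {G : Type u} {W : WeightedGraph G} {hW : W.Regular}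
      {s : WalkSpeed} {x₀ : G} {D : ℝ → Finset G}, Scales hW s d k x₀ D → ∀ᶠ r in atTop, ∀ t,
        a * r ^ 2 ≤ t → t ≤ k.c₂ * r ^ 2 → ∀ x ∈ W.ball x₀ (η * r), ∀ y ∈ W.ball x₀ (η * r),
          c * r ^ (-d) ≤ hW.killed s (D r) t x y := by
  obtain ⟨c, hc, hdiag⟩ := exists_diag_lower.{u} hd k
  obtain ⟨η, hη0, hη1, hosc⟩ := exists_killed_osc_le.{u} hd k ha (show 0 < c / 4 by positivity)
  refine ⟨c / 2, by positivity, η, hη0, hη1, fun {G W hW s x₀ D} H => ?_⟩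
  filter_upwards [hdiag H, hosc H, H.ball_subset, eventually_gt_atTop 0]
    with r h1 h2 hball hr t hat htc x hx y hy
  have hx₀ : x₀ ∈ W.ball x₀ (η * r) := mem_ball_self (by positivity)
  have hbD : ∀ z ∈ W.ball x₀ (η * r), z ∈ D r := fun z hz =>
    hball z (ball_mono (by nlinarith) hz)
  have e1 := h1 t htc
  have e2 := h2 t hat x₀ (hbD _ hx₀) x₀ hx₀ x hx
  have e3 := h2 t hat x (hbD _ hx) x₀ hx₀ y hy
  rw [hW.killed_comm s _ t x₀ x, hW.killed_comm s _ t y x] at e3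
  linarith

end

section

universe u

/-- Chaining of two lower bounds through a set of intermediate points. -/
theorem Regular.mul_sum_theta_le_killed_add {G : Type*} {W : WeightedGraph G} (hW : W.Regular)
    {s : WalkSpeed} {D B : Finset G}
    (hB : B ⊆ D) {t r α β : ℝ} (ht : 0 ≤ t) (hr : 0 ≤ r) (hα : 0 ≤ α) {x y : G}
    (h1 : ∀ z ∈ B, α ≤ hW.killed s D t x z) (h2 : ∀ z ∈ B, β ≤ hW.killed s D r z y) :
    α * β * ∑ z ∈ B, W.theta s z ≤ hW.killed s D (t + r) x y := by
  rw [← hW.killed_add s D t r x y, Finset.mul_sum]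
  refine le_trans (Finset.sum_le_sum fun z hz => ?_) (Finset.sum_le_sum_of_subset_of_nonneg hB
    fun z _ _ => mul_nonneg (mul_nonneg (hW.killed_nonneg s D ht x z)
      (hW.killed_nonneg s D hr z y)) (hW.theta_pos s z).le)
  refine mul_le_mul_of_nonneg_right ?_ (hW.theta_pos s z).le
  exact (mul_le_mul_of_nonneg_left (h2 z hz) hα).trans
    (mul_le_mul_of_nonneg_right (h1 z hz) (hW.killed_nonneg s D hr z y))

/-- From every point of a ball of radius proportional to `r`, the heat kernel to the centre is of
full order at some time in a prescribed short time window. The near-diagonal bound gives this at a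
later time; the kernel is a sum of exponentials, so it cannot vanish to high order before. -/
theorem exists_early_lower {d : ℝ} (hd : 0 < d) (k : Constants) :
    ∃ l : ℝ, 0 < l ∧ l ≤ 1 / 4 ∧ 4 * l ^ 2 ≤ k.c₂ ∧ ∃ c : ℝ, 0 < c ∧
      ∀ {G : Type u} {W : WeightedGraph G} {hW : W.Regular}
      {s : WalkSpeed} {x₀ : G} {D : ℝ → Finset G}, Scales hW s d k x₀ D → ∀ᶠ r in atTop,
        ∀ x ∈ W.ball x₀ (3 * (l * r)), ∃ t, (l * r) ^ 2 / 16 ≤ t ∧ t ≤ (l * r) ^ 2 / 8 ∧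
          c * r ^ (-d) ≤ hW.killed s (D r) t x x₀ := by
  have hc₁ := k.c₁_pos
  have hc₂ := k.c₂_pos
  obtain ⟨c, hc, η, hη0, hη1, hnear⟩ := exists_near_diag_lower.{u} hd k hc₂
  obtain ⟨l, hl0, hl1, hlη, hlc⟩ : ∃ l : ℝ, 0 < l ∧ l ≤ 1 / 4 ∧ 3 * l ≤ η ∧ 4 * l ^ 2 ≤ k.c₂ := by
    refine ⟨min (1 / 4) (min (η / 3) k.c₂), by positivity, min_le_left _ _, ?_, ?_⟩
    · have : min (1 / 4) (min (η / 3) k.c₂) ≤ η / 3 := (min_le_right _ _).trans (min_le_left _ _)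
      linarith
    · set l := min (1 / 4) (min (η / 3) k.c₂) with hl
      have h1 : l ≤ k.c₂ := (min_le_right _ _).trans (min_le_right _ _)
      have h2 : l ≤ 1 / 4 := min_le_left _ _
      have h0 : 0 ≤ l := by positivity
      nlinarith
  set A := k.c₁ * (l ^ 2 / 16) ^ (-d / 2) with hA
  have hA0 : 0 < A := by positivity
  obtain ⟨c', hc', hearly⟩ := exists_earlier.{u} hA0 hc
    (show 0 < l ^ 2 / 16 / k.c₂ by positivity)
  refine ⟨l, hl0, hl1, hlc, c', hc', fun {G W hW s x₀ D} H => ?_⟩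
  filter_upwards [hnear H, H.eventually_upper' hd (show 0 < l ^ 2 / 16 by positivity),
    H.subset_ball, H.ball_subset, eventually_gt_atTop 0] with r hn hu hsub hball hr x hx
  have hrd : 0 < r ^ (-d) := by positivity
  have hrd' : 0 < r ^ d := by positivity
  have hrr : r ^ d * r ^ (-d) = 1 := by rw [← Real.rpow_add hr]; simp
  have hx₀ : x₀ ∈ W.ball x₀ (η * r) := mem_ball_self (by positivity)
  have hxη : x ∈ W.ball x₀ (η * r) := ball_mono (by nlinarith) hx
  have hbD : ∀ z ∈ W.ball x₀ (η * r), z ∈ D r := fun z hz =>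
    hball z (ball_mono (by nlinarith) hz)
  -- The shift by `σ` makes the coefficients of the sum of exponentials absolutely summable.
  set σ := l ^ 2 / 16 * r ^ 2 with hσ
  have hσ0 : 0 < σ := by positivity
  set lam := hW.eigenvalue s (D r) with hlam
  set φ := hW.eigenfunction s (D r) with hφ
  set a : D r → ℝ := fun i => r ^ d * (Real.exp (-lam i * σ) * φ i x * φ i x₀) with ha
  have hsum : ∀ t, ∑ i, a i * Real.exp (-lam i * t) =
      r ^ d * hW.killed s (D r) (σ + t) x x₀ := by
    intro t
    unfold Regular.killed
    rw [Finset.mul_sum]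
    refine Finset.sum_congr rfl fun i _ => ?_
    rw [mul_add, Real.exp_add]
    simp only [ha]; ring
  have habs : ∑ i, |a i| ≤ A := by
    have h1 := hW.sum_abs_killed_le s (D r) σ x x₀
    have h2 := hu σ le_rfl (D r) hsub x (hbD x hxη) x (hbD x hxη)
    have h3 := hu σ le_rfl (D r) hsub x₀ (hbD _ hx₀) x₀ (hbD _ hx₀)
    calc ∑ i, |a i| = r ^ d * ∑ i, Real.exp (-lam i * σ) * |φ i x * φ i x₀| := by
          rw [Finset.mul_sum]
          refine Finset.sum_congr rfl fun i _ => ?_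
          simp only [ha]
          rw [abs_mul, abs_of_pos hrd', mul_assoc, abs_mul, abs_of_pos (Real.exp_pos _)]
      _ ≤ r ^ d * (A * r ^ (-d)) := mul_le_mul_of_nonneg_left (by linarith) hrd'.le
      _ = A * (r ^ d * r ^ (-d)) := by ring
      _ = A := by rw [hrr, mul_one]
  have ht : 0 < k.c₂ * r ^ 2 - σ := by
    rw [hσ]; nlinarith [mul_pos hc₂ (pow_pos hr 2), pow_pos hl0 2, pow_pos hr 2]
  obtain ⟨τ, hτ0, hτ1, hτ⟩ := hearly a lam (hW.eigenvalue_nonneg s (D r)) habs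
    (fun t ht => by
      rw [hsum]
      exact mul_nonneg hrd'.le (hW.killed_nonneg s _ (by linarith) _ _))
    (k.c₂ * r ^ 2 - σ) ht (by
      rw [hsum, add_sub_cancel]
      have h1 := hn (k.c₂ * r ^ 2) le_rfl le_rfl x hxη x₀ hx₀
      calc c = c * (r ^ d * r ^ (-d)) := by rw [hrr, mul_one]
        _ = r ^ d * (c * r ^ (-d)) := by ring
        _ ≤ _ := mul_le_mul_of_nonneg_left h1 hrd'.le)
  have hτ' : τ ≤ σ := by
    refine hτ1.trans ?_
    calc l ^ 2 / 16 / k.c₂ * (k.c₂ * r ^ 2 - σ) ≤ l ^ 2 / 16 / k.c₂ * (k.c₂ * r ^ 2) :=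
          mul_le_mul_of_nonneg_left (by linarith) (by positivity)
      _ = σ := by rw [hσ]; field_simp
  refine ⟨σ + τ, ?_, ?_, ?_⟩
  · rw [mul_pow]; linarith
  · rw [mul_pow]; linarith
  · rw [hsum] at hτ
    calc c' * r ^ (-d) ≤ r ^ d * hW.killed s (D r) (σ + τ) x x₀ * r ^ (-d) :=
          mul_le_mul_of_nonneg_right hτ hrd.le
      _ = r ^ d * r ^ (-d) * hW.killed s (D r) (σ + τ) x x₀ := by ring
      _ = _ := by rw [hrr, one_mul]

/-- The full lower bound: by chaining through a small ball around the centre, the heat kernel is of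
full order between any two points of a ball, at all times comparable with its squared radius. -/
theorem exists_killed_lower {d : ℝ} (hd : 0 < d) (k : Constants) :
    ∃ l : ℝ, 0 < l ∧ l ≤ 1 / 4 ∧ ∃ c : ℝ, 0 < c ∧
      ∀ {G : Type u} {W : WeightedGraph G} {hW : W.Regular}
      {s : WalkSpeed} {x₀ : G} {D : ℝ → Finset G}, Scales hW s d k x₀ D → ∀ᶠ r in atTop,
        ∀ x ∈ W.ball x₀ (3 * (l * r)), ∀ y ∈ W.ball x₀ (3 * (l * r)), ∀ t, (l * r) ^ 2 ≤ t →
          t ≤ 4 * (l * r) ^ 2 → c * r ^ (-d) ≤ hW.killed s (D r) t x y := by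
  have hc₂ := k.c₂_pos
  have hc₃ := k.c₃_pos
  obtain ⟨l, hl0, hl1, hlc, c, hc, hearly⟩ := exists_early_lower.{u} hd k
  obtain ⟨c', hc', η, hη0, hη1, hnear⟩ := exists_near_diag_lower.{u} hd k
    (show 0 < l ^ 2 / 8 by positivity)
  obtain ⟨η', hη'0, hη'1, hosc⟩ := exists_killed_osc_le.{u} hd k
    (show 0 < l ^ 2 / 16 by positivity) (half_pos hc)
  set e := min η η' with he
  have he0 : 0 < e := lt_min hη0 hη'0
  have he1 : e ≤ 1 := (min_le_left _ _).trans hη1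
  set v := k.c₃ * e ^ d with hv
  have hv0 : 0 < v := by positivity
  refine ⟨l, hl0, hl1, c / 2 * c' * v * (c / 2) * v, by positivity, fun {G W hW s x₀ D} H => ?_⟩
  filter_upwards [hearly H, hnear H, hosc H, H.eventually_le_volume he0, H.ball_subset,
    eventually_gt_atTop 0] with r h1 h2 h3 hvol hball hr x hx y hy t ht1 ht2
  have hrd : 0 < r ^ (-d) := by positivity
  have hrr : r ^ (-d) * r ^ d = 1 := by rw [← Real.rpow_add hr]; simp
  have hlr : 0 < l * r := by positivity
  have hfin := ball_finite H.conn hW.locFin x₀ (e * r)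
  set B := hfin.toFinset with hB
  have hBmem : ∀ z ∈ B, z ∈ W.ball x₀ (e * r) := fun z hz => hfin.mem_toFinset.1 hz
  have hBη : ∀ z ∈ B, z ∈ W.ball x₀ (η * r) := fun z hz =>
    ball_mono (mul_le_mul_of_nonneg_right (min_le_left _ _) hr.le) (hBmem z hz)
  have hBη' : ∀ z ∈ B, z ∈ W.ball x₀ (η' * r) := fun z hz =>
    ball_mono (mul_le_mul_of_nonneg_right (min_le_right _ _) hr.le) (hBmem z hz)
  have hBD : B ⊆ D r := fun z hz => hball z (ball_mono (by nlinarith) (hBmem z hz))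
  have hv' := hvol B fun z hz => hfin.mem_toFinset.2 hz
  have hbD : ∀ z ∈ W.ball x₀ (3 * (l * r)), z ∈ D r := fun z hz =>
    hball z (ball_mono (by nlinarith) hz)
  have hstep : ∀ z ∈ W.ball x₀ (3 * (l * r)), ∃ τ, (l * r) ^ 2 / 16 ≤ τ ∧ τ ≤ (l * r) ^ 2 / 8 ∧
      ∀ b ∈ B, c / 2 * r ^ (-d) ≤ hW.killed s (D r) τ b z := by
    intro z hz
    obtain ⟨τ, hτ1, hτ2, hτ⟩ := h1 z hz
    refine ⟨τ, hτ1, hτ2, fun b hb => ?_⟩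
    have h4 := h3 τ (by rw [mul_pow] at hτ1; linarith) z (hbD z hz) x₀
      (mem_ball_self (by positivity)) b (hBη' b hb)
    rw [hW.killed_comm] at hτ
    linarith
  obtain ⟨τ, hτ1, hτ2, hτ⟩ := hstep x hx
  obtain ⟨σ, hσ1, hσ2, hσ⟩ := hstep y hy
  have hpos : 0 < (l * r) ^ 2 := by positivity
  have hlc' : 4 * (l * r) ^ 2 ≤ k.c₂ * r ^ 2 := by
    rw [mul_pow, ← mul_assoc]; exact mul_le_mul_of_nonneg_right hlc (by positivity)
  have hmid : ∀ b ∈ B, c / 2 * c' * v * r ^ (-d) ≤ hW.killed s (D r) (τ + (t - σ - τ)) x b := by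
    intro b hb
    have h4 := hW.mul_sum_theta_le_killed_add (s := s) (t := τ) (r := t - σ - τ) hBD
      (by linarith) (by linarith) (α := c / 2 * r ^ (-d)) (β := c' * r ^ (-d))
      (by positivity) (x := x) (y := b)
      (fun z hz => by rw [hW.killed_comm]; exact hτ z hz)
      (fun z hz => h2 _ (by rw [mul_pow] at *; linarith) (by linarith) z (hBη z hz) b (hBη b hb))
    refine le_trans ?_ h4
    calc _ = c / 2 * c' * v * r ^ (-d) * (r ^ (-d) * r ^ d) := by rw [hrr, mul_one]
      _ = c / 2 * r ^ (-d) * (c' * r ^ (-d)) * (k.c₃ * e ^ d * r ^ d) := by rw [hv]; ring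
      _ ≤ _ := mul_le_mul_of_nonneg_left hv' (by positivity)
  have h5 := hW.mul_sum_theta_le_killed_add (s := s) (t := τ + (t - σ - τ)) (r := σ) hBD
    (by linarith) (by linarith) (by positivity) (x := x) (y := y) hmid hσ
  rw [show τ + (t - σ - τ) + σ = t by ring] at h5
  refine le_trans ?_ h5
  calc _ = c / 2 * c' * v * (c / 2) * v * r ^ (-d) * (r ^ (-d) * r ^ d) := by rw [hrr, mul_one]
    _ = c / 2 * c' * v * r ^ (-d) * (c / 2 * r ^ (-d)) * (k.c₃ * e ^ d * r ^ d) := by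
        rw [hv]; ring
    _ ≤ _ := mul_le_mul_of_nonneg_left hv' (by positivity)

end

/-! ### Off-diagonal bounds at the diffusive scale -/

section

universe u

section metric

variable {G : Type*} {W : WeightedGraph G}

theorem dTilde_le_symm (x y : G) (hc : W.graph.Connected) : W.dTilde x y ≤ W.dTilde y x := by
  have : Nonempty (W.graph.Walk y x) := hc y x
  rw [dTilde_eq y x]
  refine le_ciInf fun p => (dTilde_le_walkLength p.reverse).trans_eq ?_
  unfold walkLength
  rw [SimpleGraph.Walk.darts_reverse, List.map_reverse, List.sum_reverse, List.map_map]
  congr 1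
  refine List.map_congr_left fun e _ => ?_
  exact edgeLength_comm _ _

theorem adaptedTo_dist (hW : W.Regular) (hc : W.graph.Connected) {Γ : ℝ} (hΓ : 1 ≤ Γ) (x : G) :
    W.AdaptedTo .csrw Γ fun y => (W.graph.dist x y : ℝ) := by
  have hlip : ∀ y z, 0 < W.ω y z → |(W.graph.dist x y : ℝ) - W.graph.dist x z| ≤ 1 := by
    intro y z h
    have h1 := dist_le_add_one hc x h
    have h2 := dist_le_add_one hc x (y := z) (z := y) (by rwa [W.symm])
    rw [abs_le]; constructor <;> linarith
  refine ⟨hlip, fun y D => ?_⟩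
  have hw := hW.weight_pos y
  calc _ ≤ ∑ z ∈ D, W.ω y z := Finset.sum_le_sum fun z _ => by
        by_cases h : 0 < W.ω y z
        · have := (sq_le_one_iff_abs_le_one _).2 (hlip y z h)
          nlinarith
        · rw [omega_eq_zero_of_not_pos h, zero_mul]
    _ ≤ W.weight y := hW.sum_le_weight y D
    _ ≤ Γ * W.weight y := by nlinarith

theorem adaptedTo_dTilde (hW : W.Regular) (hc : W.graph.Connected) {M : ℕ} (hM : W.DegreeLE M)
    {Γ : ℝ} (hΓ : (M : ℝ) ≤ Γ) (x : G) : W.AdaptedTo .vsrw Γ (W.dTilde x) := by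
  classical
  refine ⟨fun y z h => (abs_dTilde_sub_le hc x h).trans (edgeLength_le_one y z), fun y D => ?_⟩
  have hcard : ((hW.nbr y).card : ℝ) ≤ M := by
    have h := hM y
    rw [← (hW.locFin y).coe_toFinset, Set.encard_coe_eq_coe_finsetCard] at h
    exact_mod_cast h
  calc _ ≤ ∑ z ∈ D, if z ∈ hW.nbr y then (1 : ℝ) else 0 := Finset.sum_le_sum fun z _ => by
        split_ifs with h
        · have h1 := abs_dTilde_sub_le hc x (hW.mem_nbr.1 h)
          refine le_trans (mul_le_mul_of_nonneg_left ?_ (W.nonneg y z))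
            (omega_mul_edgeLength_sq_le y z)
          rw [← sq_abs]
          exact pow_le_pow_left₀ (abs_nonneg _) h1 2
        · rw [hW.omega_eq_zero h, zero_mul]
    _ = ((D ∩ hW.nbr y).card : ℝ) := by
        rw [Finset.sum_ite_mem, Finset.sum_const, nsmul_eq_mul, mul_one]
    _ ≤ (hW.nbr y).card := by exact_mod_cast Finset.card_le_card Finset.inter_subset_right
    _ ≤ Γ * W.theta .vsrw y := by simp only [theta, mul_one]; linarith

end metric

theorem eventually_exp_neg_rpow_le {a b p : ℝ} (ha : 0 < a) (hb : 0 < b) (hp : 0 < p) (q : ℝ) :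
    ∀ᶠ r : ℝ in atTop, Real.exp (-(a * r ^ p)) ≤ b * r ^ q := by
  have h1 := (isLittleO_exp_neg_mul_rpow_atTop ha (q / p)).def hb
  filter_upwards [(tendsto_rpow_atTop hp).eventually h1, eventually_gt_atTop 0] with r h hr
  rw [Real.norm_of_nonneg (Real.exp_pos _).le, Real.norm_of_nonneg (by positivity),
    ← Real.rpow_mul hr.le, mul_div_cancel₀ q hp.ne', neg_mul] at h
  exact h

/-- A time scale `r ^ γ` that is shorter than diffusive, but long enough for the on-diagonal upper
bound to hold on all of the domain at scale `r`. -/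
theorem Scales.exists_short_time {G : Type u} {W : WeightedGraph G} {hW : W.Regular}
    {s : WalkSpeed} {d : ℝ} {k : Constants} {x₀ : G} {D : ℝ → Finset G}
    (H : Scales hW s d k x₀ D) : ∃ γ : ℝ, 1 < γ ∧ γ < 2 ∧ ∀ᶠ r in atTop, ∀ t ≥ r ^ γ,
      ∀ z ∈ D r, hW.killed s (D r) t z z ≤ k.c₁ * t ^ (-d / 2) := by
  obtain ⟨T₀, hT⟩ := H.upper
  have hδ := k.δ_pos
  -- Any exponent in `(1, 2)` with `γ (1 + δ) / 2 > 1` will do.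
  set e := min k.δ 1 with he
  have he0 : 0 < e := lt_min hδ one_pos
  have he1 : e ≤ 1 := min_le_right _ _
  have heδ : e ≤ k.δ := min_le_left _ _
  set γ := 2 / (1 + e / 2) with hγ
  have hγ1 : 1 < γ := by rw [hγ, lt_div_iff₀ (by positivity)]; linarith
  have hγ2 : γ < 2 := by rw [hγ, div_lt_iff₀ (by positivity)]; linarith
  have hγδ : 1 < γ * ((1 + k.δ) / 2) := by
    rw [hγ, div_mul_eq_mul_div, lt_div_iff₀ (by positivity)]; linarith
  refine ⟨γ, hγ1, hγ2, ?_⟩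
  filter_upwards [(tendsto_rpow_atTop (show 0 < γ by linarith)).eventually_ge_atTop T₀,
    (tendsto_rpow_atTop (sub_pos.2 hγδ)).eventually_ge_atTop k.spread, H.subset_ball,
    eventually_gt_atTop 0] with r h1 h2 hsub hr t ht z hz
  refine hT t (h1.trans ht) (D r) (fun y hy => ball_mono ?_ (hsub y hy)) z hz z hz
  calc k.spread * r ≤ r ^ (γ * ((1 + k.δ) / 2) - 1) * r := mul_le_mul_of_nonneg_right h2 hr.le
    _ = (r ^ γ) ^ ((1 + k.δ) / 2) := by
        rw [← Real.rpow_mul hr.le, Real.rpow_sub_one hr.ne', div_mul_cancel₀ _ hr.ne']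
    _ ≤ t ^ ((1 + k.δ) / 2) := Real.rpow_le_rpow (by positivity) ht (by positivity)

/-- The heat kernel between points at distance of order `r` is at most of order `r ^ (-d)`, at all
times, small ones included. -/
theorem exists_killed_far_le {d : ℝ} (hd : 0 < d) (k : Constants) (M : ℕ) {l : ℝ} (hl : 0 < l) :
    ∃ K : ℝ, 0 < K ∧ ∀ {G : Type u} {W : WeightedGraph G} {hW : W.Regular} {s : WalkSpeed}
      {x₀ : G} {D : ℝ → Finset G}, Scales hW s d k x₀ D → W.DegreeLE M →
      W.LocalRegularity s k x₀ → ∀ᶠ r in atTop, ∀ x ∈ W.ball x₀ (l * r), ∀ y ∈ D r,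
        3 * (l * r) - 1 ≤ W.graph.dist x₀ y → ∀ t, 0 ≤ t → t ≤ 2 * (l * r) ^ 2 →
          hW.killed s (D r) t x y ≤ K * r ^ (-d) := by
  have hc₁ := k.c₁_pos
  have hc₅ := k.c₅_pos
  have hκ := k.κ_pos
  have hsp := k.spread_pos
  set Γ : ℝ := max 1 M with hΓ
  have hΓ1 : 1 ≤ Γ := le_max_left _ _
  have hΓM : (M : ℝ) ≤ Γ := le_max_right _ _
  set e := l * min 1 k.c₅ with he
  have he0 : 0 < e := by positivity
  have hel : e ≤ l := by
    rw [he]; exact mul_le_of_le_one_right hl.le (min_le_left _ _)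
  have hec : e ≤ k.c₅ * l := by
    rw [he, mul_comm]; exact mul_le_mul_of_nonneg_right (min_le_right _ _) hl.le
  obtain ⟨K, hK, hfar⟩ := exists_killed_le_of_far.{u} hd hc₁
    (show 0 < 2 * l ^ 2 / e ^ 2 by positivity) hΓ1
  refine ⟨K * e ^ (-d), by positivity, fun {G W hW s x₀ D} H hM hloc => ?_⟩
  obtain ⟨γ, hγ1, hγ2, hup⟩ := H.exists_short_time
  -- A metric adapted to the walk that is at least `e r` between points at distance `l r`.
  obtain ⟨ρ, hρ1, hρ2, hρ3, hρ⟩ : ∃ ρ : G → G → ℝ, (∀ x, W.AdaptedTo s Γ (ρ x)) ∧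
      (∀ x, ρ x x = 0) ∧ (∀ x y z, ρ x y ≤ ρ x z + ρ y z) ∧
      ∀ᶠ r in atTop, ∀ x ∈ W.ball x₀ (l * r), ∀ y, l * r ≤ W.graph.dist x y → e * r ≤ ρ x y := by
    cases s with
    | csrw =>
      refine ⟨fun x y => W.graph.dist x y, adaptedTo_dist hW H.conn hΓ1, fun x => by simp,
        fun x y z => ?_, ?_⟩
      · change (W.graph.dist x y : ℝ) ≤ W.graph.dist x z + W.graph.dist y z
        rw [W.graph.dist_comm (u := y)]
        exact_mod_cast H.conn.dist_triangle
      · filter_upwards [eventually_gt_atTop 0] with r hr x _ y hxy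
        exact (mul_le_mul_of_nonneg_right hel hr.le).trans hxy
    | vsrw =>
      obtain ⟨R₄, hR₄, hloc⟩ := hloc
      refine ⟨W.dTilde, adaptedTo_dTilde hW H.conn hM hΓM, dTilde_self, fun x y z => ?_, ?_⟩
      · exact (dTilde_triangle H.conn x z y).trans
          (add_le_add le_rfl (dTilde_le_symm z y H.conn))
      · have hlin : Tendsto (fun r : ℝ => l * r) atTop atTop := tendsto_id.const_mul_atTop hl
        filter_upwards [eventually_gt_atTop 0, hlin.eventually_ge_atTop R₄] with r hr hr4 x hx y hxy
        calc e * r ≤ k.c₅ * l * r := mul_le_mul_of_nonneg_right hec hr.le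
          _ = k.c₅ * (l * r) := by ring
          _ ≤ k.c₅ * W.graph.dist x y := mul_le_mul_of_nonneg_left hxy hc₅.le
          _ ≤ _ := hloc _ hr4 x hx y hxy
  have hθ : ∀ᶠ r in atTop, ∀ z ∈ D r, (k.spread * r) ^ (-k.κ) ≤ W.theta s z := by
    have hlin : Tendsto (fun r : ℝ => k.spread * r) atTop atTop := tendsto_id.const_mul_atTop hsp
    cases s with
    | csrw =>
      obtain ⟨R₃, hR₃, hloc⟩ := hloc
      filter_upwards [H.subset_ball, hlin.eventually_ge_atTop R₃] with r hsub hr z hz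
      exact hloc _ hr z (hsub z hz)
    | vsrw =>
      filter_upwards [hlin.eventually_ge_atTop 1] with r hr z _
      exact Real.rpow_le_one_of_one_le_of_nonpos hr (by linarith)
  have hsmall : ∀ᶠ r : ℝ in atTop, Real.exp (-((e * r) ^ 2 / (128 * Γ * r ^ γ))) ≤
      (k.spread * r) ^ (-k.κ) * (e * r) ^ (-d) := by
    filter_upwards [eventually_exp_neg_rpow_le (show 0 < e ^ 2 / (128 * Γ) by positivity)
      (show 0 < k.spread ^ (-k.κ) * e ^ (-d) by positivity) (sub_pos.2 hγ2) (-k.κ + -d),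
      eventually_gt_atTop 0] with r h hr
    convert h using 1
    · congr 2
      rw [Real.rpow_sub hr, mul_pow]
      norm_cast
      field_simp
    · rw [Real.rpow_add hr, Real.mul_rpow hsp.le hr.le, Real.mul_rpow he0.le hr.le]; ring
  have hlin : Tendsto (fun r : ℝ => l * r) atTop atTop := tendsto_id.const_mul_atTop hl
  filter_upwards [hup, hρ, hθ, hsmall, H.ball_subset, eventually_ge_atTop 1,
    (tendsto_rpow_atTop (sub_pos.2 hγ1)).eventually_ge_atTop e, hlin.eventually_ge_atTop 1]
    with r hup hρ hθ hsmall hball hr1 hγe hlr x hx y hy hdist t ht0 ht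
  have hr : 0 < r := by linarith
  have hy' : l * r ≤ W.graph.dist x y := by
    have h1 : (W.graph.dist x₀ y : ℝ) ≤ W.graph.dist x₀ x + W.graph.dist x y := by
      exact_mod_cast H.conn.dist_triangle
    have h2 : (W.graph.dist x₀ x : ℝ) < l * r := hx
    linarith
  by_cases hxD : x ∈ D r
  swap
  · rw [hW.killed_off_left s (D r) t y hxD]; positivity
  have hsr : 1 ≤ k.spread * r := by
    have := k.one_le_spread
    nlinarith
  have h := hfar hW hρ1 hρ2 hρ3 hxD hy (L := e * r) (t₀ := r ^ γ) (m := (k.spread * r) ^ (-k.κ))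
    (by positivity) (by
      calc e * r ≤ r ^ (γ - 1) * r := mul_le_mul_of_nonneg_right hγe hr.le
        _ = r ^ γ := by rw [Real.rpow_sub_one hr.ne', div_mul_cancel₀ _ hr.ne'])
    (Real.one_le_rpow hr1 (by linarith)) (by positivity)
    (Real.rpow_le_one_of_one_le_of_nonpos hsr (by linarith)) (hθ x hxD) (hθ y hy) hsmall
    hup (hρ x hx y hy') t ht0 (by
      refine ht.trans_eq ?_
      field_simp)
  refine h.trans_eq ?_
  rw [Real.mul_rpow he0.le hr.le]; ring

end

/-! ### Balayage -/

section

variable {G : Type*} {W : WeightedGraph G} {s : WalkSpeed}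

/-- Duhamel's formula: the heat equation on a finite set with zero boundary values, zero initial
values, and a continuous source. -/
theorem Regular.exists_duhamel (hW : W.Regular) (s : WalkSpeed) (A : Finset G) {f : ℝ → G → ℝ}
    (hf : ∀ z, Continuous fun t => f t z) (a : ℝ) :
    ∃ v : ℝ → G → ℝ, (∀ t, ∀ y ∉ A, v t y = 0) ∧ (∀ x, v a x = 0) ∧
      ∀ t, ∀ x ∈ A, HasDerivAt (fun r => v r x) (W.laplacian s (v t) x + f t x) t := by
  classical
  set lam := hW.eigenvalue s A with hlam
  set φ := hW.eigenfunction s A with hφ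
  set g : A → ℝ → ℝ := fun i r => ∑ z ∈ A, φ i z * f r z * W.theta s z with hg
  have hgc : ∀ i, Continuous (g i) := fun i =>
    continuous_finsetSum _ fun z _ => (continuous_const.mul (hf z)).mul continuous_const
  set I : A → ℝ → ℝ := fun i t =>
    Real.exp (-lam i * t) * ∫ r in a..t, Real.exp (lam i * r) * g i r with hI
  have hId : ∀ i t, HasDerivAt (I i) (-lam i * I i t + g i t) t := by
    intro i t
    have hc : Continuous fun r => Real.exp (lam i * r) * g i r := by
      have := hgc i
      fun_prop
    have h1 := hc.integral_hasStrictDerivAt a t |>.hasDerivAt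
    have h2 : HasDerivAt (fun t => Real.exp (-lam i * t)) (Real.exp (-lam i * t) * -lam i) t := by
      simpa using ((hasDerivAt_id t).const_mul (-lam i)).exp
    refine (h2.mul h1).congr_deriv ?_
    have h3 : Real.exp (-lam i * t) * Real.exp (lam i * t) = 1 := by
      rw [← Real.exp_add]; simp
    simp only [hI]
    linear_combination g i t * h3
  refine ⟨fun t x => ∑ i, I i t * φ i x, fun t y hy => ?_, fun x => ?_, fun t x hx => ?_⟩
  · exact Finset.sum_eq_zero fun i _ => by rw [hφ, hW.eigenfunction_off s A i hy, mul_zero]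
  · exact Finset.sum_eq_zero fun i _ => by simp [hI]
  · refine (HasDerivAt.fun_sum fun i (_ : i ∈ Finset.univ) =>
      (hId i t).mul_const (φ i x)).congr_deriv ?_
    rw [hW.laplacian_sum]
    have h1 : ∑ i, g i t * φ i x = f t x := by
      simp only [hg, Finset.sum_mul]
      rw [Finset.sum_comm]
      have : ∀ z ∈ A, ∑ i, φ i z * f t z * W.theta s z * φ i x =
          if z = x then f t x else 0 := by
        intro z hz
        have h := hW.eigenfunction_complete s A hz hx
        calc _ = (∑ i, φ i z * φ i x) * (f t z * W.theta s z) := by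
              rw [Finset.sum_mul]; exact Finset.sum_congr rfl fun i _ => by ring
          _ = _ := by
              rw [h]
              split_ifs with hzx
              · subst hzx; field_simp [(hW.theta_pos s z).ne']
              · rw [zero_mul]
      rw [Finset.sum_congr rfl this, Finset.sum_ite_eq' A x, if_pos hx]
    rw [← h1, ← Finset.sum_add_distrib]
    refine Finset.sum_congr rfl fun i _ => ?_
    rw [hW.laplacian_const_mul, hW.laplacian_eigenfunction s A i hx]
    ring

/-- Balayage of a non-negative caloric function `u` from a set `B` inside the domain `D`: a function
`w` that agrees with `u` on `B`, solves the heat equation on `D \ B`, vanishes off `D`, and starts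
from zero on `D \ B`. It lies below `u`, so its defect in the heat equation is a non-negative
measure, carried by the inner boundary of `B`. -/
theorem Regular.exists_balayage (hW : W.Regular) {D B : Finset G} (hBD : B ⊆ D) {a b : ℝ}
    (hab : a ≤ b) {u : ℝ → G → ℝ}
    (hcont : ∀ y ∈ D, ContinuousOn (fun t => u t y) (Set.Icc a b))
    (hder : ∀ y ∈ D, ∀ t ∈ Set.Ioo a b, HasDerivAt (fun r => u r y) (W.laplacian s (u t) y) t)
    (hnn : ∀ t ∈ Set.Icc a b, ∀ y, (y ∈ D ∨ ∃ x ∈ D, 0 < W.ω x y) → 0 ≤ u t y) :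
    ∃ w : ℝ → G → ℝ, (∀ t, ∀ y ∈ B, w t y = u t y) ∧ (∀ t, ∀ y ∉ D, w t y = 0) ∧
      (∀ y ∈ D, y ∉ B → w a y = 0) ∧ (∀ y ∈ D, ContinuousOn (fun t => w t y) (Set.Icc a b)) ∧
      ∀ y ∈ D, ∀ t ∈ Set.Ioo a b, ∃ w', HasDerivAt (fun r => w r y) w' t ∧
        W.laplacian s (w t) y ≤ w' ∧
        ((y ∈ B → ∀ z, 0 < W.ω y z → z ∈ B) → w' = W.laplacian s (w t) y) := by
  classical
  set A := D \ B with hA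
  have hAmem : ∀ {y}, y ∈ A ↔ y ∈ D ∧ y ∉ B := Finset.mem_sdiff
  set ue : G → ℝ → ℝ := fun y => Set.IccExtend hab fun t : Set.Icc a b => u t y with hue
  have huec : ∀ y ∈ D, Continuous (ue y) := fun y hy =>
    ((continuousOn_iff_continuous_domRestrict.1 (hcont y hy))).Icc_extend'
  have hueq : ∀ y, ∀ t ∈ Set.Icc a b, ue y t = u t y := fun y t ht => by
    simp only [hue]; rw [Set.IccExtend_of_mem hab _ ht]
  set f : ℝ → G → ℝ := fun t x => 1 / W.theta s x * ∑ y ∈ B, W.ω x y * ue y t with hf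
  have hfc : ∀ z, Continuous fun t => f t z := fun z =>
    continuous_const.mul (continuous_finsetSum _ fun y hy =>
      continuous_const.mul (huec y (hBD hy)))
  obtain ⟨v, hv0, hva, hvd⟩ := hW.exists_duhamel s A hfc a
  have hvc : ∀ x, Continuous fun t => v t x := by
    intro x
    by_cases hx : x ∈ A
    · exact continuous_iff_continuousAt.2 fun t => (hvd t x hx).continuousAt
    · simp only [hv0 _ x hx]; exact continuous_const
  set w : ℝ → G → ℝ := fun t y => if y ∈ B then u t y else v t y with hw
  have hwB : ∀ t, ∀ y ∈ B, w t y = u t y := fun t y hy => if_pos hy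
  have hwA : ∀ t, ∀ y, y ∉ B → w t y = v t y := fun t y hy => if_neg hy
  have hwD : ∀ t, ∀ y ∉ D, w t y = 0 := fun t y hy => by
    rw [hwA t y fun h => hy (hBD h), hv0 t y fun h => hy (hAmem.1 h).1]
  have hLw : ∀ t ∈ Set.Icc a b, ∀ x ∈ A, W.laplacian s (w t) x = W.laplacian s (v t) x + f t x := by
    intro t ht x hx
    have hsplit : w t = fun y => v t y + (if y ∈ B then u t y else 0) := by
      funext y
      by_cases hy : y ∈ B
      · rw [hwB t y hy, if_pos hy, hv0 t y fun h => (hAmem.1 h).2 hy, zero_add]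
      · rw [hwA t y hy, if_neg hy, add_zero]
    rw [hsplit, hW.laplacian_add]
    congr 1
    have hθ := (hW.theta_pos s x).ne'
    have h1 := hW.theta_mul_laplacian_of_zero s (D := B)
      (f := fun y => if y ∈ B then u t y else 0) (fun y hy => if_neg hy) x
    rw [if_neg (hAmem.1 hx).2, mul_zero, sub_zero] at h1
    simp only [hf]
    rw [one_div, ← div_eq_inv_mul, eq_div_iff hθ, mul_comm, h1]
    refine Finset.sum_congr rfl fun y hy => ?_
    rw [if_pos hy, hueq y t ht]
  -- Comparison with `u` on `D \ B`.
  have hle : ∀ t ∈ Set.Icc a b, ∀ x ∈ A, 0 ≤ u t x - w t x := by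
    refine hW.parabolic_nonneg (s := s) (z := fun t x => u t x - w t x) (fun x hx => ?_)
      (fun x hx t ht => ?_) (fun t ht x hx y hy hxy => ?_) fun x hx => ?_
    · simp only [hwA _ x (hAmem.1 hx).2]
      exact (hcont x (hAmem.1 hx).1).sub (hvc x).continuousOn
    · refine ⟨W.laplacian s (u t) x - W.laplacian s (w t) x, ?_, ?_⟩
      · simp only [hwA _ x (hAmem.1 hx).2]
        rw [hLw t (Set.Ioo_subset_Icc_self ht) x hx]
        exact (hder x (hAmem.1 hx).1 t ht).sub (hvd t x hx)
      · rw [hW.laplacian_sub]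
    · by_cases hyB : y ∈ B
      · rw [hwB t y hyB, sub_self]
      · have hyD : y ∉ D := fun h => hy (hAmem.2 ⟨h, hyB⟩)
        rw [hwD t y hyD, sub_zero]
        exact hnn t (Set.Ioo_subset_Icc_self ht) y (Or.inr ⟨x, (hAmem.1 hx).1, hxy⟩)
    · simp only [hwA _ x (hAmem.1 hx).2, hva x, sub_zero]
      exact hnn a (Set.left_mem_Icc.2 hab) x (Or.inl (hAmem.1 hx).1)
  refine ⟨w, hwB, hwD, fun y _ hyB => by rw [hwA a y hyB, hva y], fun y hy => ?_,
    fun y hy t ht => ?_⟩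
  · by_cases hyB : y ∈ B
    · simp only [hwB _ y hyB]; exact hcont y hy
    · simp only [hwA _ y hyB]; exact (hvc y).continuousOn
  · have htI := Set.Ioo_subset_Icc_self ht
    by_cases hyB : y ∈ B
    · refine ⟨W.laplacian s (u t) y, ?_, ?_, fun h => ?_⟩
      · simp only [hwB _ y hyB]; exact hder y hy t ht
      · have h1 : 0 ≤ W.laplacian s (fun z => u t z - w t z) y := by
          refine hW.laplacian_nonneg_of_le fun z hz => ?_
          rw [hwB t y hyB, sub_self]
          by_cases hzB : z ∈ B
          · rw [hwB t z hzB, sub_self]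
          by_cases hzD : z ∈ D
          · exact hle t htI z (hAmem.2 ⟨hzD, hzB⟩)
          · rw [hwD t z hzD, sub_zero]
            exact hnn t htI z (Or.inr ⟨y, hy, hz⟩)
        rw [hW.laplacian_sub] at h1
        linarith
      · exact hW.laplacian_congr (hwB t y hyB).symm fun z hz => (hwB t z (h hyB z hz)).symm
    · have hyA : y ∈ A := hAmem.2 ⟨hy, hyB⟩
      refine ⟨W.laplacian s (w t) y, ?_, le_rfl, fun _ => rfl⟩
      simp only [hwA _ y hyB]
      rw [hLw t htI y hyA]
      exact hvd t y hyA

/-- Time derivative of the pairing of the backward heat kernel with a function `w`: only the defect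
of `w` in the heat equation contributes. -/
theorem Regular.hasDerivAt_flow_sub (hW : W.Regular) {D : Finset G} {w : ℝ → G → ℝ}
    {w' : G → ℝ} {t : ℝ} (hw0 : ∀ y ∉ D, w t y = 0)
    (hw : ∀ y ∈ D, HasDerivAt (fun r => w r y) (w' y) t) (τ : ℝ) (x : G) :
    HasDerivAt (fun r => hW.flow s D (τ - r) (w r) x)
      (∑ y ∈ D, hW.killed s D (τ - t) x y * (w' y - W.laplacian s (w t) y) * W.theta s y) t := by
  have hsym := hW.sum_mul_laplacian_comm s (D := D)
    (f := fun y => hW.killed s D (τ - t) x y) (g := w t)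
    (fun y hy => hW.killed_off_right s D _ x hy) hw0
  have hd : ∀ y ∈ D, HasDerivAt (fun r => hW.killed s D (τ - r) x y * w r y * W.theta s y)
      ((-W.laplacian s (fun y => hW.killed s D (τ - t) x y) y * w t y +
        hW.killed s D (τ - t) x y * w' y) * W.theta s y) t := by
    intro y hy
    have h1 : HasDerivAt (fun r => hW.killed s D r x y)
        (W.laplacian s (fun y => hW.killed s D (τ - t) x y) y) (τ - t) := by
      have h := hW.hasDerivAt_killed s D (τ - t) x hy
      simpa only [hW.killed_comm s D _ _ x] using h
    have h2 : HasDerivAt (fun r : ℝ => τ - r) (-1) t := by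
      simpa using (hasDerivAt_id t).const_sub τ
    have h3 := ((h1.comp t h2).mul (hw y hy)).mul_const (W.theta s y)
    refine h3.congr_deriv ?_
    simp only [Function.comp]; ring
  refine (HasDerivAt.fun_sum hd).congr_deriv ?_
  calc _ = -∑ y ∈ D, W.laplacian s (fun y => hW.killed s D (τ - t) x y) y * w t y * W.theta s y +
        ∑ y ∈ D, hW.killed s D (τ - t) x y * w' y * W.theta s y := by
        rw [← Finset.sum_neg_distrib, ← Finset.sum_add_distrib]
        exact Finset.sum_congr rfl fun y _ => by ring
    _ = _ := by
        rw [hsym, ← Finset.sum_neg_distrib, ← Finset.sum_add_distrib]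
        exact Finset.sum_congr rfl fun y _ => by ring

/-- Parabolic comparison by balayage: if the heat kernel from `(t₁, x₁)` is dominated by `K` times
that from `(t₂, x₂)` at the initial time on `B`, and at all later times on the inner boundary of
`B`, then `u(t₁, x₁) ≤ K u(t₂, x₂)` for every non-negative caloric `u`. -/
theorem Regular.le_of_killed_le (hW : W.Regular) {D B : Finset G} (hBD : B ⊆ D) {a t₁ t₂ : ℝ}
    (ha : a ≤ t₁) (ht : t₁ ≤ t₂) {u : ℝ → G → ℝ}
    (hcont : ∀ y ∈ D, ContinuousOn (fun t => u t y) (Set.Icc a t₂))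
    (hder : ∀ y ∈ D, ∀ t ∈ Set.Ioo a t₂, HasDerivAt (fun r => u r y) (W.laplacian s (u t) y) t)
    (hnn : ∀ t ∈ Set.Icc a t₂, ∀ y, (y ∈ D ∨ ∃ x ∈ D, 0 < W.ω x y) → 0 ≤ u t y)
    {x₁ x₂ : G} (hx₁ : x₁ ∈ B) (hx₂ : x₂ ∈ B) {K : ℝ} (hK : 0 ≤ K)
    (h0 : ∀ y ∈ B, hW.killed s D (t₁ - a) x₁ y ≤ K * hW.killed s D (t₂ - a) x₂ y)
    (hbdry : ∀ y ∈ B, (∃ z ∉ B, 0 < W.ω y z) → ∀ r ∈ Set.Icc a t₁,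
      hW.killed s D (t₁ - r) x₁ y ≤ K * hW.killed s D (t₂ - r) x₂ y) :
    u t₁ x₁ ≤ K * u t₂ x₂ := by
  obtain ⟨w, hwB, hwD, hwa, hwc, hwd⟩ := hW.exists_balayage (s := s) hBD (ha.trans ht) hcont hder hnn
  choose! w' hw'd hw'le hw'eq using hwd
  have hflowc : ∀ τ x, ContinuousOn (fun r => hW.flow s D (τ - r) (w r) x) (Set.Icc a t₂) := by
    intro τ x
    refine continuousOn_finsetSum _ fun y hy => ?_
    have h1 : Continuous fun r => hW.killed s D (τ - r) x y :=
      (hW.continuous_killed s D x y).comp (continuous_const.sub continuous_id)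
    exact (h1.continuousOn.mul (hwc y hy)).mul continuousOn_const
  have hflowd : ∀ τ x, ∀ t ∈ Set.Ioo a t₂, HasDerivAt (fun r => hW.flow s D (τ - r) (w r) x)
      (∑ y ∈ D, hW.killed s D (τ - t) x y * (w' y t - W.laplacian s (w t) y) * W.theta s y) t :=
    fun τ x t ht => hW.hasDerivAt_flow_sub (w' := fun y => w' y t) (hwD t)
      (fun y hy => hw'd y hy t ht) τ x
  have hend : ∀ t, ∀ x ∈ B, hW.flow s D (t - t) (w t) x = u t x := fun t x hx => by
    rw [sub_self, hW.flow_zero s D _ (hBD hx), hwB t x hx]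
  -- `K H₂ - H₁` starts non-negative and increases; `H₂` increases up to time `t₂`.
  set H₁ : ℝ → ℝ := fun r => hW.flow s D (t₁ - r) (w r) x₁ with hH₁
  set H₂ : ℝ → ℝ := fun r => hW.flow s D (t₂ - r) (w r) x₂ with hH₂
  have hmono : MonotoneOn H₂ (Set.Icc a t₂) := by
    refine monotoneOn_of_deriv_nonneg (convex_Icc _ _) (hflowc t₂ x₂) (fun r hr => ?_)
      fun r hr => ?_
    · rw [interior_Icc] at hr
      exact (hflowd t₂ x₂ r hr).differentiableAt.differentiableWithinAt
    · rw [interior_Icc] at hr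
      rw [(hflowd t₂ x₂ r hr).deriv]
      refine Finset.sum_nonneg fun y hy => mul_nonneg (mul_nonneg
        (hW.killed_nonneg s D (by linarith [hr.2]) _ _) ?_) (hW.theta_pos s y).le
      linarith [hw'le y hy r hr]
  have hmono' : MonotoneOn (fun r => K * H₂ r - H₁ r) (Set.Icc a t₁) := by
    have hsub : Set.Icc a t₁ ⊆ Set.Icc a t₂ := Set.Icc_subset_Icc_right ht
    have hd : ∀ r ∈ Set.Ioo a t₁, HasDerivAt (fun r => K * H₂ r - H₁ r) _ r := fun r hr =>
      ((hflowd t₂ x₂ r ⟨hr.1, hr.2.trans_le ht⟩).const_mul K).sub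
        (hflowd t₁ x₁ r ⟨hr.1, hr.2.trans_le ht⟩)
    refine monotoneOn_of_deriv_nonneg (convex_Icc _ _) (((hflowc t₂ x₂).mono hsub).const_mul K |>.sub
      ((hflowc t₁ x₁).mono hsub)) (fun r hr => ?_) fun r hr => ?_
    · rw [interior_Icc] at hr
      exact (hd r hr).differentiableAt.differentiableWithinAt
    · rw [interior_Icc] at hr
      have hr' : r ∈ Set.Ioo a t₂ := ⟨hr.1, hr.2.trans_le ht⟩
      rw [(hd r hr).deriv, Finset.mul_sum, ← Finset.sum_sub_distrib]
      refine Finset.sum_nonneg fun y hy => ?_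
      have hle := hw'le y hy r hr'
      by_cases hyb : y ∈ B ∧ ∃ z ∉ B, 0 < W.ω y z
      · have h1 := hbdry y hyb.1 hyb.2 r (Set.Ioo_subset_Icc_self hr)
        have h2 := mul_nonneg (mul_nonneg (sub_nonneg.2 h1) (sub_nonneg.2 hle))
          (hW.theta_pos s y).le
        linarith
      · rw [hw'eq y hy r hr' fun hyB z hz => by
          by_contra hzB
          exact hyb ⟨hyB, z, hzB, hz⟩]
        simp
  have hstart : 0 ≤ K * H₂ a - H₁ a := by
    simp only [hH₁, hH₂, Regular.flow]
    rw [Finset.mul_sum, ← Finset.sum_sub_distrib]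
    refine Finset.sum_nonneg fun y hy => ?_
    by_cases hyB : y ∈ B
    · have h2 := mul_nonneg (mul_nonneg (sub_nonneg.2 (h0 y hyB))
        (show 0 ≤ w a y by
          rw [hwB a y hyB]
          exact hnn a (Set.left_mem_Icc.2 (ha.trans ht)) y (Or.inl hy))) (hW.theta_pos s y).le
      linarith
    · rw [hwa y hy hyB]; simp
  have h1 := hmono' (Set.left_mem_Icc.2 ha) (Set.right_mem_Icc.2 ha) ha
  have h2 := hmono ⟨ha, ht⟩ (Set.right_mem_Icc.2 (ha.trans ht)) ht
  have e1 : H₁ t₁ = u t₁ x₁ := hend t₁ x₁ hx₁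
  have e2 : H₂ t₂ = u t₂ x₂ := hend t₂ x₂ hx₂
  simp only at h1
  have h3 := mul_le_mul_of_nonneg_left h2 hK
  rw [← e1, ← e2]
  linarith

end

/-! ### The parabolic Harnack inequality -/

section

universe u

/-- The parabolic Harnack inequality in pointwise form. -/
theorem exists_parabolic_harnack {d : ℝ} (hd : 0 < d) (k : Constants) (M : ℕ) :
    ∃ c : ℝ, 0 < c ∧ ∃ C : ℝ, 2 ≤ C ∧ ∀ {G : Type u} {W : WeightedGraph G} {hW : W.Regular}
      {s : WalkSpeed} {x₀ : G} {D : ℝ → Finset G}, Scales hW s d k x₀ D → W.DegreeLE M →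
      W.LocalRegularity s k x₀ → ∀ᶠ R in atTop, ∀ u : ℝ × G → ℝ,
        (∀ t ∈ Set.Icc 0 (4 * R ^ 2), ∀ y ∈ W.closure (W.ball x₀ (C * R)), 0 ≤ u (t, y)) →
        W.Caloric s C x₀ R (R ^ 2) u → ∀ p ∈ W.Qminus x₀ R (R ^ 2), ∀ q ∈ W.Qplus x₀ R (R ^ 2),
          u p ≤ c * u q := by
  have hc₁ := k.c₁_pos
  obtain ⟨l, hl0, hl1, c, hc, hlow⟩ := exists_killed_lower.{u} hd k
  obtain ⟨K, hK, hfar⟩ := exists_killed_far_le.{u} hd k M hl0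
  set U := k.c₁ * (l ^ 2 / 2) ^ (-d / 2) with hU
  have hU0 : 0 < U := by positivity
  refine ⟨max K U / c, by positivity, max 2 (k.spread / l), le_max_left _ _,
    fun {G W hW s x₀ D} H hM hloc => ?_⟩
  have hscale : Tendsto (fun R : ℝ => R / l) atTop atTop := tendsto_id.atTop_div_const hl0
  filter_upwards [hscale.eventually (hlow H), hscale.eventually (hfar H hM hloc),
    hscale.eventually (H.eventually_upper' hd (show 0 < l ^ 2 / 2 by positivity)),
    hscale.eventually H.subset_ball, hscale.eventually H.ball_subset, eventually_gt_atTop 0]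
    with R hlow hfar hup hsub hball hR u hnn hcal p hp q hq
  obtain ⟨t₁, x₁⟩ := p
  obtain ⟨t₂, x₂⟩ := q
  obtain ⟨⟨ht1, ht1'⟩, hx₁⟩ := hp
  obtain ⟨⟨ht2, ht2'⟩, hx₂⟩ := hq
  simp only at ht1 ht1' ht2 ht2' hx₁ hx₂
  set r := R / l with hr
  have hr0 : 0 < r := by positivity
  have hlr : l * r = R := by rw [hr]; field_simp
  rw [hlr] at hlow hfar
  have hR2 : 0 < R ^ 2 := by positivity
  have hrd : 0 < r ^ (-d) := by positivity
  have hDC : ∀ y ∈ D r, y ∈ W.ball x₀ (max 2 (k.spread / l) * R) := fun y hy => by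
    refine ball_mono ?_ (hsub y hy)
    calc k.spread * r = k.spread / l * R := by rw [hr]; ring
      _ ≤ _ := mul_le_mul_of_nonneg_right (le_max_right _ _) hR.le
  have hfin := ball_finite H.conn hW.locFin x₀ (3 * R)
  have hmem : ∀ {y}, y ∈ hfin.toFinset ↔ y ∈ W.ball x₀ (3 * R) := hfin.mem_toFinset
  have hBD : hfin.toFinset ⊆ D r := fun y hy =>
    hball y (ball_mono (by nlinarith) (hmem.1 hy))
  have hB : ∀ x ∈ W.ball x₀ R, x ∈ W.ball x₀ (3 * R) := fun x hx => ball_mono (by linarith) hx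
  have hcomp : ∀ {a b : ℝ}, a ≤ max K U * r ^ (-d) → c * r ^ (-d) ≤ b → a ≤ max K U / c * b := by
    intro a b h1 h2
    refine h1.trans ?_
    calc max K U * r ^ (-d) = max K U / c * (c * r ^ (-d)) := by field_simp
      _ ≤ _ := mul_le_mul_of_nonneg_left h2 (by positivity)
  refine hW.le_of_killed_le (s := s) (u := fun t y => u (t, y)) hBD (a := R ^ 2 / 2) (t₁ := t₁)
    (t₂ := t₂) (by linarith) (by linarith) (fun y hy => ?_) (fun y hy t ht => ?_)
    (fun t ht y hy => ?_) (hmem.2 (hB _ hx₁)) (hmem.2 (hB _ hx₂)) (by positivity)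
    (fun y hy => ?_) fun y hy hz t ht => ?_
  · exact (hcal y (hDC y hy)).2.mono fun t ht => ⟨by linarith [ht.1], by linarith [ht.2]⟩
  · exact (hcal y (hDC y hy)).1 t ⟨by linarith [ht.1], by linarith [ht.2]⟩
  · refine hnn t ⟨by linarith [ht.1], by linarith [ht.2]⟩ y ?_
    rcases hy with hy | ⟨x, hx, hxy⟩
    · exact Or.inl (hDC y hy)
    · exact Or.inr ⟨x, hDC x hx, hxy⟩
  · refine hcomp ?_ (hlow x₂ (hB _ hx₂) y (hmem.1 hy) _ (by linarith) (by linarith))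
    refine (hup _ ?_ (D r) hsub x₁ (hBD (hmem.2 (hB _ hx₁))) y (hBD hy)).trans
      (mul_le_mul_of_nonneg_right (le_max_right _ _) hrd.le)
    rw [← hlr, mul_pow] at ht1 ⊢
    linarith
  · refine hcomp ?_ (hlow x₂ (hB _ hx₂) y (hmem.1 hy) _ (by linarith [ht.2]) (by linarith [ht.1]))
    refine (hfar x₁ hx₁ y (hBD hy) ?_ _ (by linarith [ht.2]) (by linarith [ht.1])).trans
      (mul_le_mul_of_nonneg_right (le_max_left _ _) hrd.le)
    obtain ⟨z, hzB, hyz⟩ := hz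
    have h1 := dist_le_add_one H.conn x₀ hyz
    have h2 : 3 * R ≤ W.graph.dist x₀ z := not_lt.1 fun h => hzB (hmem.2 h)
    linarith

end

end WeightedGraph

end

end RCM

theorem theorem1p5 (s : RCM.WalkSpeed) (d : ℝ) (hd : 0 < d) (M : ℕ) (k : RCM.Constants) :
    ∃ c : ℝ, 0 < c ∧ ∃ C : ℝ, 2 ≤ C ∧
      ∀ {G : Type*} [Countable G] [MeasurableSpace G] [DiscreteMeasurableSpace G]
        (W : RCM.WeightedGraph G) (x₀ : G),
        W.graph.Connected → W.DegreeLE M → W.StandingAssumption s d k x₀ →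
          ∃ R₅ : ℝ, 1 ≤ R₅ ∧ ∀ R ≥ R₅, ∀ u : ℝ × G → ℝ,
            (∀ t ∈ Set.Icc 0 (4 * R ^ 2), ∀ y ∈ W.closure (W.ball x₀ (C * R)), 0 ≤ u (t, y)) →
            W.Caloric s C x₀ R (R ^ 2) u →
              BddAbove (u '' W.Qminus x₀ R (R ^ 2)) ∧
              sSup (u '' W.Qminus x₀ R (R ^ 2)) ≤ c * sInf (u '' W.Qplus x₀ R (R ^ 2)) := by
  obtain ⟨c, hc, C, hC, hmain⟩ := RCM.WeightedGraph.exists_parabolic_harnack hd k M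
  refine ⟨c, hc, C, hC, fun {G} _ _ _ W x₀ hconn hM hA => ?_⟩
  have hW := RCM.WeightedGraph.regular_of_volumeGrowth hd hconn hM hA.volumeGrowth
  obtain ⟨D, hD⟩ := hA.exists_scales hconn hW
  obtain ⟨R₅, hR₅⟩ := Filter.eventually_atTop.1 (hmain hD hM hA.localRegularity)
  refine ⟨max 1 R₅, le_max_left _ _, fun R hR u hnn hcal => ?_⟩
  have h := hR₅ R ((le_max_right _ _).trans hR) u hnn hcal
  have hR1 : 1 ≤ R := (le_max_left _ _).trans hR
  have hx₀ : x₀ ∈ W.ball x₀ R := RCM.WeightedGraph.mem_ball_self (by linarith)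
  have hm : (R ^ 2, x₀) ∈ W.Qminus x₀ R (R ^ 2) := ⟨⟨le_rfl, by simp only; nlinarith⟩, hx₀⟩
  have hp : (3 * R ^ 2, x₀) ∈ W.Qplus x₀ R (R ^ 2) := ⟨⟨le_rfl, by simp only; nlinarith⟩, hx₀⟩
  refine ⟨⟨c * u (3 * R ^ 2, x₀), ?_⟩, csSup_le (Set.Nonempty.image u ⟨_, hm⟩) ?_⟩
  · rintro _ ⟨p, hp', rfl⟩
    exact h p hp' _ hp
  · rintro _ ⟨p, hp', rfl⟩
    rw [← div_le_iff₀' hc]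
    refine le_csInf (Set.Nonempty.image u ⟨_, hp⟩) ?_
    rintro _ ⟨q, hq, rfl⟩
    rw [div_le_iff₀' hc]
    exact h p hp' q hq
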